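/- Let $c \ge 1$ be an integer. A *Lazard series of length $c$* of a Lie algebra $L$ over a field $F$ is a descending chain of subalgebras $L = L_1 \supseteq L_2 \supseteq \dots \supseteq L_{c+1} = 0$ with $[L_i, L_j] \subseteq L_{i+j}$ for all $i,j \ge 1$ (where $L_k = 0$ for $k > c$); a *Lazard Lie algebra* is a Lie algebra with a distinguished Lazard series. Lazard series of groups and *Lazard groups* are defined in the same way, with subgroups and group commutators. For a field $F$ let $\mathbb{L}_{c,F}$ be the class of finitely generated Lazard Lie algebras over $F$ of nilpotency class $\le c$, in the language $\{+,-,0,(\lambda\cdot)_{\lambda\in F},[\cdot,\cdot],P_1,\dots,P_{c+1}\}$, where $P_i$ is a predicate for the $i$-th term of the series. For a prime $p$ let $\mathbb{G}_{c,p}$ be the class of finite Lazard groups $G$ of nilpotency class $\le c$ and exponent $p$ ($x^p=1$ for all $x \in G$), in the language $\{\cdot,{}^{-1},1,P_1,\dots,P_{c+1}\}$. A class of finitely generated structures is a *Fraïssé class* if it is nonempty, closed under isomorphism, contains countably many isomorphism types, is closed under substructures, and has the joint embedding and amalgamation properties. A *Fraïssé limit* of it is a countable structure $M$ such that every isomorphism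 between finitely generated substructures of $M$ extends to an automorphism of $M$ and such that the structures isomorphic to finitely generated substructures of $M$ are exactly the members of the class. A structure $M$ is *uniformly locally finite* if there is $f : \mathbb{N} \to \mathbb{N}$ such that every substructure generated by $n$ elements has at most $f(n)$ elements. **Theorem.** 1. For every field $F$, $\mathbb{L}_{c,F}$ is a nonempty class of finitely generated structures that is closed under isomorphism and under substructures and has the joint embedding and amalgamation properties. If $F$ is countable or $c = 1$, it also contains only countably many isomorphism types, so it is a Fraïssé class. 2. If $F$ is countable, $\mathbb{L}_{c,F}$ has a Fraïssé limit $\mathbf{L}_{c,F}$. 3. If $F$ is finite, the Fraïssé limit $\mathbf{L}_{c,F}$ is uniformly locally finite, and its theory $T_{c,F} = \mathrm{Th}(\mathbf{L}_{c,F})$ is $\omega$-categorical and has quantifier elimination. 4. If $p$ is a prime with $c < p$, then $\mathbb{G}_{c,p}$ is a Fraïssé class; it has a Fraïssé limit $\mathbf{G}_{c,p}$, and $\mathrm{Th}(\mathbf{G}_{c,p})$ is $\omega$-categorical and has quantifier elimination. -/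

import Mathlib

open FirstOrder FirstOrder.Language CategoryTheory

universe u v w

namespace LazardFraisse

/-! ### General model theory -/

section General

variable {L : FirstOrder.Language.{u, v}}

/-- A nonempty class of finitely generated structures, closed under isomorphism, with the
hereditary property (closure under arbitrary substructures), the joint embedding property and the
amalgamation property.  There is no countability requirement. -/
structure IsAmalgamationClass (K : Set (Bundled.{w} L.Structure)) : Prop where
  nonempty : K.Nonempty
  fg : ∀ M ∈ K, Structure.FG L M
  iso_closed : ∀ M N : Bundled.{w} L.Structure, Nonempty (M ≃[L] N) → M ∈ K → N ∈ K
  hereditary : ∀ M ∈ K, ∀ S : L.Substructure M, Bundled.of (c := L.Structure) S ∈ K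
  jointEmbedding : JointEmbedding K
  amalgamation : Amalgamation K

/-- A Fraïssé class: additionally there are only countably many isomorphism types. -/
structure IsFraisseClass (K : Set (Bundled.{w} L.Structure)) : Prop
    extends IsAmalgamationClass K where
  countable : (Quotient.mk' '' K).Countable

/-- Some `f : ℕ → ℕ` bounds the size of every substructure generated by `n` elements by `f n`. -/
def UniformlyLocallyFinite (L : FirstOrder.Language.{u, v}) (M : Type w) [L.Structure M] : Prop :=
  ∃ f : ℕ → ℕ, ∀ (n : ℕ) (a : Fin n → M),
    (Substructure.closure L (Set.range a) : Set M).encard ≤ f n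

/-- Up to isomorphism there is exactly one countably infinite model
(models are taken in the universe `w`). -/
def OmegaCategorical (T : L.Theory) : Prop :=
  (∃ M : Theory.ModelType.{u, v, w} T, Cardinal.mk M = Cardinal.aleph0) ∧
    Cardinal.Categorical Cardinal.aleph0.{w} T

/-- Every formula is equivalent modulo `T` to a quantifier-free one in the same variables. -/
def HasQuantifierElimination (T : L.Theory) : Prop :=
  ∀ (n : ℕ) (φ : L.Formula (Fin n)),
    ∃ ψ : L.Formula (Fin n), BoundedFormula.IsQF ψ ∧ Theory.Iff T φ ψ

end General

/-! ### Lazard Lie algebras -/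

/-- The function symbols `+`, `-`, `0`, `[·,·]` and `r •` (for `r : F`). -/
inductive LieFunc (F : Type u) : ℕ → Type u
  | add : LieFunc F 2
  | neg : LieFunc F 1
  | zero : LieFunc F 0
  | bracket : LieFunc F 2
  | smul (r : F) : LieFunc F 1

/-- The unary predicate symbols `P₁, …, P_{c+1}`; the symbol `pred i` is `P_{i+1}`. -/
inductive LazardRel (c : ℕ) : ℕ → Type
  | pred (i : Fin (c + 1)) : LazardRel c 1

/-- The language of Lie algebras over `F` with predicates for a Lazard series of length `c`. -/
def lieLang (c : ℕ) (F : Type u) : FirstOrder.Language.{u, 0} where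
  Functions := LieFunc F
  Relations := LazardRel c

instance countable_lieLang_functions (c : ℕ) (F : Type u) [Countable F] :
    Countable (Σ l, (lieLang c F).Functions l) := by
  let g : (Σ l, (lieLang c F).Functions l) → Fin 4 ⊕ F := fun x =>
    match x with
    | ⟨_, LieFunc.add⟩ => Sum.inl 0
    | ⟨_, LieFunc.neg⟩ => Sum.inl 1
    | ⟨_, LieFunc.zero⟩ => Sum.inl 2
    | ⟨_, LieFunc.bracket⟩ => Sum.inl 3
    | ⟨_, LieFunc.smul r⟩ => Sum.inr r
  refine Function.Injective.countable (f := g) ?_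
  rintro ⟨_, _ | _ | _ | _ | _⟩ ⟨_, _ | _ | _ | _ | _⟩ h <;> simp_all [g]

/-- `H₁ ⊇ H₂ ⊇ …` is a Lazard series of length `c` of the Lie algebra `A`, with the convention
`H_k = 0` for all `k > c`.  The value `H 0` plays no role. -/
structure IsLieLazardSeries (c : ℕ) {F : Type u} [Field F] {A : Type w} [LieRing A]
    [LieAlgebra F A] (H : ℕ → LieSubalgebra F A) : Prop where
  one : H 1 = ⊤
  anti : ∀ i, 1 ≤ i → H (i + 1) ≤ H i
  bot : ∀ k, c < k → H k = ⊥
  lie_mem : ∀ i j, 1 ≤ i → 1 ≤ j → ∀ x ∈ H i, ∀ y ∈ H j, ⁅x, y⁆ ∈ H (i + j)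

/-- The `lieLang c F`-structure `M` is a Lazard Lie algebra over `F` of nilpotency class at most
`c`: its function symbols are the operations of a Lie algebra over `F` of class at most `c`, and
its predicates `P₁, …, P_{c+1}` are the terms of a Lazard series. -/
def IsLazardLieAlgebra (c : ℕ) (F : Type u) [Field F] (M : Type w) [(lieLang c F).Structure M] :
    Prop :=
  ∃ (_ : LieRing M) (_ : LieAlgebra F M) (H : ℕ → LieSubalgebra F M),
    (∀ x y : M, Structure.funMap (L := lieLang c F) LieFunc.add ![x, y] = x + y) ∧
    (∀ x : M, Structure.funMap (L := lieLang c F) LieFunc.neg ![x] = -x) ∧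
    (Structure.funMap (L := lieLang c F) LieFunc.zero ![] = (0 : M)) ∧
    (∀ x y : M, Structure.funMap (L := lieLang c F) LieFunc.bracket ![x, y] = ⁅x, y⁆) ∧
    (∀ (r : F) (x : M), Structure.funMap (L := lieLang c F) (LieFunc.smul r) ![x] = r • x) ∧
    (∀ (i : Fin (c + 1)) (x : M),
      Structure.RelMap (L := lieLang c F) (LazardRel.pred i) ![x] ↔ x ∈ H (i + 1)) ∧
    IsLieLazardSeries c H ∧
    LieModule.lowerCentralSeries F M M c = ⊥

/-- The class of finitely generated Lazard Lie algebras over `F` of nilpotency class at most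
`c`. -/
def lazardLieAlgebras (c : ℕ) (F : Type u) [Field F] :
    Set (Bundled.{u} (lieLang c F).Structure) :=
  {M | IsLazardLieAlgebra c F M ∧ Structure.FG (lieLang c F) M}

/-! ### Lazard groups -/

/-- The function symbols `·`, `⁻¹`, `1`. -/
inductive GroupFunc : ℕ → Type
  | mul : GroupFunc 2
  | inv : GroupFunc 1
  | one : GroupFunc 0

/-- The language of groups with predicates for a Lazard series of length `c`. -/
def groupLang (c : ℕ) : FirstOrder.Language.{0, 0} where
  Functions := GroupFunc
  Relations := LazardRel c

instance countable_groupLang_functions (c : ℕ) :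
    Countable (Σ l, (groupLang c).Functions l) := by
  let g : (Σ l, (groupLang c).Functions l) → Fin 3 := fun x =>
    match x with
    | ⟨_, GroupFunc.mul⟩ => 0
    | ⟨_, GroupFunc.inv⟩ => 1
    | ⟨_, GroupFunc.one⟩ => 2
  refine Function.Injective.countable (f := g) ?_
  rintro ⟨_, _ | _ | _⟩ ⟨_, _ | _ | _⟩ h <;> simp_all [g]

/-- `H₁ ⊇ H₂ ⊇ …` is a Lazard series of length `c` of the group `G`, with the convention
`H_k = 1` for all `k > c`.  The value `H 0` plays no role. -/
structure IsGroupLazardSeries (c : ℕ) {G : Type w} [Group G] (H : ℕ → Subgroup G) : Prop where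
  one : H 1 = ⊤
  anti : ∀ i, 1 ≤ i → H (i + 1) ≤ H i
  bot : ∀ k, c < k → H k = ⊥
  commutator_le : ∀ i j, 1 ≤ i → 1 ≤ j → ⁅H i, H j⁆ ≤ H (i + j)

/-- The `groupLang c`-structure `M` is a Lazard group of exponent `p` (that is, `x ^ p = 1` for
all `x`, so that the trivial group is allowed) and nilpotency class at most `c`. -/
def IsLazardGroup (c p : ℕ) (M : Type w) [(groupLang c).Structure M] : Prop :=
  ∃ (_ : Group M) (H : ℕ → Subgroup M),
    (∀ x y : M, Structure.funMap (L := groupLang c) GroupFunc.mul ![x, y] = x * y) ∧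
    (∀ x : M, Structure.funMap (L := groupLang c) GroupFunc.inv ![x] = x⁻¹) ∧
    (Structure.funMap (L := groupLang c) GroupFunc.one ![] = (1 : M)) ∧
    (∀ (i : Fin (c + 1)) (x : M),
      Structure.RelMap (L := groupLang c) (LazardRel.pred i) ![x] ↔ x ∈ H (i + 1)) ∧
    IsGroupLazardSeries c H ∧
    Subgroup.lowerCentralSeries (⊤ : Subgroup M) c = ⊥ ∧
    (∀ x : M, x ^ p = 1)

/-- The class of finite Lazard groups of exponent `p` and nilpotency class at most `c`. -/
def lazardGroups (c p : ℕ) : Set (Bundled.{w} (groupLang c).Structure) :=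
  {M | IsLazardGroup c p M ∧ Finite M}

end LazardFraisse

/-! The heart of the matter is amalgamation, and it is reduced to extensions by one element. Call C
⊂ A a step of weight i if C is an ideal of codimension one (for groups: a normal subgroup with A =
C⟨a⟩), the new element a has weight i, and everything of weight greater than i already lies in C.
Every embedding in the class is a composition of steps: always adjoin a missing element of the
greatest possible weight (`exists_lieStep_lt`, `exists_groupStep_lt`).

Two steps over C, by a of weight i and b of weight j, are amalgamated by hand
(`IsLieStep.exists_amalgam`). The elements a and b act on C by derivations δ and ε that raise
weights by i and j. Inside the semidirect sum of C with Der(C) × F², where the plane F² is abelian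
and acts trivially, send a to (δ, e₁) and b to (ε, e₂); the plane keeps a and b independent modulo
C. The bracket [a, b] becomes the derivation [δ, ε], of weight at least i + j. The amalgam is
spanned by C, a, b and the derivations of weight at least i + j, so over A it is not one step: it is
a step of weight j together with further steps of weight at least i + j.

These extra steps are why towers need a termination argument. Measure a pair of towers by the
multiset of all sums of a weight on one side and a weight on the other. Amalgamating one step
replaces some sums by strictly larger ones, and weights are bounded by c, so the reversed sums
decrease in the Dershowitz–Manna order (`hasSteppedAmalgam_of_steps`). Joint embedding is
amalgamation over the trivial structure.

For groups the same scheme is run directly, with Aut(C) and a plane over ℤ/p in place of Der(C) and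
F². The new difficulty is exponent p. The amalgam is generated by elements of order dividing p, and
for c < p such elements form a subgroup of any group with a Lazard series of length c
(`IsGroupLazardSeries.mul_pow_eq_one`). This rests on the closure of polynomial sequences under
products and on the divisibility of binomial coefficients by p.

The limit is the direct limit of a chain in which every extension problem is eventually solved. When
F is finite, and for groups, nilpotency bounds the size of n-generated members. Hence finitely many
quantifier-free formulas isolate the quantifier-free types of n-tuples. Ultrahomogeneity then gives
quantifier elimination, and back-and-forth gives ω-categoricity. -/

namespace LazardFraisse

/-! ### Towers of one-step extensions and their amalgamation -/

section Towers

variable {L : FirstOrder.Language.{u, v}}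

/-- The inverse of a surjective embedding. -/
noncomputable def embeddingInverse {A B : Type*} [L.Structure A] [L.Structure B] (f : A ↪[L] B)
    (h : Function.Surjective f) : B ↪[L] A :=
  let e : A ≃[L] B :=
    { Equiv.ofBijective f ⟨f.injective, h⟩ with
      map_fun' := f.map_fun'
      map_rel' := f.map_rel' }
  e.symm.toEmbedding

theorem apply_embeddingInverse {A B : Type*} [L.Structure A] [L.Structure B] (f : A ↪[L] B)
    (h : Function.Surjective f) (b : B) : f (embeddingInverse f h b) = b :=
  (Equiv.ofBijective f ⟨f.injective, h⟩).apply_symm_apply b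

theorem embeddingInverse_apply {A B : Type*} [L.Structure A] [L.Structure B] (f : A ↪[L] B)
    (h : Function.Surjective f) (a : A) : embeddingInverse f h (f a) = a :=
  f.injective (apply_embeddingInverse f h (f a))

theorem embeddingInverse_surjective {A B : Type*} [L.Structure A] [L.Structure B] (f : A ↪[L] B)
    (h : Function.Surjective f) : Function.Surjective (embeddingInverse f h) :=
  fun a => ⟨f a, embeddingInverse_apply f h a⟩

variable (K : Set (Bundled.{w} L.Structure))
  (S : ∀ ⦃A B : Bundled.{w} L.Structure⦄, (A ↪[L] B) → ℕ → Prop)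

/-- `StepTower K S f w` says that `f` is a composition of steps whose weights form the multiset
`w`, and of a surjective embedding, with all the intermediate structures in `K`. -/
inductive StepTower : ∀ ⦃A B : Bundled.{w} L.Structure⦄, (A ↪[L] B) → Multiset ℕ → Prop
  | nil {A B : Bundled.{w} L.Structure} (f : A ↪[L] B) (hf : Function.Surjective f) :
      StepTower f 0
  | cons {A B C : Bundled.{w} L.Structure} (f : A ↪[L] B) (g : B ↪[L] C) (i : ℕ)
      (w : Multiset ℕ) (hB : B ∈ K) (hf : S f i) (hg : StepTower g w) :
      StepTower (g.comp f) (i ::ₘ w)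

variable {K S}

theorem StepTower.surjective {A B : Bundled.{w} L.Structure} {f : A ↪[L] B} {w : Multiset ℕ}
    (h : StepTower K S f w) (hw : w = 0) : Function.Surjective f := by
  cases h with
  | nil f hf => exact hf
  | cons f g i w hB hf hg => simp at hw

theorem StepTower.exists_cons {A B : Bundled.{w} L.Structure} {f : A ↪[L] B} {w : Multiset ℕ}
    (h : StepTower K S f w) (hw : w ≠ 0) :
    ∃ (i : ℕ) (v : Multiset ℕ) (C : Bundled.{w} L.Structure) (g : A ↪[L] C) (k : C ↪[L] B),
      C ∈ K ∧ S g i ∧ StepTower K S k v ∧ f = k.comp g ∧ w = i ::ₘ v := by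
  cases h with
  | nil f hf => simp at hw
  | cons f g i w hB hf hg => exact ⟨i, w, _, f, g, hB, hf, hg, rfl, rfl⟩

theorem StepTower.mem {A B : Bundled.{w} L.Structure} {f : A ↪[L] B} {w : Multiset ℕ}
    (h : StepTower K S f w) {P : ℕ → Prop}
    (hS : ∀ (A B : Bundled.{w} L.Structure) (f : A ↪[L] B) (i : ℕ), S f i → P i) :
    ∀ i ∈ w, P i := by
  induction h with
  | nil f hf => simp
  | cons f g i w hB hf hg ih =>
    intro j hj
    rcases Multiset.mem_cons.1 hj with rfl | hj
    · exact hS _ _ f _ hf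
    · exact ih j hj

section

variable (hS : ∀ (A' A B : Bundled.{w} L.Structure) (e : A' ↪[L] A) (f : A ↪[L] B) (i : ℕ),
  Function.Surjective e → S f i → S (f.comp e) i)
include hS

theorem StepTower.precomp {A' A B : Bundled.{w} L.Structure} {f : A ↪[L] B} {w : Multiset ℕ}
    (h : StepTower K S f w) (e : A' ↪[L] A) (he : Function.Surjective e) :
    StepTower K S (f.comp e) w := by
  cases h with
  | nil f hf => exact .nil _ (hf.comp he)
  | cons f g i w hB hf hg =>
    rw [Embedding.comp_assoc]
    exact .cons _ _ _ _ hB (hS _ _ _ e f i he hf) hg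

theorem StepTower.comp {A B C : Bundled.{w} L.Structure} {f : A ↪[L] B} {v : Multiset ℕ}
    (hf : StepTower K S f v) {g : B ↪[L] C} {w : Multiset ℕ} (hg : StepTower K S g w) :
    StepTower K S (g.comp f) (v + w) := by
  induction hf with
  | nil f hf => simpa using hg.precomp hS f hf
  | cons f h i v hB hf hh ih =>
    rw [← Embedding.comp_assoc, Multiset.cons_add]
    exact .cons _ _ _ _ hB hf (ih hg)

end

theorem StepTower.single {A B : Bundled.{w} L.Structure} {f : A ↪[L] B} {i : ℕ} (hB : B ∈ K)
    (h : S f i) : StepTower K S f {i} := by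
  have := StepTower.cons (K := K) f (Embedding.refl L B) i 0 hB h
    (.nil _ Function.surjective_id)
  rwa [Embedding.refl_comp] at this

variable (K S) in
/-- `f` and `g` have an amalgam over the common domain such that the weights in `v` and `w` occur
again on the opposite sides, together with weights which are sums of larger ones. -/
def HasSteppedAmalgam {C A B : Bundled.{w} L.Structure} (f : C ↪[L] A) (g : C ↪[L] B)
    (v w : Multiset ℕ) : Prop :=
  ∃ (D : Bundled.{w} L.Structure) (f' : A ↪[L] D) (g' : B ↪[L] D) (e₁ e₂ : Multiset ℕ),
    D ∈ K ∧ f'.comp f = g'.comp g ∧ StepTower K S f' (w + e₁) ∧ StepTower K S g' (v + e₂) ∧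
    (∀ x ∈ e₁, ∃ i ∈ v, ∃ j ∈ w, i + j ≤ x) ∧ (∀ x ∈ e₂, ∃ i ∈ v, ∃ j ∈ w, i + j ≤ x)

theorem HasSteppedAmalgam.symm {C A B : Bundled.{w} L.Structure} {f : C ↪[L] A} {g : C ↪[L] B}
    {v w : Multiset ℕ} (h : HasSteppedAmalgam K S f g v w) : HasSteppedAmalgam K S g f w v := by
  obtain ⟨D, f', g', e₁, e₂, hD, hc, hf, hg, h₁, h₂⟩ := h
  refine ⟨D, g', f', e₂, e₁, hD, hc.symm, hg, hf, fun x hx => ?_, fun x hx => ?_⟩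
  · obtain ⟨i, hi, j, hj, h⟩ := h₂ x hx
    exact ⟨j, hj, i, hi, by omega⟩
  · obtain ⟨i, hi, j, hj, h⟩ := h₁ x hx
    exact ⟨j, hj, i, hi, by omega⟩

/-- The pairwise sums of the weights, reversed by the bound `2 * N`: in the Dershowitz–Manna order
this measures how hard it is to amalgamate towers with these weights. -/
def pairMeasure (N : ℕ) (v w : Multiset ℕ) : Multiset ℕ :=
  (v ×ˢ w).map fun x => 2 * N - (x.1 + x.2)

theorem pairMeasure_comm (N : ℕ) (v w : Multiset ℕ) : pairMeasure N v w = pairMeasure N w v := by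
  unfold pairMeasure
  induction v using Multiset.induction_on with
  | empty => simp
  | cons a s ih => simp [Multiset.cons_product, Multiset.product_cons, ih, add_comm]

theorem pairMeasure_add_left (N : ℕ) (v v' w : Multiset ℕ) :
    pairMeasure N (v + v') w = pairMeasure N v w + pairMeasure N v' w := by
  simp [pairMeasure, Multiset.add_product]

theorem pairMeasure_add_right (N : ℕ) (v w w' : Multiset ℕ) :
    pairMeasure N v (w + w') = pairMeasure N v w + pairMeasure N v w' := by
  simp [pairMeasure, Multiset.product_add]

theorem pairMeasure_ne_zero {N : ℕ} {v w : Multiset ℕ} (hv : v ≠ 0) (hw : w ≠ 0) :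
    pairMeasure N v w ≠ 0 := by
  obtain ⟨i, hi⟩ := Multiset.exists_mem_of_ne_zero hv
  obtain ⟨j, hj⟩ := Multiset.exists_mem_of_ne_zero hw
  intro h
  have : (2 * N - (i + j)) ∈ pairMeasure N v w :=
    Multiset.mem_map.2 ⟨(i, j), Multiset.mem_product.2 ⟨hi, hj⟩, rfl⟩
  simp [h] at this

/-- Used when only the first step of one tower is amalgamated: a nonempty block of pairs is dropped
and nothing replaces it. -/
theorem pairMeasure_lt_left {N : ℕ} {v v' w : Multiset ℕ} (hv : v' ≠ 0) (hw : w ≠ 0) :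
    (pairMeasure N v w).IsDershowitzMannaLT (pairMeasure N (v + v') w) :=
  ⟨pairMeasure N v w, 0, pairMeasure N v' w, pairMeasure_ne_zero hv hw, by simp,
    pairMeasure_add_left .., by simp⟩

/-- The pairs of `i` with `w` are traded for pairs of `v` with `e`. A member of `e` is at least i +
j for some j in `w`, and adding a weight from `v`, which is at least 1, makes the new sum strictly
exceed i + j. The bound `N` keeps all sums within 2N, so truncated subtraction reverses the order
strictly. -/
theorem pairMeasure_lt_right {N i : ℕ} {v w e : Multiset ℕ} (hi : i ≤ N)
    (hv : ∀ x ∈ v, 1 ≤ x ∧ x ≤ N) (hw : ∀ x ∈ w, x ≤ N) (he : ∀ x ∈ e, x ≤ N)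
    (hw0 : w ≠ 0) (hie : ∀ x ∈ e, ∃ j ∈ w, i + j ≤ x) :
    (pairMeasure N v (w + e)).IsDershowitzMannaLT (pairMeasure N (i ::ₘ v) w) := by
  refine ⟨pairMeasure N v w, pairMeasure N v e, pairMeasure N {i} w,
    pairMeasure_ne_zero (by simp) hw0, pairMeasure_add_right .., ?_, ?_⟩
  · rw [← Multiset.singleton_add, pairMeasure_add_left, add_comm]
  · intro y hy
    obtain ⟨⟨a, x⟩, hax, rfl⟩ := Multiset.mem_map.1 hy
    obtain ⟨ha, hx⟩ := Multiset.mem_product.1 hax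
    obtain ⟨j, hj, hij⟩ := hie x hx
    refine ⟨2 * N - (i + j), Multiset.mem_map.2 ⟨(i, j), ?_, rfl⟩, ?_⟩
    · simpa using hj
    · have h₁ := hv a ha
      have h₂ := hw j hj
      have h₃ := he x hx
      dsimp only at ha hx ⊢
      omega

/-- Amalgamation of one-step extensions implies amalgamation of towers. -/
theorem hasSteppedAmalgam_of_steps (N : ℕ)
    (hS : ∀ (A' A B : Bundled.{w} L.Structure) (e : A' ↪[L] A) (f : A ↪[L] B) (i : ℕ),
      Function.Surjective e → S f i → S (f.comp e) i)
    (hN : ∀ (A B : Bundled.{w} L.Structure) (f : A ↪[L] B) (i : ℕ), S f i → 1 ≤ i ∧ i ≤ N)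
    (base : ∀ (C A B : Bundled.{w} L.Structure) (f : C ↪[L] A) (g : C ↪[L] B) (i j : ℕ),
      C ∈ K → A ∈ K → B ∈ K → S f i → S g j → HasSteppedAmalgam K S f g {i} {j})
    {C A B : Bundled.{w} L.Structure} (f : C ↪[L] A) (g : C ↪[L] B) {v w : Multiset ℕ}
    (hC : C ∈ K) (hA : A ∈ K) (hB : B ∈ K) (hf : StepTower K S f v) (hg : StepTower K S g w) :
    HasSteppedAmalgam K S f g v w := by
  have hwf := Multiset.wellFounded_isDershowitzMannaLT (α := ℕ)
  induction hm : pairMeasure N v w using hwf.induction generalizing C A B f g v w with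
  | _ m IH =>
  subst hm
  -- A tower without steps is an isomorphism, and the other extension itself is the amalgam.
  have onto : ∀ {C A B : Bundled.{w} L.Structure} (f : C ↪[L] A) (g : C ↪[L] B)
      {w : Multiset ℕ}, B ∈ K → Function.Surjective f → StepTower K S g w →
      HasSteppedAmalgam K S f g 0 w := by
    intro C A B f g w hB hf hg
    refine ⟨B, g.comp (embeddingInverse f hf), Embedding.refl L B, 0, 0, hB, ?_, ?_,
      .nil _ Function.surjective_id, by simp, by simp⟩
    · ext x
      simp [embeddingInverse_apply]
    · simpa using hg.precomp hS _ (embeddingInverse_surjective f hf)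
  by_cases hv : v = 0
  · subst hv
    exact onto f g hB (hf.surjective rfl) hg
  by_cases hw : w = 0
  · subst hw
    exact (onto g f hA (hg.surjective rfl) hf).symm
  -- The inductive step for a tower with at least two steps on the left. The induction hypothesis is
  -- passed as an argument so that the same statement also serves with the two sides exchanged.
  have split : ∀ {C A B : Bundled.{w} L.Structure} (f : C ↪[L] A) (g : C ↪[L] B)
      {v' v w : Multiset ℕ}, C ∈ K → A ∈ K → B ∈ K → StepTower K S f v' → StepTower K S g w →
      (∃ i, v' = i ::ₘ v) → v ≠ 0 → w ≠ 0 →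
      (∀ {C A B : Bundled.{w} L.Structure} (f : C ↪[L] A) (g : C ↪[L] B) {a b : Multiset ℕ},
        C ∈ K → A ∈ K → B ∈ K → StepTower K S f a → StepTower K S g b →
        (pairMeasure N a b).IsDershowitzMannaLT (pairMeasure N v' w) →
        HasSteppedAmalgam K S f g a b) →
      HasSteppedAmalgam K S f g v' w := by
    intro C A B f g v' v w hC hA hB hf hg ⟨i₀, hi₀⟩ hv hw IH
    obtain ⟨i, v₂, A₁, f₁, f₂, hA₁, hf₁, hf₂, rfl, hvi⟩ := hf.exists_cons (by simp [hi₀])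
    have hv₂ : v₂ ≠ 0 := by
      rintro rfl
      rw [hi₀] at hvi
      have := congrArg Multiset.card hvi
      simp at this
      exact hv this
    subst hvi
    have hi := hN _ _ _ _ hf₁
    -- First square: the bottom step of the left tower against the whole right tower.
    obtain ⟨D₁, f₁', g₁', e₁, e₂, hD₁, hc₁, hf₁', hg₁', he₁, he₂⟩ :=
      IH f₁ g hC hA₁ hB (.single hA₁ hf₁) hg (by
        rw [← Multiset.singleton_add]
        exact pairMeasure_lt_left hv₂ hw)
    have hw' := hg.mem hN
    have hwe := hf₁'.mem hN
    have hvv := hf₂.mem hN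
    -- Second square, pasted onto the first: the rest of the left tower against the tower of `f₁'`,
    -- which has picked up the extra weights `e₁`.
    obtain ⟨D, h', k, e₃, e₄, hD, hc₂, hh', hk, he₃, he₄⟩ :=
      IH f₂ f₁' hA₁ hA hD₁ hf₂ hf₁' (pairMeasure_lt_right hi.2 hvv (fun x hx => (hw' x hx).2)
        (fun x hx => (hwe x (Multiset.mem_add.2 (Or.inr hx))).2) hw (fun x hx => by
          obtain ⟨i', hi', j, hj, h⟩ := he₁ x hx
          rw [Multiset.mem_singleton] at hi'
          subst hi'
          exact ⟨j, hj, h⟩))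
    have key : ∀ x, (∃ a ∈ v₂, ∃ b ∈ w + e₁, a + b ≤ x) →
        ∃ a ∈ i ::ₘ v₂, ∃ b ∈ w, a + b ≤ x := by
      rintro x ⟨a, ha, b, hb, hab⟩
      rcases Multiset.mem_add.1 hb with hb | hb
      · exact ⟨a, Multiset.mem_cons_of_mem ha, b, hb, hab⟩
      · obtain ⟨i', hi', j, hj, h⟩ := he₁ b hb
        exact ⟨i', by simp [Multiset.mem_singleton.1 hi'], j, hj, by omega⟩
    have key' : ∀ x, (∃ a ∈ ({i} : Multiset ℕ), ∃ b ∈ w, a + b ≤ x) →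
        ∃ a ∈ i ::ₘ v₂, ∃ b ∈ w, a + b ≤ x := by
      rintro x ⟨a, ha, b, hb, hab⟩
      exact ⟨a, by simp [Multiset.mem_singleton.1 ha], b, hb, hab⟩
    refine ⟨D, h', k.comp g₁', e₁ + e₃, e₂ + e₄, hD, ?_, ?_, ?_, ?_, ?_⟩
    · rw [← Embedding.comp_assoc, hc₂, Embedding.comp_assoc, hc₁, Embedding.comp_assoc]
    · rwa [← add_assoc]
    · have := hg₁'.comp hS hk
      rwa [show i ::ₘ v₂ + (e₂ + e₄) = {i} + e₂ + (v₂ + e₄) by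
        rw [← Multiset.singleton_add]; abel]
    · intro x hx
      rcases Multiset.mem_add.1 hx with hx | hx
      · exact key' x (he₁ x hx)
      · exact key x (he₃ x hx)
    · intro x hx
      rcases Multiset.mem_add.1 hx with hx | hx
      · exact key' x (he₂ x hx)
      · exact key x (he₄ x hx)
  obtain ⟨i, v₂, A₁, f₁, f₂, hA₁, hf₁, hf₂, rfl, rfl⟩ := hf.exists_cons hv
  obtain ⟨j, w₂, B₁, g₁, g₂, hB₁, hg₁, hg₂, rfl, rfl⟩ := hg.exists_cons hw
  by_cases hv₂ : v₂ = 0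
  · by_cases hw₂ : w₂ = 0
    · subst hv₂ hw₂
      have hf₂' := hf₂.surjective rfl
      have hg₂' := hg₂.surjective rfl
      -- One step on each side. Each tower still ends in an isomorphism, which is inverted and
      -- absorbed into the map to the amalgam.
      obtain ⟨D, f', g', e₁, e₂, hD, hc, hf', hg', he₁, he₂⟩ :=
        base _ _ _ f₁ g₁ i j hC hA₁ hB₁ hf₁ hg₁
      refine ⟨D, f'.comp (embeddingInverse f₂ hf₂'), g'.comp (embeddingInverse g₂ hg₂'), e₁, e₂,
        hD, ?_, hf'.precomp hS _ (embeddingInverse_surjective _ _),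
        hg'.precomp hS _ (embeddingInverse_surjective _ _), he₁, he₂⟩
      ext x
      simpa [embeddingInverse_apply] using DFunLike.congr_fun hc x
    · exact (split _ (f₂.comp f₁) hC hB hA hg hf ⟨j, rfl⟩ hw₂ hv
        (fun f g _ _ hC hA hB hf hg h => IH _ (by rwa [pairMeasure_comm N (i ::ₘ v₂)]) f g hC hA hB
          hf hg rfl)).symm
  · exact split _ (g₂.comp g₁) hC hA hB hf hg ⟨i, rfl⟩ hv₂ hw
      (fun f g _ _ hC hA hB hf hg h => IH _ h f g hC hA hB hf hg rfl)

end Towers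

/-! ### Existence of Fraïssé limits -/

section Limit

variable {L : FirstOrder.Language.{u, v}}

/-- An extension problem over `G` with respect to the family `R`: embeddings of some `R k` into
some `R l` and into `G`; there is also a void problem. -/
abbrev ExtensionTask (R : ℕ → Bundled.{w} L.Structure) (G : Bundled.{w} L.Structure) : Type w :=
  Option (Σ kl : ℕ × ℕ, (R kl.1 ↪[L] R kl.2) × (R kl.1 ↪[L] G))

/-- Transport of an extension problem along an embedding. -/
def ExtensionTask.push {R : ℕ → Bundled.{w} L.Structure} {G Q : Bundled.{w} L.Structure}
    (e : G ↪[L] Q) : ExtensionTask R G → ExtensionTask R Q :=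
  Option.map fun t => ⟨t.1, t.2.1, e.comp t.2.2⟩

/-- A member of `K` with doubly indexed extension problems over it. -/
structure ChainStage (K : Set (Bundled.{w} L.Structure)) (R : ℕ → Bundled.{w} L.Structure) where
  carrier : Bundled.{w} L.Structure
  mem : carrier ∈ K
  pending : ℕ → ℕ → ExtensionTask R carrier

variable {K : Set (Bundled.{w} L.Structure)}

/-- One move of the construction: amalgamation solves the given extension problem, and joint
embedding then also absorbs `R n`, so that the age of the limit will be all of the class. -/
theorem exists_solution (hj : JointEmbedding K) (ha : Amalgamation K)
    {R : ℕ → Bundled.{w} L.Structure} (hR : ∀ n, R n ∈ K) (G : Bundled.{w} L.Structure)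
    (hG : G ∈ K) (t : ExtensionTask R G) (n : ℕ) :
    ∃ (Q : Bundled.{w} L.Structure) (e : G ↪[L] Q), Q ∈ K ∧ Nonempty (R n ↪[L] Q) ∧
      ∀ k l (p : R k ↪[L] R l) (g : R k ↪[L] G), t = some ⟨(k, l), p, g⟩ →
        ∃ h : R l ↪[L] Q, h.comp p = e.comp g := by
  have key : ∃ (Q : Bundled.{w} L.Structure) (e : G ↪[L] Q), Q ∈ K ∧
      ∀ k l (p : R k ↪[L] R l) (g : R k ↪[L] G), t = some ⟨(k, l), p, g⟩ →
        ∃ h : R l ↪[L] Q, h.comp p = e.comp g := by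
    rcases t with _ | ⟨⟨k, l⟩, p, g⟩
    · exact ⟨G, Embedding.refl L G, hG, by simp⟩
    · obtain ⟨Q, h, e, hQ, hc⟩ := ha (R k) (R l) G p g (hR k) (hR l) hG
      refine ⟨Q, e, hQ, fun k' l' p' g' ht => ?_⟩
      simp only [Option.some.injEq, Sigma.mk.injEq, Prod.mk.injEq] at ht
      obtain ⟨⟨rfl, rfl⟩, ht⟩ := ht
      simp only [heq_eq_eq, Prod.mk.injEq] at ht
      obtain ⟨rfl, rfl⟩ := ht
      exact ⟨h, hc⟩
  obtain ⟨Q, e, hQ, he⟩ := key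
  obtain ⟨Q', hQ', ⟨e₁⟩, ⟨e₂⟩⟩ := hj Q hQ (R n) (hR n)
  refine ⟨Q', e₁.comp e, hQ', ⟨e₂⟩, fun k l p g ht => ?_⟩
  obtain ⟨h, hh⟩ := he k l p g ht
  exact ⟨e₁.comp h, by rw [Embedding.comp_assoc, hh, Embedding.comp_assoc]⟩

/-- Bookkeeping: finitely generated structures over countably many function symbols are countable
and have countably many embeddings into each other, so the problems over each stage can be listed,
and a pairing function schedules all problems of all stages. -/
theorem exists_rich_chain [Countable (Σ l, L.Functions l)] (hn : K.Nonempty)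
    (hfg : ∀ M ∈ K, Structure.FG L M) (hj : JointEmbedding K) (ha : Amalgamation K)
    {R : ℕ → Bundled.{w} L.Structure} (hR : ∀ n, R n ∈ K) :
    ∃ (G : ℕ → Bundled.{w} L.Structure) (f : ∀ n, G n ↪[L] G (n + 1)),
      (∀ n, G n ∈ K) ∧ (∀ n, Nonempty (R n ↪[L] G (n + 1))) ∧
      ∀ i k l (p : R k ↪[L] R l) (g : R k ↪[L] G i),
        ∃ (n : ℕ) (hin : i ≤ n) (h : R l ↪[L] G n),
          h.comp p = (DirectedSystem.natLERec f i n hin).comp g := by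
  have henum : ∀ G ∈ K, ∃ e : ℕ → ExtensionTask R G, Function.Surjective e := by
    intro G hG
    have : ∀ M ∈ K, Countable M := fun M hM => Structure.cg_iff_countable.1 (hfg M hM).cg
    have hGc := this G hG
    have h₁ : ∀ k l, Countable (R k ↪[L] R l) := fun k l =>
      have := this _ (hR l)
      Structure.FG.countable_embedding _ (hfg _ (hR k))
    have h₂ : ∀ k, Countable (R k ↪[L] G) := fun k =>
      Structure.FG.countable_embedding _ (hfg _ (hR k))
    exact exists_surjective_nat _
  choose enum henum using henum
  choose Q e hQ hRQ hsol using exists_solution hj ha hR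
  obtain ⟨G₀, hG₀⟩ := hn
  -- Stage n treats the problem with the indices `n.unpair`. Rows i ≤ n hold the problems posed at
  -- stage i and are transported to the new stage; the later rows are refilled with the problems
  -- over the new stage, so that row n + 1 is correct when stage n + 1 is reached.
  let next : ℕ → ChainStage K R → ChainStage K R := fun n s =>
    let t := s.pending n.unpair.1 n.unpair.2
    ⟨Q s.carrier s.mem t n, hQ s.carrier s.mem t n, fun i j =>
      if i ≤ n then (s.pending i j).push (e s.carrier s.mem t n)
      else enum _ (hQ s.carrier s.mem t n) j⟩
  let st : ℕ → ChainStage K R := fun n =>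
    Nat.rec ⟨G₀, hG₀, fun _ j => enum G₀ hG₀ j⟩ next n
  let f : ∀ n, (st n).carrier ↪[L] (st (n + 1)).carrier := fun n =>
    e (st n).carrier (st n).mem ((st n).pending n.unpair.1 n.unpair.2) n
  refine ⟨fun n => (st n).carrier, f, fun n => (st n).mem, fun n => hRQ _ _ _ n, ?_⟩
  intro i k l p g
  have hself : ∀ i j, (st i).pending i j = enum (st i).carrier (st i).mem j := by
    intro i j
    cases i with
    | zero => rfl
    | succ i => exact if_neg (by simp)
  obtain ⟨j, hj⟩ := henum (st i).carrier (st i).mem (some ⟨(k, l), p, g⟩)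
  have hpend : ∀ n (hin : i ≤ n), (st n).pending i j =
      some ⟨(k, l), p, (DirectedSystem.natLERec f i n hin).comp g⟩ := by
    intro n hin
    induction n, hin using Nat.le_induction with
    | base =>
      rw [hself, hj]
      refine congrArg (fun g : R k ↪[L] (st _).carrier =>
        (some ⟨(k, l), p, g⟩ : ExtensionTask R _)) (Embedding.ext fun x => ?_)
      simp [Nat.leRecOn_self]
    | succ n hin ih =>
      have : (st (n + 1)).pending i j = ((st n).pending i j).push (f n) := if_pos hin
      have he : (f n).comp ((DirectedSystem.natLERec f i n hin).comp g) =
          (DirectedSystem.natLERec f i (n + 1) (by omega)).comp g := by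
        ext x
        simp [Nat.leRecOn_succ hin]
      rw [this, ih, ← he]
      rfl
  -- The problem with number j of stage i is treated at stage `Nat.pair i j`, which does not precede
  -- stage i.
  have hle : i ≤ Nat.pair i j := Nat.left_le_pair i j
  obtain ⟨h, hh⟩ := hsol (st (Nat.pair i j)).carrier (st (Nat.pair i j)).mem
    ((st (Nat.pair i j)).pending (Nat.pair i j).unpair.1 (Nat.pair i j).unpair.2) (Nat.pair i j)
    k l p ((DirectedSystem.natLERec f i _ hle).comp g) (by
      rw [← hpend _ hle, Nat.unpair_pair])
  refine ⟨Nat.pair i j + 1, by omega, h, ?_⟩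
  refine hh.trans ?_
  ext x
  simp [Nat.leRecOn_succ hle, f]

/-- Representatives of the isomorphism types feed a rich chain, whose direct limit solves all
extension problems. Solving them for one additional generator at a time is the extension property,
equivalent to ultrahomogeneity for countably generated structures. -/
theorem exists_fraisseLimit [Countable (Σ l, L.Functions l)] (hK : IsFraisse K) :
    ∃ (M : Type w) (_ : L.Structure M) (_ : Countable M), IsFraisseLimit K M := by
  obtain ⟨hn, hfg, hc, hh, hj, ha⟩ := hK
  obtain ⟨F, hF⟩ := hc.exists_eq_range (hn.image _)
  have hR : ∀ n, ∃ N ∈ K, Quotient.mk' N = F n := fun n => by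
    have : F n ∈ Quotient.mk' '' K := hF ▸ Set.mem_range_self n
    exact this
  choose R hRK hRF using hR
  have hrep : ∀ N ∈ K, ∃ n, Nonempty (N ≃[L] R n) := by
    intro N hN
    have : Quotient.mk' N ∈ Set.range F := hF ▸ Set.mem_image_of_mem _ hN
    obtain ⟨n, hn⟩ := this
    exact ⟨n, Quotient.exact ((hRF n).trans hn).symm⟩
  obtain ⟨G, f, hG, hRG, hext⟩ := exists_rich_chain hn hfg hj ha hRK
  let φ : ∀ i j, i ≤ j → G i ↪[L] G j := DirectedSystem.natLERec f
  let M := Language.DirectLimit (fun n => (G n : Type w)) φ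
  let ι := Language.DirectLimit.of L ℕ (fun n => (G n : Type w)) φ
  have hCG : Structure.CG L M := Language.DirectLimit.cg _ fun n => (hfg _ (hG n)).cg
  have hM : Countable M := Structure.cg_iff_countable.1 hCG
  have hage : L.age M = K := by
    refine (age_directLimit (fun n => (G n : Type w)) φ).trans ?_
    refine Set.Subset.antisymm (Set.iUnion_subset fun n => hh _ (hG n)) fun N hN => ?_
    obtain ⟨n, ⟨e⟩⟩ := hrep N hN
    exact Set.mem_iUnion.2 ⟨n + 1, hfg N hN, ⟨(hRG n).some.comp e.toEmbedding⟩⟩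
  have hrich : ∀ A ∈ K, ∀ B ∈ K, ∀ (p : A ↪[L] B) (g : A ↪[L] M),
      ∃ h : B ↪[L] M, h.comp p = g := by
    intro A hA B hB p g
    obtain ⟨k, ⟨a⟩⟩ := hrep A hA
    obtain ⟨l, ⟨b⟩⟩ := hrep B hB
    -- The image of the finitely generated `A` is already contained in the image of some stage `G
    -- i`, so `g` factors through that stage and becomes one of the scheduled problems.
    obtain ⟨i, T, hT⟩ := Language.DirectLimit.exists_fg_substructure_in_Sigma g.toHom.range
      ((hfg A hA).range g.toHom)
    have hr : ∀ x, g x ∈ (ι i).toHom.range := by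
      intro x
      have : g x ∈ T.map (ι i).toHom :=
        hT ▸ ⟨x, rfl⟩
      obtain ⟨y, -, hy⟩ := this
      exact ⟨y, hy⟩
    let g' : A ↪[L] G i := (ι i).equivRange.symm.toEmbedding.comp
      (g.codRestrict _ hr)
    have hg' : ∀ x, ι i (g' x) = g x := by
      intro x
      have := (ι i).equivRange.apply_symm_apply (g.codRestrict _ hr x)
      exact congrArg Subtype.val this
    obtain ⟨n, hin, h, hh⟩ := hext i k l ((b.toEmbedding.comp p).comp a.symm.toEmbedding)
      (g'.comp a.symm.toEmbedding)
    refine ⟨((ι n).comp h).comp b.toEmbedding, ?_⟩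
    ext x
    have := DFunLike.congr_fun hh (a x)
    have hax : a.symm.toEmbedding (a x) = x := a.symm_apply_apply x
    simp only [Embedding.comp_apply, hax] at this ⊢
    rw [this]
    exact (Language.DirectLimit.of_f (hij := hin)).trans (hg' x)
  refine ⟨M, inferInstance, hM, ⟨?_, hage⟩⟩
  rw [isUltrahomogeneous_iff_IsExtensionPair hCG]
  rintro ⟨q, hq⟩ m
  let S := q.dom ⊔ Substructure.closure L {m}
  have hS : S.FG := hq.sup (Substructure.fg_closure_singleton _)
  obtain ⟨g, hg⟩ := hrich ⟨q.dom, inferInstance⟩ (hage ▸ age.fg_substructure hq)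
    ⟨S, inferInstance⟩ (hage ▸ age.fg_substructure hS)
    (Substructure.inclusion le_sup_left) q.toEmbedding
  refine ⟨⟨⟨S, g.toHom.range, g.equivRange⟩, hS⟩,
    (le_sup_right : _ ≤ S) (Substructure.subset_closure (Set.mem_singleton m)),
    ⟨le_sup_left, ?_⟩⟩
  ext x
  have := DFunLike.congr_fun hg x
  simpa using this

end Limit

/-! ### Quantifier-free types, quantifier elimination and ω-categoricity -/

section QuantifierFreeTypes

variable {L : FirstOrder.Language.{u, v}}

/-- Two tuples, possibly in different structures, satisfy the same quantifier-free formulas. -/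
def SameQFType (L : FirstOrder.Language.{u, v}) {M N : Type*} [L.Structure M] [L.Structure N]
    {n : ℕ} (a : Fin n → M) (b : Fin n → N) : Prop :=
  ∀ θ : L.Formula (Fin n), BoundedFormula.IsQF θ → (θ.Realize a ↔ θ.Realize b)

section

variable {M N P : Type*} [L.Structure M] [L.Structure N] [L.Structure P] {n : ℕ}

theorem SameQFType.symm {a : Fin n → M} {b : Fin n → N} (h : SameQFType L a b) :
    SameQFType L b a := fun θ hθ => (h θ hθ).symm

theorem SameQFType.trans {a : Fin n → M} {b : Fin n → N} {c : Fin n → P}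
    (h : SameQFType L a b) (h' : SameQFType L b c) : SameQFType L a c :=
  fun θ hθ => (h θ hθ).trans (h' θ hθ)

theorem sameQFType_comp (f : M ↪[L] N) (a : Fin n → M) : SameQFType L a (f ∘ a) := by
  intro θ hθ
  have := hθ.realize_embedding f (v := a) (xs := default)
  rw [Formula.Realize, Formula.Realize, ← this]
  exact iff_of_eq (congrArg _ (Subsingleton.elim _ _))

theorem SameQFType.restrict {m : ℕ} {a : Fin n → M} {b : Fin n → N} (h : SameQFType L a b)
    (g : Fin m → Fin n) : SameQFType L (a ∘ g) (b ∘ g) := by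
  intro θ hθ
  have := h (Formula.relabel g θ) (hθ.relabel _)
  simpa using this

theorem mem_closure_range_iff {a : Fin n → M} {x : M} :
    x ∈ Substructure.closure L (Set.range a) ↔ ∃ t : L.Term (Fin n), t.realize a = x := by
  rw [Substructure.mem_closure_iff_exists_term]
  constructor
  · rintro ⟨t, rfl⟩
    choose g hg using fun y : Set.range a => y.2
    refine ⟨t.relabel g, ?_⟩
    rw [Term.realize_relabel]
    congr 1
    funext y
    exact hg y
  · rintro ⟨t, rfl⟩
    exact ⟨t.relabel fun i => ⟨a i, i, rfl⟩, by rw [Term.realize_relabel]; rfl⟩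

/-- The assignment t(a) ↦ t(b) is well defined and injective because equations between terms are
quantifier-free, and it respects relations because atomic formulas are. The substructure is a
variable `S`, equal to the closure, to spare transport along equalities. -/
theorem SameQFType.exists_embedding {a : Fin n → M} {b : Fin n → N} (h : SameQFType L a b)
    {S : L.Substructure M} (hS : Substructure.closure L (Set.range a) = S) :
    ∃ g : S ↪[L] N, ∀ (t : L.Term (Fin n)) (ht : t.realize a ∈ S),
      g ⟨t.realize a, ht⟩ = t.realize b := by
  have heq : ∀ t t' : L.Term (Fin n), t.realize a = t'.realize a ↔ t.realize b = t'.realize b := by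
    intro t t'
    simpa using h (t.equal t') (BoundedFormula.IsAtomic.equal _ _).isQF
  have hrel : ∀ {k : ℕ} (R : L.Relations k) (ts : Fin k → L.Term (Fin n)),
      Structure.RelMap R (fun i => (ts i).realize a) ↔
        Structure.RelMap R (fun i => (ts i).realize b) := by
    intro k R ts
    simpa using h (R.formula ts) (BoundedFormula.IsAtomic.rel _ _).isQF
  have hT : ∀ x : S, ∃ t : L.Term (Fin n), t.realize a = x := fun x =>
    mem_closure_range_iff.1 (hS ▸ x.2)
  choose T hT using hT
  refine ⟨⟨⟨fun x => (T x).realize b, fun x y hxy => ?_⟩, fun {k} F x => ?_, fun {k} R x => ?_⟩,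
    fun t ht => ?_⟩
  · exact Subtype.ext (by rw [← hT x, ← hT y]; exact (heq _ _).2 hxy)
  · refine (heq _ (Term.func F fun i => T (x i))).1 ?_
    rw [hT, Term.realize_func]
    simp only [hT]
    rfl
  · refine (hrel R fun i => T (x i)).symm.trans ?_
    simp only [hT]
    rfl
  · exact (heq _ _).1 (hT ⟨t.realize a, ht⟩)

theorem SameQFType.exists_automorphism (hM : IsUltrahomogeneous L M) {a b : Fin n → M}
    (h : SameQFType L a b) : ∃ σ : M ≃[L] M, ∀ i, σ (a i) = b i := by
  obtain ⟨g, hg⟩ := h.exists_embedding rfl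
  obtain ⟨σ, hσ⟩ := hM _ (Substructure.fg_closure (Set.finite_range a)) g
  refine ⟨σ, fun i => ?_⟩
  have h₁ := hg (Term.var i) (Substructure.subset_closure ⟨i, rfl⟩)
  rw [hσ] at h₁
  exact h₁

theorem isQF_iSup {α β : Type*} [Finite β] {f : β → L.Formula α}
    (hf : ∀ b, BoundedFormula.IsQF (f b)) : BoundedFormula.IsQF (Formula.iSup f) := by
  unfold Formula.iSup BoundedFormula.iSup
  dsimp only
  generalize Finset.toList _ = l
  induction l with
  | nil => exact BoundedFormula.isQF_bot
  | cons b l ih => exact (hf b).sup ih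

theorem isQF_iInf {α β : Type*} [Finite β] {f : β → L.Formula α}
    (hf : ∀ b, BoundedFormula.IsQF (f b)) : BoundedFormula.IsQF (Formula.iInf f) := by
  unfold Formula.iInf BoundedFormula.iInf
  dsimp only
  generalize Finset.toList _ = l
  induction l with
  | nil => exact BoundedFormula.IsQF.top
  | cons b l ih => exact (hf b).inf ih

/-- For every `n`, finitely many quantifier-free formulas isolate the quantifier-free types of
all `n`-tuples. -/
def HasIsolatedQFTypes (L : FirstOrder.Language.{u, v}) (M : Type*) [L.Structure M] : Prop :=
  ∀ n, ∃ Ψ : Set (L.Formula (Fin n)), Ψ.Finite ∧ (∀ ψ ∈ Ψ, BoundedFormula.IsQF ψ) ∧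
    (∀ a : Fin n → M, ∃ ψ ∈ Ψ, ψ.Realize a) ∧
    ∀ ψ ∈ Ψ, ∀ a b : Fin n → M, ψ.Realize a → ψ.Realize b → SameQFType L a b

/-- Choose a representative for every value of the invariant. For each pair of representatives with
different types one quantifier-free formula separates them; the finite conjunction over the second
member isolates the type of the first. -/
theorem hasIsolatedQFTypes_of_finite_invariant
    (h : ∀ n, ∃ (T : Type (max u v)) (_ : Finite T) (τ : (Fin n → M) → T),
      ∀ a b, τ a = τ b → SameQFType L a b) : HasIsolatedQFTypes L M := by
  intro n
  obtain ⟨T, _, τ, hτ⟩ := h n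
  have hχ : ∀ a b : Fin n → M, ∃ χ : L.Formula (Fin n), BoundedFormula.IsQF χ ∧ χ.Realize a ∧
      (χ.Realize b → SameQFType L a b) := by
    intro a b
    by_cases hab : SameQFType L a b
    · exact ⟨⊤, .top, by simp, fun _ => hab⟩
    · simp only [SameQFType, not_forall] at hab
      obtain ⟨θ, hθ, hne⟩ := hab
      by_cases ha : θ.Realize a
      · exact ⟨θ, hθ, ha, fun hb => absurd (iff_of_true ha hb) hne⟩
      · refine ⟨θ.not, hθ.not, by simpa using ha, fun hb => absurd ?_ hne⟩
        exact iff_of_false ha (by simpa using hb)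
  choose χ hχ using hχ
  choose rep hrep using fun t : Set.range τ => t.2
  refine ⟨Set.range fun s : Set.range τ => Formula.iInf fun t : Set.range τ => χ (rep s) (rep t),
    Set.finite_range _, ?_, ?_, ?_⟩
  · rintro _ ⟨s, rfl⟩
    exact isQF_iInf fun t => (hχ _ _).1
  · intro a
    refine ⟨_, ⟨⟨τ a, a, rfl⟩, rfl⟩, ?_⟩
    have := hτ a (rep ⟨τ a, a, rfl⟩) (hrep ⟨τ a, a, rfl⟩).symm
    rw [Formula.realize_iInf]
    intro t
    exact (this _ (hχ _ _).1).2 (hχ _ _).2.1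
  · have key : ∀ (s : Set.range τ) (a : Fin n → M),
        (Formula.iInf fun t : Set.range τ => χ (rep s) (rep t)).Realize a →
          SameQFType L (rep s) a := by
      intro s a ha
      have h' := hτ a (rep ⟨τ a, a, rfl⟩) (hrep ⟨τ a, a, rfl⟩).symm
      rw [Formula.realize_iInf] at ha
      exact ((hχ _ _).2.2 ((h' _ (hχ _ _).1).1 (ha ⟨τ a, a, rfl⟩))).trans h'.symm
    rintro _ ⟨s, rfl⟩ a b ha hb
    exact (key s a ha).symm.trans (key s b hb)

theorem finite_structure (X : Type*) [Finite X] [Finite (Σ n, L.Functions n)]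
    [Finite (Σ n, L.Relations n)] : Finite (L.Structure X) := by
  have h₁ : ∀ n, Finite (L.Functions n) := fun n =>
    Finite.of_injective (fun f => (⟨n, f⟩ : Σ n, L.Functions n)) fun f g h => by simpa using h
  have h₂ : ∀ n, Finite (L.Relations n) := fun n =>
    Finite.of_injective (fun f => (⟨n, f⟩ : Σ n, L.Relations n)) fun f g h => by simpa using h
  let g : L.Structure X → ((f : Σ n, L.Functions n) → (Fin f.1 → X) → X) ×
      ((r : Σ n, L.Relations n) → (Fin r.1 → X) → Prop) := fun s =>
    (fun f => s.funMap f.2, fun r => s.RelMap r.2)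
  refine Finite.of_injective g fun s t hst => ?_
  simp only [g, Prod.mk.injEq] at hst
  refine Structure.ext ?_ ?_
  · funext n f x
    exact congrFun (congrFun hst.1 ⟨n, f⟩) x
  · funext n r x
    exact congrFun (congrFun hst.2 ⟨n, r⟩) x

/-- A structure transported to `Fin m` along a bijection. -/
theorem exists_equiv_fin (S : Type*) [L.Structure S] {m : ℕ} (e : S ≃ Fin m) :
    ∃ s : L.Structure (Fin m), Nonempty (@FirstOrder.Language.Equiv L S (Fin m) _ s) :=
  ⟨e.inducedStructure, ⟨e.inducedStructureEquiv⟩⟩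

/-- The invariant of a tuple is a copy, on an initial segment of ℕ of bounded length, of the
substructure it generates, together with the copied tuple. A finite language admits only finitely
many such data. -/
theorem UniformlyLocallyFinite.hasIsolatedQFTypes [Finite (Σ n, L.Functions n)]
    [Finite (Σ n, L.Relations n)] {M : Type w} [L.Structure M]
    (hM : UniformlyLocallyFinite L M) : HasIsolatedQFTypes L M := by
  obtain ⟨f, hf⟩ := hM
  refine hasIsolatedQFTypes_of_finite_invariant fun n => ?_
  have hfin : ∀ m, Finite (L.Structure (Fin m)) := fun m => finite_structure _
  have h : ∀ a : Fin n → M, ∃ t : Σ m : Fin (f n + 1), L.Structure (Fin m) × (Fin n → Fin m),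
      @SameQFType L M (Fin t.1) _ t.2.1 n a t.2.2 := by
    intro a
    let S := Substructure.closure L (Set.range a)
    have hSf : (S : Set M).Finite := Set.finite_of_encard_le_coe (hf n a)
    have : Finite S := hSf
    have hcard : Nat.card S ≤ f n := by
      have := hf n a
      rw [← hSf.cast_ncard_eq, Nat.cast_le] at this
      exact this
    obtain ⟨s, ⟨e⟩⟩ := exists_equiv_fin (L := L) S (Finite.equivFin S)
    let a' : Fin n → S := fun i => ⟨a i, Substructure.subset_closure ⟨i, rfl⟩⟩
    refine ⟨⟨⟨Nat.card S, by omega⟩, s, e ∘ a'⟩, ?_⟩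
    have h₁ := sameQFType_comp S.subtype a'
    have h₂ := @sameQFType_comp L S (Fin (Nat.card S)) _ s n e.toEmbedding a'
    exact @SameQFType.trans L M S (Fin (Nat.card S)) _ _ s n _ _ _ h₁.symm h₂
  choose τ hτ using h
  refine ⟨_, inferInstance, τ, fun a b hab => ?_⟩
  have h₁ := hτ a
  have h₂ := hτ b
  rw [hab] at h₁
  exact @SameQFType.trans L M (Fin (τ b).1) M _ (τ b).2.1 _ n _ _ _ h₁
    (@SameQFType.symm L M (Fin (τ b).1) _ (τ b).2.1 n _ _ h₂)

theorem sentence_realize_iAlls_iff (φ : L.Formula (Fin n)) :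
    M ⊨ (Formula.iAlls (Fin n) (Formula.relabel Sum.inr φ) : L.Sentence) ↔
      ∀ a : Fin n → M, φ.Realize a := by
  rw [Sentence.Realize, Formula.realize_iAlls]
  simp [Formula.realize_relabel, Function.comp_def]

/-- Universal closures are sentences, so validity of a formula passes between models of the complete
theory. All later transfers from `M` to `N` go through this. -/
theorem forall_realize_iff (M : Type*) {N : Type*} [L.Structure M] [L.Structure N]
    [N ⊨ L.completeTheory M] (φ : L.Formula (Fin n)) :
    (∀ a : Fin n → N, φ.Realize a) ↔ ∀ a : Fin n → M, φ.Realize a := by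
  rw [← sentence_realize_iAlls_iff, ← sentence_realize_iAlls_iff]
  exact realize_iff_of_model_completeTheory M N _

end

variable {M : Type w} [L.Structure M]

/-- A formula is equivalent to the disjunction of the isolating formulas that are consistent with
it: tuples with the same quantifier-free type are conjugate under automorphisms, hence satisfy the
same formulas. -/
theorem hasQuantifierElimination_completeTheory (hM : IsUltrahomogeneous L M)
    (hiso : HasIsolatedQFTypes L M) : HasQuantifierElimination (L.completeTheory M) := by
  intro n φ
  obtain ⟨Ψ, hfin, hqf, hcov, hsep⟩ := hiso n
  have : Finite {ψ : L.Formula (Fin n) // ψ ∈ Ψ ∧ ∃ a : Fin n → M, ψ.Realize a ∧ φ.Realize a} :=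
    Set.Finite.to_subtype (hfin.subset fun ψ hψ => hψ.1)
  let χ := Formula.iSup fun ψ : {ψ : L.Formula (Fin n) // ψ ∈ Ψ ∧
    ∃ a : Fin n → M, ψ.Realize a ∧ φ.Realize a} => (ψ : L.Formula (Fin n))
  refine ⟨χ, isQF_iSup fun ψ => hqf _ ψ.2.1, ?_⟩
  have hMχ : ∀ a : Fin n → M, (φ.iff χ).Realize a := by
    intro a
    rw [Formula.realize_iff, Formula.realize_iSup]
    constructor
    · intro ha
      obtain ⟨ψ, hψ, hψa⟩ := hcov a
      exact ⟨⟨ψ, hψ, a, hψa, ha⟩, hψa⟩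
    · rintro ⟨⟨ψ, hψ, b, hψb, hφb⟩, hψa⟩
      obtain ⟨σ, hσ⟩ := (hsep ψ hψ b a hψb hψa).exists_automorphism hM
      have : σ ∘ b = a := funext hσ
      rw [← this, StrongHomClass.realize_formula]
      exact hφb
  intro N v xs
  have := (forall_realize_iff M (N := N) (φ.iff χ)).2 hMχ v
  rw [Formula.Realize] at this
  convert! this

/-- Back-and-forth between `M` and a countable model `N` of its theory. The formulas that isolate
types in `M` do so across `M` and `N`, and ultrahomogeneity of `M` is used through sentences true in
`M`. -/
theorem omegaCategorical_completeTheory [Countable M] [Infinite M] (hM : IsUltrahomogeneous L M)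
    (hiso : HasIsolatedQFTypes L M) :
    OmegaCategorical.{u, v, w} (L.completeTheory M) := by
  -- If ψ isolates a type in `M`, then for each quantifier-free θ one of ψ → θ, ψ → ¬θ is valid in
  -- `M`, and therefore in `N`.
  have sameOf : ∀ {N : Type w} [L.Structure N] [N ⊨ L.completeTheory M] {n : ℕ}
      {Ψ : Set (L.Formula (Fin n))}, (∀ ψ ∈ Ψ, ∀ a b : Fin n → M, ψ.Realize a → ψ.Realize b →
        SameQFType L a b) → ∀ ψ ∈ Ψ, ∀ (a : Fin n → M) (b : Fin n → N), ψ.Realize a →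
        ψ.Realize b → SameQFType L a b := by
    intro N _ _ n Ψ hsep ψ hψ a b ha hb θ hθ
    by_cases hθa : θ.Realize a
    · have := (forall_realize_iff M (N := N) (ψ.imp θ)).2 (fun x => by
        rw [Formula.realize_imp]
        exact fun hx => (hsep ψ hψ a x ha hx θ hθ).1 hθa) b
      rw [Formula.realize_imp] at this
      exact iff_of_true hθa (this hb)
    · have := (forall_realize_iff M (N := N) (ψ.imp θ.not)).2 (fun x => by
        rw [Formula.realize_imp, Formula.realize_not]
        exact fun hx => mt (hsep ψ hψ a x ha hx θ hθ).2 hθa) b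
      rw [Formula.realize_imp, Formula.realize_not] at this
      exact iff_of_false hθa (this hb)
  have snoc_relabel : ∀ {P : Type w} {n : ℕ} (a : Fin n → P) (y : Fin 1 → P),
      (Sum.elim a y ∘ (Fin.lastCases (Sum.inr 0) Sum.inl : Fin (n + 1) → Fin n ⊕ Fin 1)) =
        (Fin.snoc a (y 0) : Fin (n + 1) → P) := by
    intro P n a y
    funext i
    refine Fin.lastCases ?_ (fun i => ?_) i <;> simp
  have range_snoc : ∀ {P : Type w} [L.Structure P] {n : ℕ} (a : Fin n → P) (y : P)
      {S : L.Substructure P}, Substructure.closure L (Set.range a) = S →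
      Substructure.closure L (Set.range (Fin.snoc a y : Fin (n + 1) → P)) =
        Substructure.closure L {y} ⊔ S := by
    intro P _ n a y S hS
    rw [← hS, ← Substructure.closure_union]
    congr 1
    ext x
    simp only [Set.mem_range, Set.mem_union, Set.mem_singleton_iff]
    constructor
    · rintro ⟨i, rfl⟩
      refine Fin.lastCases ?_ (fun i => ?_) i
      · simp
      · right; exact ⟨i, by simp⟩
    · rintro (rfl | ⟨i, rfl⟩)
      · exact ⟨Fin.last n, by simp⟩
      · exact ⟨i.castSucc, by simp⟩
  have extend : ∀ {P Q : Type w} [L.Structure P] [L.Structure Q] {n : ℕ} (a : Fin n → P) (y : P)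
      (z : Q) (S : L.Substructure P) (hS : Substructure.closure L (Set.range a) = S)
      (f : S ↪[L] Q) (b : Fin n → Q) (_ : ∀ i (hi : a i ∈ S), f ⟨a i, hi⟩ = b i),
      SameQFType L (Fin.snoc a y : Fin (n + 1) → P) (Fin.snoc b z : Fin (n + 1) → Q) →
      ∃ g : (Substructure.closure L {y} ⊔ S : L.Substructure P) ↪[L] Q,
        f = g.comp (Substructure.inclusion le_sup_right) := by
    intro P Q _ _ n a y z S hS f b hb hab
    obtain ⟨g, hg⟩ := hab.exists_embedding (range_snoc a y hS)
    refine ⟨g, ?_⟩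
    ext ⟨x, hx⟩
    obtain ⟨t, rfl⟩ := mem_closure_range_iff.1 (hS ▸ hx)
    have haS : ∀ i, a i ∈ S := fun i => hS ▸ Substructure.subset_closure ⟨i, rfl⟩
    have h₁ : (⟨t.realize a, hx⟩ : S) = t.realize fun i => (⟨a i, haS i⟩ : S) := by
      apply Subtype.ext
      exact HomClass.realize_term S.subtype (v := fun i => (⟨a i, haS i⟩ : S))
    have h₂ : f ⟨t.realize a, hx⟩ = t.realize b := by
      rw [h₁, ← HomClass.realize_term f]
      congr 1
      funext i
      exact hb i _
    have hc : ∀ {R : Type w} [L.Structure R] (c : Fin n → R) (r : R),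
        (t.relabel Fin.castSucc).realize (Fin.snoc c r : Fin (n + 1) → R) = t.realize c := by
      intro R _ c r
      rw [Term.realize_relabel]
      congr 1
      funext i
      simp
    rw [h₂, ← hc b z]
    have hm : (t.relabel Fin.castSucc).realize (Fin.snoc a y : Fin (n + 1) → P) ∈
        (Substructure.closure L {y} ⊔ S : L.Substructure P) := by
      rw [hc]
      exact (le_sup_right : S ≤ Substructure.closure L {y} ⊔ S) hx
    rw [← hg _ hm]
    refine congrArg g (Subtype.ext ?_)
    exact hc a y
  have back : ∀ (N : Type w) [L.Structure N] [N ⊨ L.completeTheory M],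
      L.IsExtensionPair M N ∧ L.IsExtensionPair N M := by
    intro N _ _
    constructor
    · rw [isExtensionPair_iff_exists_embedding_closure_singleton_sup]
      intro S hSfg f m
      obtain ⟨n, a, hS⟩ := Substructure.fg_iff_exists_fin_generating_family.1 hSfg
      have haS : ∀ i, a i ∈ S := fun i => hS ▸ Substructure.subset_closure ⟨i, rfl⟩
      obtain ⟨Ψ, -, hqf, hcov, hsep⟩ := hiso n
      obtain ⟨Ψ', -, -, hcov', hsep'⟩ := hiso (n + 1)
      obtain ⟨χ, hχ, hχa⟩ := hcov a
      obtain ⟨ψ, hψ, hψa⟩ := hcov' (Fin.snoc a m)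
      let b : Fin n → N := fun i => f ⟨a i, haS i⟩
      have hab : SameQFType L a b :=
        (sameQFType_comp S.subtype (fun i => (⟨a i, haS i⟩ : S))).symm.trans (sameQFType_comp f _)
      let ex : L.Formula (Fin n) := Formula.iExs (Fin 1)
        (Formula.relabel (Fin.lastCases (Sum.inr 0) Sum.inl : Fin (n + 1) → Fin n ⊕ Fin 1) ψ)
      have hex : ∀ (P : Type w) [L.Structure P] (c : Fin n → P),
          ex.Realize c ↔ ∃ y : Fin 1 → P, ψ.Realize (Fin.snoc c (y 0) : Fin (n + 1) → P) := by
        intro P _ c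
        simp only [ex, Formula.realize_iExs, Formula.realize_relabel]
        exact exists_congr fun y => by rw [← snoc_relabel]
      have hχb : χ.Realize b := (hab χ (hqf χ hχ)).1 hχa
      -- By ultrahomogeneity `M` satisfies ∀x (χ(x) → ∃y ψ(x, y)): an automorphism carries `a` to
      -- `x` and `m` to a witness. The sentence then holds in `N` and supplies the image of `m`.
      have := (forall_realize_iff M (N := N) (χ.imp ex)).2 (fun x => by
        rw [Formula.realize_imp, hex]
        intro hx
        obtain ⟨σ, hσ⟩ := (hsep χ hχ a x hχa hx).exists_automorphism hM
        refine ⟨fun _ => σ m, ?_⟩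
        have : (Fin.snoc x (σ m) : Fin (n + 1) → M) = σ ∘ (Fin.snoc a m : Fin (n + 1) → M) := by
          funext i
          refine Fin.lastCases ?_ (fun i => ?_) i <;> simp [hσ]
        rw [this, StrongHomClass.realize_formula]
        exact hψa) b
      rw [Formula.realize_imp, hex] at this
      obtain ⟨y, hy⟩ := this hχb
      exact extend a m (y 0) S hS f b (fun i hi => rfl) (sameOf hsep' ψ hψ _ _ hψa hy)
    · rw [isExtensionPair_iff_exists_embedding_closure_singleton_sup]
      intro S hSfg f z
      obtain ⟨n, b, hS⟩ := Substructure.fg_iff_exists_fin_generating_family.1 hSfg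
      have hbS : ∀ i, b i ∈ S := fun i => hS ▸ Substructure.subset_closure ⟨i, rfl⟩
      let a : Fin n → M := fun i => f ⟨b i, hbS i⟩
      have hba : SameQFType L b a :=
        (sameQFType_comp S.subtype (fun i => (⟨b i, hbS i⟩ : S))).symm.trans (sameQFType_comp f _)
      obtain ⟨Ψ', hfin', -, hcov', hsep'⟩ := hiso (n + 1)
      have := hfin'.to_subtype
      have hcovN := (forall_realize_iff M (N := N)
        (Formula.iSup fun ψ : Ψ' => (ψ : L.Formula (Fin (n + 1))))).2 (fun x => by
          rw [Formula.realize_iSup]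
          obtain ⟨ψ, hψ, h⟩ := hcov' x
          exact ⟨⟨ψ, hψ⟩, h⟩) (Fin.snoc b z)
      rw [Formula.realize_iSup] at hcovN
      obtain ⟨⟨ψ, hψ⟩, hψb⟩ := hcovN
      -- The formula ψ satisfied by (b, z) in `N` is satisfied somewhere in `M`, since otherwise ¬ψ
      -- would be valid in both. An automorphism then moves the first n entries of this solution
      -- onto `a`, and its last entry is the image of `z`.
      have : ∃ x : Fin (n + 1) → M, ψ.Realize x := by
        by_contra hne
        push Not at hne
        have := (forall_realize_iff M (N := N) ψ.not).2
          (fun x => by rw [Formula.realize_not]; exact hne x) (Fin.snoc b z)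
        rw [Formula.realize_not] at this
        exact this hψb
      obtain ⟨x, hx⟩ := this
      have hxb := sameOf hsep' ψ hψ x _ hx hψb
      have hxa : SameQFType L (x ∘ Fin.castSucc) a := by
        have := hxb.restrict Fin.castSucc
        have hb : (Fin.snoc b z : Fin (n + 1) → N) ∘ Fin.castSucc = b := by
          funext i; simp
        rw [hb] at this
        exact this.trans hba
      obtain ⟨σ, hσ⟩ := hxa.exists_automorphism hM
      refine extend b z (σ (x (Fin.last n))) S hS f a (fun i hi => rfl) ?_
      have : (Fin.snoc a (σ (x (Fin.last n))) : Fin (n + 1) → M) = σ ∘ x := by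
        funext i
        refine Fin.lastCases ?_ (fun i => ?_) i
        · simp
        · simpa using (hσ i).symm
      rw [this]
      exact hxb.symm.trans (sameQFType_comp σ.toEmbedding x)
  have iso : ∀ (N : Type w) [L.Structure N] [N ⊨ L.completeTheory M] [Countable N],
      Nonempty (M ≃[L] N) := by
    intro N _ _ _
    -- The case of the empty tuple starts the back-and-forth, with an embedding of the substructure
    -- generated by the constants.
    obtain ⟨Ψ, -, -, hcov, hsep⟩ := hiso 0
    obtain ⟨ψ, hψ, hψa⟩ := hcov finZeroElim
    have hψb := (forall_realize_iff M (N := N) ψ).2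
      (fun x => by rwa [Subsingleton.elim x finZeroElim]) finZeroElim
    have h := sameOf hsep ψ hψ _ _ hψa hψb
    obtain ⟨g, -⟩ := h.exists_embedding rfl
    obtain ⟨e, -⟩ := equiv_between_cg (L := L) (M := M) (N := N) Structure.cg_of_countable
      Structure.cg_of_countable
      ⟨⟨_, g.toHom.range, g.equivRange⟩, Substructure.fg_closure (Set.finite_range _)⟩
      (back N).1 (back N).2
    exact ⟨e⟩
  refine ⟨⟨Theory.ModelType.of (L.completeTheory M) M, Cardinal.mk_eq_aleph0 M⟩, ?_⟩
  intro N₁ N₂ h₁ h₂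
  have : Countable N₁ := Cardinal.mk_le_aleph0_iff.1 h₁.le
  have : Countable N₂ := Cardinal.mk_le_aleph0_iff.1 h₂.le
  obtain ⟨e₁⟩ := iso N₁
  obtain ⟨e₂⟩ := iso N₂
  exact ⟨e₂.comp e₁.symm⟩

end QuantifierFreeTypes

/-! ### One-step extensions of Lie algebras and their derivations -/

section LieSteps

variable {F : Type*} [Field F]

theorem IsLieLazardSeries.mono {c : ℕ} {A : Type*} [LieRing A] [LieAlgebra F A]
    {H : ℕ → LieSubalgebra F A} (h : IsLieLazardSeries c H) {i j : ℕ} (hi : 1 ≤ i) (hij : i ≤ j) :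
    H j ≤ H i := by
  induction j, hij using Nat.le_induction with
  | base => exact le_rfl
  | succ j hij ih => exact (h.anti j (hi.trans hij)).trans ih

theorem IsLieLazardSeries.mem_one {c : ℕ} {A : Type*} [LieRing A] [LieAlgebra F A]
    {H : ℕ → LieSubalgebra F A} (h : IsLieLazardSeries c H) (x : A) : x ∈ H 1 := by
  rw [h.one]
  exact LieSubalgebra.mem_top x

/-- The Lie algebra embedding `f` respects the series, its range is an ideal of codimension one,
and `a` is an element outside the range of the largest possible weight `i`. -/
structure IsLieStep {C A : Type*} [LieRing C] [LieAlgebra F C] [LieRing A] [LieAlgebra F A]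
    (HC : ℕ → LieSubalgebra F C) (HA : ℕ → LieSubalgebra F A) (f : C →ₗ⁅F⁆ A) (i : ℕ) (a : A) :
    Prop where
  inj : Function.Injective f
  mem_iff : ∀ k, 1 ≤ k → ∀ x, f x ∈ HA k ↔ x ∈ HC k
  pos : 1 ≤ i
  mem : a ∈ HA i
  notMem : a ∉ f.range
  span : ∀ x, ∃ (y : C) (r : F), x = f y + r • a
  ideal : ∀ y, ∃ z, ⁅a, f y⁆ = f z
  next : ∀ x ∈ HA (i + 1), x ∈ f.range

namespace IsLieStep

variable {C A : Type*} [LieRing C] [LieAlgebra F C] [LieRing A] [LieAlgebra F A]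
  {HC : ℕ → LieSubalgebra F C} {HA : ℕ → LieSubalgebra F A} {f : C →ₗ⁅F⁆ A} {i : ℕ} {a : A}

theorem unique (h : IsLieStep HC HA f i a) {y y' : C} {r r' : F}
    (he : f y + r • a = f y' + r' • a) : y = y' ∧ r = r' := by
  have hr : r = r' := by
    by_contra hne
    have hsub : r - r' ≠ 0 := sub_ne_zero.2 hne
    apply h.notMem
    refine ⟨(r - r')⁻¹ • (y' - y), ?_⟩
    have : (r - r') • a = f y' - f y := by
      rw [sub_smul, sub_eq_sub_iff_add_eq_add, add_comm, he, add_comm]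
    change f ((r - r')⁻¹ • (y' - y)) = a
    rw [map_smul, map_sub, ← this, smul_smul, inv_mul_cancel₀ hsub, one_smul]
  subst hr
  exact ⟨h.inj (add_right_cancel he), rfl⟩

/-- Since the image of `C` is an ideal, ad a restricts to it; the Leibniz rule is the Jacobi
identity. -/
theorem exists_derivation (h : IsLieStep HC HA f i a) :
    ∃ δ : LieDerivation F C C, ∀ y, f (δ y) = ⁅a, f y⁆ := by
  choose δ hδ using h.ideal
  refine ⟨⟨⟨⟨δ, fun x y => ?_⟩, fun r x => ?_⟩, fun x y => ?_⟩, fun y => (hδ y).symm⟩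
  · apply h.inj
    simp [← hδ]
  · apply h.inj
    simp [← hδ]
  · apply h.inj
    change f (δ ⁅x, y⁆) = f (⁅x, δ y⁆ - ⁅y, δ x⁆)
    rw [← hδ, LieHom.map_lie, map_sub, LieHom.map_lie, LieHom.map_lie, ← hδ, ← hδ, leibniz_lie, ← lie_skew]
    abel

/-- As a Lie algebra `A` is the semidirect sum of `C` and the line spanned by `a`, so a homomorphism
is determined by its values on `C` and at `a`, subject only to compatibility with the action of `a`.
-/
theorem exists_lift (h : IsLieStep HC HA f i a) {δ : LieDerivation F C C}
    (hδ : ∀ y, f (δ y) = ⁅a, f y⁆) {T : Type*} [LieRing T] [LieAlgebra F T] (p : C →ₗ⁅F⁆ T) (t : T)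
    (ht : ∀ y, ⁅t, p y⁆ = p (δ y)) :
    ∃ q : A →ₗ⁅F⁆ T, ∀ (y : C) (r : F), q (f y + r • a) = p y + r • t := by
  choose Y R hYR using h.span
  let q : A → T := fun x => p (Y x) + R x • t
  have hq : ∀ (y : C) (r : F), q (f y + r • a) = p y + r • t := by
    intro y r
    obtain ⟨h₁, h₂⟩ := h.unique (hYR (f y + r • a)).symm
    simp only [q, h₁, h₂]
  refine ⟨⟨⟨⟨q, fun x x' => ?_⟩, fun r x => ?_⟩, fun {x x'} => ?_⟩, hq⟩
  · obtain ⟨y, r, rfl⟩ := h.span x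
    obtain ⟨y', r', rfl⟩ := h.span x'
    have : f y + r • a + (f y' + r' • a) = f (y + y') + (r + r') • a := by
      rw [map_add, add_smul]; abel
    rw [this, hq, hq, hq, map_add, add_smul]
    abel
  · obtain ⟨y, s, rfl⟩ := h.span x
    have : r • (f y + s • a) = f (r • y) + (r * s) • a := by
      rw [map_smul, smul_add, smul_smul]
    change q _ = r • q _
    rw [this, hq]
    simp only [hq, map_smul, smul_add, smul_smul]
  · obtain ⟨y, r, rfl⟩ := h.span x
    obtain ⟨y', r', rfl⟩ := h.span x'
    have : ⁅f y + r • a, f y' + r' • a⁆ =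
        f (⁅y, y'⁆ + r • δ y' - r' • δ y) + (0 : F) • a := by
      simp only [lie_add, add_lie, lie_smul, smul_lie, lie_self, map_add, map_sub, map_smul,
        LieHom.map_lie, hδ, ← lie_skew a (f y)]
      module
    change q _ = ⁅q _, q _⁆
    rw [this, hq, hq, hq]
    simp only [lie_add, add_lie, lie_smul, smul_lie, lie_self, map_add, map_sub, map_smul,
        LieHom.map_lie, ← ht, ← lie_skew t (p y)]
    module

end IsLieStep

/-- The derivations which raise the weight by `k`. -/
def RaisesWeight {C : Type*} [LieRing C] [LieAlgebra F C] (H : ℕ → LieSubalgebra F C) (k : ℕ)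
    (δ : LieDerivation F C C) : Prop :=
  ∀ l, 1 ≤ l → ∀ x ∈ H l, δ x ∈ H (l + k)

namespace RaisesWeight

variable {C : Type*} [LieRing C] [LieAlgebra F C] {H : ℕ → LieSubalgebra F C} {k l : ℕ}
  {δ ε : LieDerivation F C C}

theorem zero : RaisesWeight H k (0 : LieDerivation F C C) := fun _ _ _ _ => zero_mem _

theorem add (h : RaisesWeight H k δ) (h' : RaisesWeight H k ε) : RaisesWeight H k (δ + ε) :=
  fun l hl x hx => add_mem (h l hl x hx) (h' l hl x hx)

theorem smul (h : RaisesWeight H k δ) (r : F) : RaisesWeight H k (r • δ) :=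
  fun l hl x hx => (H (l + k)).smul_mem r (h l hl x hx)

theorem lie (h : RaisesWeight H k δ) (h' : RaisesWeight H l ε) :
    RaisesWeight H (k + l) ⁅δ, ε⁆ := by
  intro m hm x hx
  rw [LieDerivation.commutator_apply]
  refine sub_mem ?_ ?_
  · have := h (m + l) (by omega) _ (h' m hm x hx)
    rwa [show m + l + k = m + (k + l) by omega] at this
  · have := h' (m + k) (by omega) _ (h m hm x hx)
    rwa [show m + k + l = m + (k + l) by omega] at this

theorem mono {c : ℕ} (hH : IsLieLazardSeries c H) (h : RaisesWeight H l δ) (hkl : k ≤ l) :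
    RaisesWeight H k δ :=
  fun m hm x hx => hH.mono (by omega) (by omega) (h m hm x hx)

end RaisesWeight

theorem IsLieStep.raisesWeight {c : ℕ} {C A : Type*} [LieRing C] [LieAlgebra F C] [LieRing A]
    [LieAlgebra F A] {HC : ℕ → LieSubalgebra F C} {HA : ℕ → LieSubalgebra F A} {f : C →ₗ⁅F⁆ A}
    {i : ℕ} {a : A} (h : IsLieStep HC HA f i a) (hA : IsLieLazardSeries c HA)
    {δ : LieDerivation F C C} (hδ : ∀ y, f (δ y) = ⁅a, f y⁆) : RaisesWeight HC i δ := by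
  intro l hl x hx
  rw [← h.mem_iff _ (by omega), hδ, add_comm]
  exact hA.lie_mem _ _ h.pos hl _ h.mem _ ((h.mem_iff l hl x).2 hx)

/-- A two-dimensional abelian Lie algebra. -/
def AbelianPlane (F : Type*) := F × F

namespace AbelianPlane

instance : AddCommGroup (AbelianPlane F) := inferInstanceAs (AddCommGroup (F × F))

instance : Module F (AbelianPlane F) := inferInstanceAs (Module F (F × F))

instance : FiniteDimensional F (AbelianPlane F) := inferInstanceAs (FiniteDimensional F (F × F))

instance : Bracket (AbelianPlane F) (AbelianPlane F) := ⟨fun _ _ => 0⟩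

theorem lie_eq_zero (x y : AbelianPlane F) : ⁅x, y⁆ = 0 := rfl

instance : LieRing (AbelianPlane F) where
  add_lie := by simp [lie_eq_zero]
  lie_add := by simp [lie_eq_zero]
  lie_self := by simp [lie_eq_zero]
  leibniz_lie := by simp [lie_eq_zero]

instance : LieAlgebra F (AbelianPlane F) where
  lie_smul := by simp [lie_eq_zero]

@[simp] theorem fst_zero : (0 : AbelianPlane F).1 = 0 := rfl
@[simp] theorem snd_zero : (0 : AbelianPlane F).2 = 0 := rfl
@[simp] theorem fst_add (x y : AbelianPlane F) : (x + y).1 = x.1 + y.1 := rfl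
@[simp] theorem snd_add (x y : AbelianPlane F) : (x + y).2 = x.2 + y.2 := rfl
@[simp] theorem fst_smul (r : F) (x : AbelianPlane F) : (r • x).1 = r * x.1 := rfl
@[simp] theorem snd_smul (r : F) (x : AbelianPlane F) : (r • x).2 = r * x.2 := rfl

end AbelianPlane

open LieAlgebra

/-! ### The ambient semidirect sum and the amalgam inside it -/

section Amalgam

variable {C : Type*} [LieRing C] [LieAlgebra F C]

/-- The semidirect sum of `C` with its derivations, extended by a central plane. -/
abbrev Ambient (F C : Type*) [Field F] [LieRing C] [LieAlgebra F C] :=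
  C ⋊⁅LieHom.fst F (LieDerivation F C C) (AbelianPlane F)⁆
    (LieDerivation F C C × AbelianPlane F)

instance [FiniteDimensional F C] : FiniteDimensional F (Ambient F C) :=
  have : IsNoetherian F (LieDerivation F C C) := LieDerivation.instNoetherian F C
  Module.Finite.equiv (SemiDirectSum.toProdl _).symm

/-- The element `t` has weight at least `k`, where the two generators of the central plane have
the weights `i` and `j`. -/
structure HasWeight (H : ℕ → LieSubalgebra F C) (i j k : ℕ) (t : Ambient F C) : Prop where
  left : t.left ∈ H k
  der : RaisesWeight H k t.right.1
  fst : k ≤ i ∨ t.right.2.1 = 0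
  snd : k ≤ j ∨ t.right.2.2 = 0

variable {c : ℕ} {H : ℕ → LieSubalgebra F C} {i j k l : ℕ} {t s : Ambient F C}

theorem HasWeight.zero : HasWeight H i j k (0 : Ambient F C) :=
  ⟨zero_mem _, .zero, Or.inr rfl, Or.inr rfl⟩

theorem HasWeight.add (h : HasWeight H i j k t) (h' : HasWeight H i j k s) :
    HasWeight H i j k (t + s) := by
  refine ⟨add_mem h.left h'.left, h.der.add h'.der, ?_, ?_⟩
  · rcases h.fst with h₁ | h₁
    · exact Or.inl h₁
    · rcases h'.fst with h₂ | h₂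
      · exact Or.inl h₂
      · exact Or.inr (by simp [h₁, h₂])
  · rcases h.snd with h₁ | h₁
    · exact Or.inl h₁
    · rcases h'.snd with h₂ | h₂
      · exact Or.inl h₂
      · exact Or.inr (by simp [h₁, h₂])

theorem HasWeight.smul (h : HasWeight H i j k t) (r : F) : HasWeight H i j k (r • t) := by
  refine ⟨(H k).smul_mem r h.left, h.der.smul r, ?_, ?_⟩
  · exact h.fst.imp id fun h => by simp [h]
  · exact h.snd.imp id fun h => by simp [h]

theorem HasWeight.mono (hH : IsLieLazardSeries c H) (h : HasWeight H i j l t) (hk : 1 ≤ k)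
    (hkl : k ≤ l) : HasWeight H i j k t :=
  ⟨hH.mono hk hkl h.left, h.der.mono hH hkl, h.fst.imp (hkl.trans ·) id,
    h.snd.imp (hkl.trans ·) id⟩

/-- Brackets have no plane component, so only the `C`-part and the derivation part matter; a
derivation of weight k maps `H l` to `H (k + l)`. -/
theorem HasWeight.lie (hH : IsLieLazardSeries c H) (hk : 1 ≤ k) (hl : 1 ≤ l)
    (h : HasWeight H i j k t) (h' : HasWeight H i j l s) : HasWeight H i j (k + l) ⁅t, s⁆ := by
  refine ⟨?_, h.der.lie h'.der, Or.inr rfl, Or.inr rfl⟩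
  refine sub_mem (add_mem (hH.lie_mem k l hk hl _ h.left _ h'.left) ?_) (h'.der k hk _ h.left)
  have := h.der l hl _ h'.left
  rwa [add_comm] at this

/-- A derivation that raises weights by more than c vanishes on `H 1`, which is everything. The
bounds i, j ≤ c dispose of the plane. -/
theorem HasWeight.eq_zero (hH : IsLieLazardSeries c H) (hi : i ≤ c) (hj : j ≤ c) (hk : c < k)
    (h : HasWeight H i j k t) : t = 0 := by
  have h₁ : t.left = 0 := by
    have := h.left
    rwa [hH.bot k hk] at this
  have h₂ : t.right.1 = 0 := by
    ext x
    have := h.der 1 le_rfl x (hH.mem_one x)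
    rwa [hH.bot _ (by omega)] at this
  have h₃ : t.right.2.1 = 0 := h.fst.resolve_left (by omega)
  have h₄ : t.right.2.2 = 0 := h.snd.resolve_left (by omega)
  have h₅ : t.right.2 = 0 := Prod.ext h₃ h₄
  exact SemiDirectSum.ext h₁ (Prod.ext h₂ h₅)

/-- The amalgam of two one-step extensions of `C`, with the derivations `δ` and `ε`. -/
def amalgamSubalgebra (hH : IsLieLazardSeries c H) {δ ε : LieDerivation F C C}
    (hδ : RaisesWeight H i δ) (hε : RaisesWeight H j ε) : LieSubalgebra F (Ambient F C) where
  carrier := {t | HasWeight H i j 1 t ∧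
    RaisesWeight H (i + j) (t.right.1 - t.right.2.1 • δ - t.right.2.2 • ε)}
  zero_mem' := ⟨.zero, by simpa using RaisesWeight.zero⟩
  add_mem' := by
    rintro t s ⟨ht, ht'⟩ ⟨hs, hs'⟩
    refine ⟨ht.add hs, ?_⟩
    convert! ht'.add hs' using 1
    simp only [SemiDirectSum.add_eq_mk, Prod.fst_add, Prod.snd_add, AbelianPlane.fst_add,
      AbelianPlane.snd_add]
    module
  smul_mem' := by
    rintro r t ⟨ht, ht'⟩
    refine ⟨ht.smul r, ?_⟩
    convert! ht'.smul r using 1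
    simp only [SemiDirectSum.smul_eq_mk, Prod.smul_fst, Prod.smul_snd, AbelianPlane.fst_smul,
      AbelianPlane.snd_smul]
    module
  lie_mem' := by
    rintro t s ⟨ht, ht'⟩ ⟨hs, hs'⟩
    refine ⟨(ht.lie hH le_rfl le_rfl hs).mono hH le_rfl (by omega), ?_⟩
    set γ := t.right.1 - t.right.2.1 • δ - t.right.2.2 • ε with hγ
    set γ' := s.right.1 - s.right.2.1 • δ - s.right.2.2 • ε with hγ'
    have e₁ : t.right.1 = t.right.2.1 • δ + t.right.2.2 • ε + γ := by rw [hγ]; module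
    have e₂ : s.right.1 = s.right.2.1 • δ + s.right.2.2 • ε + γ' := by rw [hγ']; module
    have e₃ : ⁅t, s⁆.right.1 - ⁅t, s⁆.right.2.1 • δ - ⁅t, s⁆.right.2.2 • ε =
        ⁅t.right.1, s.right.1⁆ := by
      change ⁅t.right.1, s.right.1⁆ - (0 : F) • δ - (0 : F) • ε = _
      module
    rw [e₃, e₁, e₂]
    have hm : ∀ {m} {ζ : LieDerivation F C C}, i + j ≤ m → RaisesWeight H m ζ →
      RaisesWeight H (i + j) ζ := fun hm hζ => hζ.mono hH hm
    have hsmul : ∀ (r : F) (ζ ζ' : LieDerivation F C C), ⁅ζ, r • ζ'⁆ = r • ⁅ζ, ζ'⁆ :=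
      fun r ζ ζ' => LieAlgebra.lie_smul r ζ ζ'
    have hself : ∀ ζ : LieDerivation F C C, ⁅ζ, ζ⁆ = 0 := LieRing.lie_self
    -- The vanishing of [δ, δ] and [ε, ε] is essential, since 2i or 2j may be less than i + j. Every
    -- remaining term has weight at least i + j.
    simp only [lie_add, add_lie, hsmul, smul_lie, hself, smul_zero, zero_add, add_zero]
    have hδε := hδ.lie hε
    have hεδ := hm (by omega) (hε.lie hδ)
    have h₁ := hm (by omega) (hδ.lie hs')
    have h₂ := hm (by omega) (hε.lie hs')
    have h₃ := hm (by omega) (ht'.lie hδ)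
    have h₄ := hm (by omega) (ht'.lie hε)
    have h₅ := hm (by omega) (ht'.lie hs')
    repeat' first
      | apply RaisesWeight.add
      | apply RaisesWeight.smul
      | assumption

/-- The series of the amalgam. -/
def amalgamSeries (hH : IsLieLazardSeries c H) {δ ε : LieDerivation F C C}
    (hδ : RaisesWeight H i δ) (hε : RaisesWeight H j ε) (k : ℕ) :
    LieSubalgebra F (amalgamSubalgebra hH hδ hε) where
  -- The index 0 is treated like 1, so that a subalgebra results for every k.
  carrier := {t | HasWeight H i j (max k 1) (t : Ambient F C)}
  zero_mem' := .zero
  add_mem' := fun ht hs => HasWeight.add ht hs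
  smul_mem' := fun r _ ht => HasWeight.smul ht r
  lie_mem' := fun ht hs => (HasWeight.lie hH (by omega) (by omega) ht hs).mono hH (by omega)
    (by omega)

theorem mem_amalgamSeries {hH : IsLieLazardSeries c H} {δ ε : LieDerivation F C C}
    {hδ : RaisesWeight H i δ} {hε : RaisesWeight H j ε} (hk : 1 ≤ k)
    {t : amalgamSubalgebra hH hδ hε} :
    t ∈ amalgamSeries hH hδ hε k ↔ HasWeight H i j k (t : Ambient F C) := by
  change HasWeight H i j (max k 1) (t : Ambient F C) ↔ _
  rw [max_eq_left hk]

theorem amalgamSeries_isLieLazardSeries (hH : IsLieLazardSeries c H) {δ ε : LieDerivation F C C}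
    (hδ : RaisesWeight H i δ) (hε : RaisesWeight H j ε) (hi : i ≤ c) (hj : j ≤ c) :
    IsLieLazardSeries c (amalgamSeries hH hδ hε) where
  one := by
    rw [eq_top_iff]
    exact fun t _ => (mem_amalgamSeries le_rfl).2 t.2.1
  anti k hk t ht := by
    rw [mem_amalgamSeries (by omega)] at ht ⊢
    exact ht.mono hH hk (by omega)
  bot k hk := by
    rw [eq_bot_iff]
    intro t ht
    rw [mem_amalgamSeries (by omega)] at ht
    rw [LieSubalgebra.mem_bot]
    exact Subtype.ext (ht.eq_zero hH hi hj hk)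
  lie_mem k l hk hl t ht s hs := by
    rw [mem_amalgamSeries (by omega)] at ht hs ⊢
    exact ht.lie hH hk hl hs

end Amalgam

/-- The embedding `f` of `A` into `D` is a composition of an embedding onto a subalgebra `R` with
`R = f(A) + H m` and of a step of weight `j` which adjoins `t`. -/
def FactorsThroughStep {A D : Type*} [LieRing A] [LieAlgebra F A] [LieRing D] [LieAlgebra F D]
    (HD : ℕ → LieSubalgebra F D) (f : A →ₗ⁅F⁆ D) (t : D) (j m : ℕ) : Prop :=
  ∃ R : LieSubalgebra F D, (∀ x, f x ∈ R) ∧ (∀ x ∈ R, ∃ y, ∃ z ∈ HD m, x = f y + z) ∧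
    t ∈ HD j ∧ t ∉ R ∧ (∀ d, ∃ r ∈ R, ∃ s : F, d = r + s • t) ∧ (∀ r ∈ R, ⁅t, r⁆ ∈ R) ∧
    HD (j + 1) ≤ R

/-- Take R = q(A) + HD(i + j). It is normalised by `t` because [t, q(a)] has weight i + j while [t,
q(f(C))] stays in q(A). The functional μ reads off the coefficient of `t` modulo R; as it vanishes
on weight j + 1, elements of that weight lie in R. -/
theorem factorsThroughStep_of_functional {c : ℕ} {C A D : Type*} [LieRing C] [LieAlgebra F C]
    [LieRing A] [LieAlgebra F A] [LieRing D] [LieAlgebra F D] {HC : ℕ → LieSubalgebra F C}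
    {HA : ℕ → LieSubalgebra F A} {HD : ℕ → LieSubalgebra F D} {f : C →ₗ⁅F⁆ A} {i j : ℕ} {a : A}
    (h : IsLieStep HC HA f i a) (hD : IsLieLazardSeries c HD) {q : A →ₗ⁅F⁆ D}
    (hq : q a ∈ HD i) (hj : 1 ≤ j) {t : D} (ht : t ∈ HD j) (μ : D →ₗ[F] F)
    (hμ : ∀ d ∈ HD (j + 1), μ d = 0) (hμt : μ t = 1) (hμq : ∀ x, μ (q x) = 0)
    (hC : ∀ y, ∃ z, ⁅t, q (f y)⁆ = q z)
    (hspan : ∀ d, ∃ x, ∃ z ∈ HD (i + j), d = q x + μ d • t + z) :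
    FactorsThroughStep HD q t j (i + j) := by
  have hi := h.pos
  have hlie : ∀ (m : ℕ), 1 ≤ m → ∀ d : D, ∀ z ∈ HD m, ⁅d, z⁆ ∈ HD m := fun m hm d z hz =>
    hD.mono hm (by omega) (hD.lie_mem 1 m le_rfl hm d (hD.mem_one d) z hz)
  let R : LieSubalgebra F D :=
    { carrier := {d | ∃ x, ∃ z ∈ HD (i + j), d = q x + z}
      zero_mem' := ⟨0, 0, zero_mem _, by simp⟩
      add_mem' := by
        rintro _ _ ⟨x, z, hz, rfl⟩ ⟨x', z', hz', rfl⟩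
        exact ⟨x + x', z + z', add_mem hz hz', by rw [map_add]; abel⟩
      smul_mem' := by
        rintro r _ ⟨x, z, hz, rfl⟩
        exact ⟨r • x, r • z, (HD _).smul_mem r hz, by rw [map_smul, smul_add]⟩
      lie_mem' := by
        rintro _ _ ⟨x, z, hz, rfl⟩ ⟨x', z', hz', rfl⟩
        refine ⟨⁅x, x'⁆, ⁅q x, z'⁆ + ⁅z, q x' + z'⁆, add_mem (hlie _ (by omega) _ _ hz') ?_, ?_⟩
        · rw [← lie_skew]
          exact neg_mem (hlie _ (by omega) _ _ hz)
        · rw [LieHom.map_lie, add_lie, lie_add]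
          abel }
  refine ⟨R, fun x => ⟨x, 0, zero_mem _, by simp⟩, fun x hx => hx, ht, ?_, ?_, ?_, ?_⟩
  · rintro ⟨x, z, hz, rfl⟩
    rw [map_add, hμq, hμ z (hD.mono (by omega) (by omega) hz), add_zero] at hμt
    exact zero_ne_one hμt
  · intro d
    obtain ⟨x, z, hz, hd⟩ := hspan d
    exact ⟨q x + z, ⟨x, z, hz, rfl⟩, μ d, by rw [add_right_comm]; exact hd⟩
  · rintro _ ⟨x, z, hz, rfl⟩
    obtain ⟨y, r, rfl⟩ := h.span x
    obtain ⟨w, hw⟩ := hC y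
    refine ⟨w, r • ⁅t, q a⁆ + ⁅t, z⁆, add_mem ((HD _).smul_mem r ?_) (hlie _ (by omega) _ _ hz), ?_⟩
    · rw [add_comm]
      exact hD.lie_mem j i hj hi t ht _ hq
    · rw [map_add, map_smul, lie_add, lie_add, lie_smul, hw]
      abel
  · intro d hd
    obtain ⟨x, z, hz, hd'⟩ := hspan d
    rw [hμ d hd, zero_smul, add_zero] at hd'
    exact ⟨x, z, hz, hd'⟩

/-- Up to weight i the summand r • a can be cancelled; beyond it, `next` and uniqueness force r = 0.
The redundant condition on r • δ gives the right-hand side the shape of `HasWeight` for the image in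
the ambient algebra. -/
theorem IsLieStep.mem_series_iff {c : ℕ} {C A : Type*} [LieRing C] [LieAlgebra F C] [LieRing A]
    [LieAlgebra F A] {HC : ℕ → LieSubalgebra F C} {HA : ℕ → LieSubalgebra F A} {f : C →ₗ⁅F⁆ A}
    {i : ℕ} {a : A} (h : IsLieStep HC HA f i a) (hC : IsLieLazardSeries c HC)
    (hA : IsLieLazardSeries c HA) {δ : LieDerivation F C C} (hδ : RaisesWeight HC i δ) {k : ℕ}
    (hk : 1 ≤ k) (y : C) (r : F) :
    f y + r • a ∈ HA k ↔ y ∈ HC k ∧ RaisesWeight HC k (r • δ) ∧ (k ≤ i ∨ r = 0) := by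
  by_cases hki : k ≤ i
  · have ha : r • a ∈ HA k := (HA k).smul_mem r (hA.mono hk hki h.mem)
    rw [add_mem_cancel_right ha, h.mem_iff k hk]
    exact ⟨fun hy => ⟨hy, (hδ.mono hC hki).smul r, Or.inl hki⟩, fun hy => hy.1⟩
  · constructor
    · intro hx
      obtain ⟨y', hy'⟩ := h.next _ (hA.mono (by omega) (by omega) hx)
      obtain ⟨rfl, rfl⟩ := h.unique (y := y) (y' := y') (r := r) (r' := 0)
        (by rw [zero_smul, add_zero]; exact hy'.symm)
      rw [zero_smul, add_zero, h.mem_iff k hk] at hx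
      exact ⟨hx, by rw [zero_smul]; exact .zero, Or.inr rfl⟩
    · rintro ⟨hy, -, hr⟩
      rw [hr.resolve_left hki, zero_smul, add_zero]
      exact (h.mem_iff k hk y).2 hy

/-- Restriction of the codomain of a homomorphism of Lie algebras to a subalgebra. -/
def lieHomCodRestrict {A T : Type*} [LieRing A] [LieAlgebra F A] [LieRing T] [LieAlgebra F T]
    (D : LieSubalgebra F T) (q : A →ₗ⁅F⁆ T) (hq : ∀ x, q x ∈ D) : A →ₗ⁅F⁆ D :=
  { LinearMap.codRestrict D.toSubmodule (q : A →ₗ[F] T) hq with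
    map_lie' := fun {_ _} => Subtype.ext (q.map_lie _ _) }

/-- Amalgamation of one-step extensions. -/
theorem IsLieStep.exists_amalgam {c : ℕ} {C A B : Type*} [LieRing C] [LieAlgebra F C]
    [LieRing A] [LieAlgebra F A] [LieRing B] [LieAlgebra F B]
    {HC : ℕ → LieSubalgebra F C} {HA : ℕ → LieSubalgebra F A} {HB : ℕ → LieSubalgebra F B}
    {f : C →ₗ⁅F⁆ A} {g : C →ₗ⁅F⁆ B} {i j : ℕ} {a : A} {b : B}
    (hC : IsLieLazardSeries c HC) (hA : IsLieLazardSeries c HA) (hB : IsLieLazardSeries c HB)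
    (hf : IsLieStep HC HA f i a) (hg : IsLieStep HC HB g j b) (hi : i ≤ c) (hj : j ≤ c) :
    ∃ (D : LieSubalgebra F (Ambient F C)) (HD : ℕ → LieSubalgebra F D) (f' : A →ₗ⁅F⁆ D)
      (g' : B →ₗ⁅F⁆ D), IsLieLazardSeries c HD ∧
      (∀ k, 1 ≤ k → ∀ x, f' x ∈ HD k ↔ x ∈ HA k) ∧ (∀ k, 1 ≤ k → ∀ x, g' x ∈ HD k ↔ x ∈ HB k) ∧
      (∀ y, f' (f y) = g' (g y)) ∧ FactorsThroughStep HD f' (g' b) j (i + j) ∧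
      FactorsThroughStep HD g' (f' a) i (j + i) := by
  obtain ⟨δ, hδ⟩ := hf.exists_derivation
  obtain ⟨ε, hε⟩ := hg.exists_derivation
  have hδw := hf.raisesWeight hA hδ
  have hεw := hg.raisesWeight hB hε
  let D := amalgamSubalgebra hC hδw hεw
  let HD := amalgamSeries hC hδw hεw
  have hHD : IsLieLazardSeries c HD := amalgamSeries_isLieLazardSeries hC hδw hεw hi hj
  -- The new element acts as its own derivation and is marked by a basis vector of the plane.
  -- Without the mark, steps with equal or zero derivations could not be kept apart.
  obtain ⟨qa, hqa⟩ := hf.exists_lift hδ (SemiDirectSum.inl _ : C →ₗ⁅F⁆ Ambient F C)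
    ⟨0, (δ, ((1, 0) : F × F))⟩ (fun y => by ext <;> simp)
  obtain ⟨qb, hqb⟩ := hg.exists_lift hε (SemiDirectSum.inl _ : C →ₗ⁅F⁆ Ambient F C)
    ⟨0, (ε, ((0, 1) : F × F))⟩ (fun y => by ext <;> simp)
  replace hqa : ∀ (y : C) (r : F), qa (f y + r • a) = ⟨y, (r • δ, ((r, 0) : F × F))⟩ := by
    intro y r
    rw [hqa]
    refine SemiDirectSum.ext (by simp) (Prod.ext (by simp) (Prod.ext ?_ ?_))
    · exact (zero_add _).trans (mul_one r)
    · exact (zero_add _).trans (mul_zero r)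
  replace hqb : ∀ (y : C) (r : F), qb (g y + r • b) = ⟨y, (r • ε, ((0, r) : F × F))⟩ := by
    intro y r
    rw [hqb]
    refine SemiDirectSum.ext (by simp) (Prod.ext (by simp) (Prod.ext ?_ ?_))
    · exact (zero_add _).trans (mul_zero r)
    · exact (zero_add _).trans (mul_one r)
  have hqaw : ∀ k, 1 ≤ k → ∀ x, HasWeight HC i j k (qa x) ↔ x ∈ HA k := by
    intro k hk x
    obtain ⟨y, r, rfl⟩ := hf.span x
    rw [hf.mem_series_iff hC hA hδw hk, hqa]
    exact ⟨fun h => ⟨h.1, h.2, h.3⟩, fun h => ⟨h.1, h.2.1, h.2.2, Or.inr rfl⟩⟩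
  have hqbw : ∀ k, 1 ≤ k → ∀ x, HasWeight HC i j k (qb x) ↔ x ∈ HB k := by
    intro k hk x
    obtain ⟨y, r, rfl⟩ := hg.span x
    rw [hg.mem_series_iff hC hB hεw hk, hqb]
    exact ⟨fun h => ⟨h.1, h.2, h.4⟩, fun h => ⟨h.1, h.2.1, Or.inr rfl, h.2.2⟩⟩
  have hqaD : ∀ x, qa x ∈ D := by
    intro x
    refine ⟨(hqaw 1 le_rfl x).2 (hA.mem_one x), ?_⟩
    obtain ⟨y, r, rfl⟩ := hf.span x
    rw [hqa]
    convert! RaisesWeight.zero using 1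
    dsimp only
    module
  have hqbD : ∀ x, qb x ∈ D := by
    intro x
    refine ⟨(hqbw 1 le_rfl x).2 (hB.mem_one x), ?_⟩
    obtain ⟨y, r, rfl⟩ := hg.span x
    rw [hqb]
    convert! RaisesWeight.zero using 1
    dsimp only
    module
  have hfa : ∀ y, qa (f y) = ⟨y, (0, ((0, 0) : F × F))⟩ := fun y => by
    have := hqa y 0
    rwa [zero_smul, add_zero, zero_smul] at this
  have hgb : ∀ y, qb (g y) = ⟨y, (0, ((0, 0) : F × F))⟩ := fun y => by
    have := hqb y 0
    rwa [zero_smul, add_zero, zero_smul] at this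
  have haa : qa a = ⟨0, (δ, ((1, 0) : F × F))⟩ := by
    have := hqa 0 1
    rwa [one_smul, map_zero, zero_add, one_smul] at this
  have hbb : qb b = ⟨0, (ε, ((0, 1) : F × F))⟩ := by
    have := hqb 0 1
    rwa [one_smul, map_zero, zero_add, one_smul] at this
  let f' : A →ₗ⁅F⁆ D := lieHomCodRestrict D qa hqaD
  let g' : B →ₗ⁅F⁆ D := lieHomCodRestrict D qb hqbD
  have hfg : ∀ y, f' (f y) = g' (g y) := fun y => Subtype.ext ((hfa y).trans (hgb y).symm)
  have hf'w : ∀ k, 1 ≤ k → ∀ x, f' x ∈ HD k ↔ x ∈ HA k := fun k hk x =>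
    (mem_amalgamSeries hk).trans (hqaw k hk x)
  have hg'w : ∀ k, 1 ≤ k → ∀ x, g' x ∈ HD k ↔ x ∈ HB k := fun k hk x =>
    (mem_amalgamSeries hk).trans (hqbw k hk x)
  let lam : D →ₗ[F] F :=
    { toFun := fun d => (d : Ambient F C).right.2.1
      map_add' := fun _ _ => rfl
      map_smul' := fun _ _ => rfl }
  let mu : D →ₗ[F] F :=
    { toFun := fun d => (d : Ambient F C).right.2.2
      map_add' := fun _ _ => rfl
      map_smul' := fun _ _ => rfl }
  -- Subtracting the `C`-part and the multiples of a and b given by the plane coordinates leaves a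
  -- derivation of weight i + j: this is the condition that defines the amalgam.
  have hdec : ∀ d : D, ∃ z ∈ HD (i + j),
      d = f' (f (d : Ambient F C).left) + lam d • f' a + mu d • g' b + z := by
    intro d
    refine ⟨d - (f' (f (d : Ambient F C).left) + lam d • f' a + mu d • g' b), ?_, by abel⟩
    have hi' := hf.pos
    rw [mem_amalgamSeries (by omega)]
    change HasWeight HC i j (i + j) ((d : Ambient F C) - (qa (f (d : Ambient F C).left) +
      (d : Ambient F C).right.2.1 • qa a + (d : Ambient F C).right.2.2 • qb b))
    rw [hfa, haa, hbb]
    obtain ⟨⟨x, γ, (r : F), (s : F)⟩, hd⟩ := d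
    refine ⟨?_, ?_, Or.inr ?_, Or.inr ?_⟩
    · simp
    · convert! hd.2 using 1
      simp only [SemiDirectSum.smul_eq_mk, SemiDirectSum.add_eq_mk, SemiDirectSum.sub_eq_mk,
        Prod.fst_add, Prod.fst_sub, Prod.smul_fst]
      module
    · change r - (0 + r * 1 + s * 0) = 0
      ring
    · change s - (0 + r * 0 + s * 1) = 0
      ring
  refine ⟨D, HD, f', g', hHD, hf'w, hg'w, hfg, ?_, ?_⟩
  · refine factorsThroughStep_of_functional hf hHD ((hf'w i hf.pos a).2 hf.mem) hg.pos
      ((hg'w j hg.pos b).2 hg.mem) mu ?_ ?_ ?_ ?_ ?_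
    · intro d hd
      rw [mem_amalgamSeries (by omega)] at hd
      exact hd.snd.resolve_left (by omega)
    · change (qb b).right.2.2 = 1
      rw [hbb]
    · intro x
      obtain ⟨y, r, rfl⟩ := hf.span x
      change (qa (f y + r • a)).right.2.2 = 0
      rw [hqa]
    · intro y
      obtain ⟨z, hz⟩ := hg.ideal y
      exact ⟨f z, by rw [hfg, ← LieHom.map_lie, hz, hfg]⟩
    · intro d
      obtain ⟨z, hz, hd⟩ := hdec d
      refine ⟨f (d : Ambient F C).left + lam d • a, z, hz, hd.trans ?_⟩
      rw [map_add, map_smul]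
  · refine factorsThroughStep_of_functional hg hHD ((hg'w j hg.pos b).2 hg.mem) hf.pos
      ((hf'w i hf.pos a).2 hf.mem) lam ?_ ?_ ?_ ?_ ?_
    · intro d hd
      rw [mem_amalgamSeries (by omega)] at hd
      exact hd.fst.resolve_left (by omega)
    · change (qa a).right.2.1 = 1
      rw [haa]
    · intro x
      obtain ⟨y, r, rfl⟩ := hg.span x
      change (qb (g y + r • b)).right.2.1 = 0
      rw [hqb]
    · intro y
      obtain ⟨z, hz⟩ := hf.ideal y
      exact ⟨g z, by rw [← hfg, ← LieHom.map_lie, hz, hfg]⟩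
    · intro d
      obtain ⟨z, hz, hd⟩ := hdec d
      refine ⟨g (d : Ambient F C).left + mu d • b, z, by rwa [add_comm], hd.trans ?_⟩
      rw [map_add, map_smul, hfg]
      abel

end LieSteps

/-! ### Finite generation and nilpotency of Lie algebras -/

section LieGeneration

variable {F : Type*} [Field F] {A : Type*} [LieRing A] [LieAlgebra F A]

theorem IsLieLazardSeries.lie_mem_series {c : ℕ} {H : ℕ → LieSubalgebra F A}
    (h : IsLieLazardSeries c H) {k : ℕ} (hk : 1 ≤ k) (x : A) {y : A} (hy : y ∈ H k) :
    ⁅x, y⁆ ∈ H (k + 1) := by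
  rw [add_comm]
  exact h.lie_mem 1 k le_rfl hk x (h.mem_one x) y hy

/-- The lower central series descends at least as fast as any Lazard series, so the bound on the
nilpotency class in the definition of the class is automatic. -/
theorem IsLieLazardSeries.lowerCentralSeries_eq_bot {c : ℕ} {H : ℕ → LieSubalgebra F A}
    (h : IsLieLazardSeries c H) : LieModule.lowerCentralSeries F A A c = ⊥ := by
  have hle : ∀ k, ∀ x ∈ LieModule.lowerCentralSeries F A A k, x ∈ H (k + 1) := by
    intro k
    induction k with
    | zero => exact fun x _ => h.mem_one x
    | succ k ih =>
      let N : LieSubmodule F A A :=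
        { (H (k + 1 + 1)).toSubmodule with
          lie_mem := fun {x m} hm =>
            h.anti _ (by omega) (h.lie_mem_series (by omega) x hm) }
      have : LieModule.lowerCentralSeries F A A (k + 1) ≤ N := by
        rw [LieModule.lowerCentralSeries_succ, LieSubmodule.lie_le_iff]
        exact fun x _ m hm => h.lie_mem_series (by omega) x (ih m hm)
      exact fun x hx => this hx
  rw [eq_bot_iff]
  intro x hx
  have := hle c x hx
  rw [h.bot _ (Nat.lt_succ_self c)] at this
  exact this

open Classical in
/-- The right-normed brackets of length `k + 1` in the elements of `X`. -/
noncomputable def rightNormedBrackets (X : Finset A) : ℕ → Finset A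
  | 0 => X
  | k + 1 => Finset.image₂ (fun x y => ⁅x, y⁆) X (rightNormedBrackets X k)

theorem card_rightNormedBrackets_le (X : Finset A) (k : ℕ) :
    (rightNormedBrackets X k).card ≤ X.card ^ (k + 1) := by
  induction k with
  | zero => simp [rightNormedBrackets]
  | succ k ih =>
    classical
    refine (Finset.card_image₂_le _ _ _).trans ?_
    rw [pow_succ' _ (k + 1)]
    exact Nat.mul_le_mul_left _ ih

/-- Right-normed brackets of more than c generators vanish by weight, and the shorter ones span. The
explicit cardinality yields uniform local finiteness over finite fields. -/
theorem IsLieLazardSeries.exists_spanning_finset {c : ℕ} {H : ℕ → LieSubalgebra F A}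
    (h : IsLieLazardSeries c H) (X : Finset A) (hX : LieSubalgebra.lieSpan F A (X : Set A) = ⊤) :
    ∃ T : Finset A, Submodule.span F (T : Set A) = ⊤ ∧
      T.card ≤ ∑ k ∈ Finset.range c, X.card ^ (k + 1) := by
  classical
  refine ⟨(Finset.range c).biUnion (rightNormedBrackets X), ?_,
    Finset.card_biUnion_le.trans (Finset.sum_le_sum fun k _ => card_rightNormedBrackets_le X k)⟩
  set W := Submodule.span F (((Finset.range c).biUnion (rightNormedBrackets X) : Finset A) : Set A)
    with hW
  have hwt : ∀ k, ∀ x ∈ rightNormedBrackets X k, x ∈ H (k + 1) := by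
    intro k
    induction k with
    | zero => exact fun x _ => h.mem_one x
    | succ k ih =>
      intro x hx
      obtain ⟨y, -, z, hz, rfl⟩ := Finset.mem_image₂.1 hx
      exact h.lie_mem_series (by omega) y (ih z hz)
  have hmem : ∀ k, ∀ x ∈ rightNormedBrackets X k, x ∈ W := by
    intro k x hx
    by_cases hk : k < c
    · exact Submodule.subset_span (Finset.mem_coe.2
        (Finset.mem_biUnion.2 ⟨k, Finset.mem_range.2 hk, hx⟩))
    · have := hwt k x hx
      rw [h.bot _ (by omega), LieSubalgebra.mem_bot] at this
      rw [this]
      exact zero_mem _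
  have hXW : ∀ x ∈ X, ∀ w ∈ W, ⁅x, w⁆ ∈ W := by
    intro x hx w hw
    induction hw using Submodule.span_induction with
    | mem w hw =>
      obtain ⟨k, -, hk⟩ := Finset.mem_biUnion.1 (Finset.mem_coe.1 hw)
      exact hmem (k + 1) _ (Finset.mem_image₂.2 ⟨x, hx, w, hk, rfl⟩)
    | zero => rw [lie_zero]; exact zero_mem _
    | add w w' _ _ h₁ h₂ => rw [lie_add]; exact add_mem h₁ h₂
    | smul r w _ h₁ => rw [lie_smul]; exact W.smul_mem r h₁
  -- The elements that stabilise W form a subalgebra by the Jacobi identity. It contains the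
  -- generators, so W is an ideal and in particular a subalgebra containing `X`.
  let I : LieSubalgebra F A :=
    { carrier := {x | ∀ w ∈ W, ⁅x, w⁆ ∈ W}
      zero_mem' := fun w _ => by rw [zero_lie]; exact zero_mem _
      add_mem' := fun {x y} hx hy w hw => by rw [add_lie]; exact add_mem (hx w hw) (hy w hw)
      smul_mem' := fun r x hx w hw => by rw [smul_lie]; exact W.smul_mem r (hx w hw)
      lie_mem' := fun {x y} hx hy w hw => by
        rw [lie_lie]
        exact sub_mem (hx _ (hy w hw)) (hy _ (hx w hw)) }
  have hI : I = ⊤ := by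
    rw [eq_top_iff, ← hX, LieSubalgebra.lieSpan_le]
    exact hXW
  let J : LieSubalgebra F A :=
    { W with
      lie_mem' := fun {x y} _ hy => by
        have : x ∈ I := hI ▸ LieSubalgebra.mem_top x
        exact this y hy }
  have hJ : J = ⊤ := by
    rw [eq_top_iff, ← hX, LieSubalgebra.lieSpan_le]
    exact fun x hx => hmem 0 x hx
  rw [eq_top_iff]
  intro x _
  have : x ∈ J := hJ ▸ LieSubalgebra.mem_top x
  exact this

end LieGeneration

/-! ### Embeddings and symbols of small arity -/

section Symbols

variable {L : FirstOrder.Language.{u, v}} {M N : Type*} [L.Structure M] [L.Structure N]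

theorem map_funMap_zero (f : M ↪[L] N) (g : L.Functions 0) :
    f (Structure.funMap g ![]) = Structure.funMap g ![] :=
  (f.map_fun g _).trans (congrArg _ (Subsingleton.elim _ _))

theorem map_funMap_one (f : M ↪[L] N) (g : L.Functions 1) (x : M) :
    f (Structure.funMap g ![x]) = Structure.funMap g ![f x] :=
  (f.map_fun g _).trans (congrArg _ (by funext i; fin_cases i; rfl))

theorem map_funMap_two (f : M ↪[L] N) (g : L.Functions 2) (x y : M) :
    f (Structure.funMap g ![x, y]) = Structure.funMap g ![f x, f y] :=
  (f.map_fun g _).trans (congrArg _ (by funext i; fin_cases i <;> rfl))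

theorem map_relMap_one (f : M ↪[L] N) (r : L.Relations 1) (x : M) :
    Structure.RelMap r ![f x] ↔ Structure.RelMap r ![x] := by
  rw [← f.map_rel]
  apply iff_of_eq
  congr 1; funext i; fin_cases i; rfl

end Symbols

/-! ### Translation between structures and Lazard Lie algebras -/

section LieLanguage

variable {c : ℕ} {F : Type u} [Field F]

/-- The structure `M` consists of the operations of a Lie algebra and of the Lazard series `H`. -/
structure LieCompatible (c : ℕ) (F : Type u) [Field F] (M : Type w) [(lieLang c F).Structure M]
    [LieRing M] [LieAlgebra F M] (H : ℕ → LieSubalgebra F M) : Prop where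
  add : ∀ x y : M, Structure.funMap (L := lieLang c F) LieFunc.add ![x, y] = x + y
  neg : ∀ x : M, Structure.funMap (L := lieLang c F) LieFunc.neg ![x] = -x
  zero : Structure.funMap (L := lieLang c F) LieFunc.zero ![] = (0 : M)
  bracket : ∀ x y : M, Structure.funMap (L := lieLang c F) LieFunc.bracket ![x, y] = ⁅x, y⁆
  smul : ∀ (r : F) (x : M), Structure.funMap (L := lieLang c F) (LieFunc.smul r) ![x] = r • x
  pred : ∀ (i : Fin (c + 1)) (x : M),
    Structure.RelMap (L := lieLang c F) (LazardRel.pred i) ![x] ↔ x ∈ H (i + 1)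
  series : IsLieLazardSeries c H

theorem isLazardLieAlgebra_iff {M : Type w} [(lieLang c F).Structure M] :
    IsLazardLieAlgebra c F M ↔ ∃ (_ : LieRing M) (_ : LieAlgebra F M) (H : ℕ → LieSubalgebra F M),
      LieCompatible c F M H :=
  ⟨fun ⟨i, j, H, h₁, h₂, h₃, h₄, h₅, h₆, h₇, _⟩ => ⟨i, j, H, h₁, h₂, h₃, h₄, h₅, h₆, h₇⟩,
    fun ⟨i, j, H, h⟩ => ⟨i, j, H, h.add, h.neg, h.zero, h.bracket, h.smul, h.pred, h.series,
      h.series.lowerCentralSeries_eq_bot⟩⟩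

/-- The structure given by a Lie algebra and a series of subalgebras. -/
@[reducible]
def lieStructure (c : ℕ) (F : Type u) [Field F] {M : Type w} [LieRing M] [LieAlgebra F M]
    (H : ℕ → LieSubalgebra F M) : (lieLang c F).Structure M where
  funMap := fun {_} f => match f with
    | LieFunc.add => fun x => x 0 + x 1
    | LieFunc.neg => fun x => -x 0
    | LieFunc.zero => fun _ => 0
    | LieFunc.bracket => fun x => ⁅x 0, x 1⁆
    | LieFunc.smul r => fun x => r • x 0
  RelMap := fun {_} r => match r with
    | LazardRel.pred i => fun x => x 0 ∈ H (i + 1)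

theorem lieCompatible_lieStructure {M : Type w} [LieRing M] [LieAlgebra F M]
    {H : ℕ → LieSubalgebra F M} (h : IsLieLazardSeries c H) :
    letI := lieStructure c F H
    LieCompatible c F M H :=
  letI := lieStructure c F H
  ⟨fun _ _ => rfl, fun _ => rfl, rfl, fun _ _ => rfl, fun _ _ => rfl, fun _ _ => Iff.rfl, h⟩

namespace LieCompatible

variable {M N : Type*} [(lieLang c F).Structure M] [(lieLang c F).Structure N]
  [LieRing M] [LieAlgebra F M] [LieRing N] [LieAlgebra F N]
  {H : ℕ → LieSubalgebra F M} {H' : ℕ → LieSubalgebra F N}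

theorem mem_of_pred (h : LieCompatible c F M H) {k : ℕ} (hk : k < c + 1) (x : M) :
    Structure.RelMap (L := lieLang c F) (LazardRel.pred ⟨k, hk⟩) ![x] ↔ x ∈ H (k + 1) :=
  h.pred ⟨k, hk⟩ x

/-- The subalgebra with the same elements as a substructure. -/
def toSubalgebra (h : LieCompatible c F M H) (S : (lieLang c F).Substructure M) :
    LieSubalgebra F M where
  carrier := S
  zero_mem' := by
    rw [← h.zero]
    exact S.fun_mem _ _ fun i => i.elim0
  add_mem' := fun {x y} hx hy => by
    rw [← h.add]
    exact S.fun_mem _ _ (by intro i; fin_cases i; exacts [hx, hy])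
  smul_mem' := fun r x hx => by
    rw [← h.smul]
    exact S.fun_mem _ _ (by intro i; fin_cases i; exact hx)
  lie_mem' := fun {x y} hx hy => by
    change ⁅x, y⁆ ∈ S
    rw [← h.bracket]
    exact S.fun_mem _ _ (by intro i; fin_cases i; exacts [hx, hy])

theorem mem_toSubalgebra (h : LieCompatible c F M H) {S : (lieLang c F).Substructure M} {x : M} :
    x ∈ h.toSubalgebra S ↔ x ∈ S := Iff.rfl

/-- The substructure with the same elements as a subalgebra. -/
def ofSubalgebra (h : LieCompatible c F M H) (R : LieSubalgebra F M) :
    (lieLang c F).Substructure M where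
  carrier := R
  fun_mem := fun {n} f x hx => by
    have e₂ : ∀ y : Fin 2 → M, y = ![y 0, y 1] := fun y => by
      funext i; fin_cases i <;> rfl
    have e₁ : ∀ y : Fin 1 → M, y = ![y 0] := fun y => by
      funext i; fin_cases i; rfl
    cases f with
    | add => rw [e₂ x, h.add]; exact add_mem (hx 0) (hx 1)
    | neg => rw [e₁ x, h.neg]; exact neg_mem (hx 0)
    | zero => rw [Subsingleton.elim x ![], h.zero]; exact zero_mem R
    | bracket => rw [e₂ x, h.bracket]; exact R.lie_mem (hx 0) (hx 1)
    | smul r => rw [e₁ x, h.smul]; exact R.smul_mem r (hx 0)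

theorem exists_substructure (h : LieCompatible c F M H) (S : (lieLang c F).Substructure M) :
    ∃ (_ : LieRing S) (_ : LieAlgebra F S) (HS : ℕ → LieSubalgebra F S),
      LieCompatible c F S HS := by
  let i₁ : LieRing S := inferInstanceAs (LieRing (h.toSubalgebra S))
  let i₂ : LieAlgebra F S := inferInstanceAs (LieAlgebra F (h.toSubalgebra S))
  let inc : S →ₗ⁅F⁆ M := (h.toSubalgebra S).incl
  refine ⟨i₁, i₂, fun k => (H k).comap inc, fun x y => Subtype.ext ?_, fun x => Subtype.ext ?_,
    Subtype.ext ?_, fun x y => Subtype.ext ?_, fun r x => Subtype.ext ?_, fun k x => ?_,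
    ?_, ?_, ?_, ?_⟩
  · exact (map_funMap_two (L := lieLang c F) S.subtype LieFunc.add x y).trans (h.add _ _)
  · exact (map_funMap_one (L := lieLang c F) S.subtype LieFunc.neg x).trans (h.neg _)
  · exact (map_funMap_zero (L := lieLang c F) S.subtype LieFunc.zero).trans h.zero
  · exact (map_funMap_two (L := lieLang c F) S.subtype LieFunc.bracket x y).trans (h.bracket _ _)
  · exact (map_funMap_one (L := lieLang c F) S.subtype (LieFunc.smul r) x).trans (h.smul _ _)
  · exact (map_relMap_one (L := lieLang c F) S.subtype (LazardRel.pred k) x).symm.trans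
      (h.pred _ _)
  · rw [eq_top_iff]
    intro x _
    change (x : M) ∈ H 1
    exact h.series.mem_one _
  · exact fun k hk x hx => h.series.anti k hk hx
  · intro k hk
    rw [eq_bot_iff]
    intro x hx
    have hx' : (x : M) ∈ H k := hx
    rw [h.series.bot k hk] at hx'
    exact Subtype.ext hx'
  · exact fun k l hk hl x hx y hy => h.series.lie_mem k l hk hl x hx y hy

/-- Embeddings of structures are homomorphisms of Lie algebras. -/
def toLieHom (h : LieCompatible c F M H) (h' : LieCompatible c F N H')
    (f : M ↪[lieLang c F] N) : M →ₗ⁅F⁆ N where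
  toFun := f
  map_add' x y := ((congrArg f (h.add x y)).symm.trans
    (map_funMap_two (L := lieLang c F) f LieFunc.add x y)).trans (h'.add _ _)
  map_smul' r x := ((congrArg f (h.smul r x)).symm.trans
    (map_funMap_one (L := lieLang c F) f (LieFunc.smul r) x)).trans (h'.smul _ _)
  map_lie' := fun {x y} => ((congrArg f (h.bracket x y)).symm.trans
    (map_funMap_two (L := lieLang c F) f LieFunc.bracket x y)).trans (h'.bracket _ _)

/-- For k ≤ c this is preservation and reflection of a predicate; for larger k both terms are zero
and injectivity suffices. -/
theorem map_mem_iff (h : LieCompatible c F M H) (h' : LieCompatible c F N H')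
    (f : M ↪[lieLang c F] N) {k : ℕ} (hk : 1 ≤ k) (x : M) : f x ∈ H' k ↔ x ∈ H k := by
  by_cases hkc : k ≤ c
  · obtain ⟨k, rfl⟩ := Nat.exists_eq_add_of_le' hk
    exact (h'.mem_of_pred (by omega) _).symm.trans ((map_relMap_one (L := lieLang c F) f
      (LazardRel.pred ⟨k, by omega⟩) x).trans (h.mem_of_pred (by omega) x))
  · rw [h.series.bot k (by omega), h'.series.bot k (by omega), LieSubalgebra.mem_bot,
      LieSubalgebra.mem_bot]
    have h₀ : f 0 = 0 := (toLieHom h h' f).map_zero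
    exact ⟨fun hx => f.injective (hx.trans h₀.symm), fun hx => by rw [hx, h₀]⟩

/-- Homomorphisms of Lie algebras which respect the series are embeddings of structures. -/
def toEmbedding (h : LieCompatible c F M H) (h' : LieCompatible c F N H') (f : M →ₗ⁅F⁆ N)
    (hf : ∀ k, 1 ≤ k → ∀ x, f x ∈ H' k ↔ x ∈ H k) : M ↪[lieLang c F] N where
  toFun := f
  inj' := by
    refine (injective_iff_map_eq_zero f).2 fun x hx => ?_
    -- Injectivity comes for free: the term with index c + 1 is zero on both sides.
    have := (hf (c + 1) (by omega) x).1 (by rw [hx]; exact zero_mem _)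
    rwa [h.series.bot _ (by omega), LieSubalgebra.mem_bot] at this
  map_fun' := fun {n} g x => by
    have e₂ : ∀ y : Fin 2 → M, y = ![y 0, y 1] := fun y => by
      funext i; fin_cases i <;> rfl
    have e₁ : ∀ y : Fin 1 → M, y = ![y 0] := fun y => by
      funext i; fin_cases i; rfl
    have v₂ : ∀ y z : M, f ∘ ![y, z] = ![f y, f z] := fun y z => by
      funext i; fin_cases i <;> rfl
    have v₁ : ∀ y : M, f ∘ ![y] = ![f y] := fun y => by
      funext i; fin_cases i; rfl
    change f _ = Structure.funMap g (f ∘ x)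
    cases g with
    | add => rw [e₂ x, v₂, h.add, h'.add, map_add]
    | neg => rw [e₁ x, v₁, h.neg, h'.neg, map_neg]
    | zero => rw [Subsingleton.elim x ![], Subsingleton.elim (f ∘ ![]) ![], h.zero, h'.zero, map_zero]
    | bracket => rw [e₂ x, v₂, h.bracket, h'.bracket, LieHom.map_lie]
    | smul r => rw [e₁ x, v₁, h.smul, h'.smul, map_smul]
  map_rel' := fun {n} g x => by
    have e₁ : ∀ y : Fin 1 → M, y = ![y 0] := fun y => by
      funext i; fin_cases i; rfl
    have v₁ : ∀ y : M, f ∘ ![y] = ![f y] := fun y => by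
      funext i; fin_cases i; rfl
    change Structure.RelMap g (f ∘ x) ↔ _
    cases g with
    | pred k => rw [e₁ x, v₁, h.pred, h'.pred, hf _ (by omega)]

theorem closure_eq_top_iff (h : LieCompatible c F M H) (X : Set M) :
    Substructure.closure (lieLang c F) X = ⊤ ↔ LieSubalgebra.lieSpan F M X = ⊤ := by
  constructor
  · intro hX
    have : Substructure.closure (lieLang c F) X ≤ h.ofSubalgebra (LieSubalgebra.lieSpan F M X) :=
      (Substructure.closure_le).2 LieSubalgebra.subset_lieSpan
    rw [eq_top_iff]
    intro x _
    exact this (hX ▸ Substructure.mem_top x)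
  · intro hX
    have : LieSubalgebra.lieSpan F M X ≤ h.toSubalgebra (Substructure.closure (lieLang c F) X) :=
      LieSubalgebra.lieSpan_le.2 Substructure.subset_closure
    rw [eq_top_iff]
    intro x _
    exact this (hX ▸ LieSubalgebra.mem_top x)

/-- Nilpotency makes finitely generated the same as finite-dimensional, which is what gives closure
under arbitrary substructures. -/
theorem fg_iff (h : LieCompatible c F M H) :
    Structure.FG (lieLang c F) M ↔ FiniteDimensional F M := by
  rw [Structure.fg_def]
  constructor
  · rintro ⟨X, hX⟩
    obtain ⟨T, hT, -⟩ := h.series.exists_spanning_finset X ((h.closure_eq_top_iff _).1 hX)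
    exact ⟨T, hT⟩
  · rintro ⟨X, hX⟩
    refine ⟨X, (h.closure_eq_top_iff _).2 ?_⟩
    rw [eq_top_iff]
    intro x _
    exact LieSubalgebra.submodule_span_le_lieSpan (hX ▸ Submodule.mem_top)

end LieCompatible

theorem mem_lazardLieAlgebras_iff {M : Bundled.{u} (lieLang c F).Structure} :
    M ∈ lazardLieAlgebras c F ↔ ∃ (_ : LieRing M) (_ : LieAlgebra F M)
      (H : ℕ → LieSubalgebra F M), LieCompatible c F M H ∧ FiniteDimensional F M := by
  constructor
  · rintro ⟨h₁, h₂⟩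
    obtain ⟨i, j, H, h⟩ := isLazardLieAlgebra_iff.1 h₁
    exact ⟨i, j, H, h, (h.fg_iff).1 h₂⟩
  · rintro ⟨i, j, H, h, hfd⟩
    exact ⟨isLazardLieAlgebra_iff.2 ⟨i, j, H, h⟩, (h.fg_iff).2 hfd⟩

theorem substructure_mem_lazardLieAlgebras {M : Bundled.{u} (lieLang c F).Structure}
    (hM : M ∈ lazardLieAlgebras c F) (S : (lieLang c F).Substructure M) :
    Bundled.of (c := (lieLang c F).Structure) S ∈ lazardLieAlgebras c F := by
  obtain ⟨i, j, H, h, hfd⟩ := (mem_lazardLieAlgebras_iff).1 hM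
  refine ⟨isLazardLieAlgebra_iff.2 (h.exists_substructure S), ?_⟩
  change Structure.FG (lieLang c F) S
  rw [← Substructure.fg_iff_structure_fg]
  obtain ⟨X, hX⟩ : (h.toSubalgebra S).toSubmodule.FG := IsNoetherian.noetherian _
  refine ⟨X, le_antisymm ?_ ?_⟩
  · rw [Substructure.closure_le]
    intro x hx
    have : x ∈ (h.toSubalgebra S).toSubmodule := hX ▸ Submodule.subset_span hx
    exact this
  · intro x hx
    have hle : Submodule.span F (X : Set M) ≤
        (h.toSubalgebra (Substructure.closure (lieLang c F) (X : Set M))).toSubmodule :=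
      Submodule.span_le.2 Substructure.subset_closure
    have hx' : x ∈ (h.toSubalgebra S).toSubmodule := hx
    rw [← hX] at hx'
    exact hle hx'

end LieLanguage

/-! ### Classes whose embeddings decompose into steps -/

section SteppedClasses

variable {L : FirstOrder.Language.{u, v}} {K : Set (Bundled.{w} L.Structure)}
  {S : ∀ ⦃A B : Bundled.{w} L.Structure⦄, (A ↪[L] B) → ℕ → Prop}

/-- Enlarge the image step by step inside `S₂`; the ascending chain condition stops the process. The
invariant `P` is carried along so that each step can be chosen with a weight satisfying `Q`. -/
theorem exists_stepTower_codRestrict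
    (hS : ∀ (A' A B : Bundled.{w} L.Structure) (e : A' ↪[L] A) (f : A ↪[L] B) (i : ℕ),
      Function.Surjective e → S f i → S (f.comp e) i)
    {D : Bundled.{w} L.Structure} [hwf : WellFoundedGT (L.Substructure D)]
    (hK : ∀ T : L.Substructure D, Bundled.of (c := L.Structure) T ∈ K) (S₂ : L.Substructure D)
    (P : L.Substructure D → Prop) (Q : ℕ → Prop)
    (hstep : ∀ S₁ : L.Substructure D, P S₁ → S₁ < S₂ → ∃ (T : L.Substructure D) (h : S₁ ≤ T),
      S₁ < T ∧ T ≤ S₂ ∧ P T ∧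
        ∃ i, Q i ∧ S (A := Bundled.of S₁) (B := Bundled.of T) (Substructure.inclusion h) i)
    {A : Bundled.{w} L.Structure} (f : A ↪[L] D) (hf : ∀ x, f x ∈ S₂) (hP : P f.toHom.range) :
    ∃ w, StepTower K S (B := Bundled.of S₂) (f.codRestrict S₂ hf) w ∧ ∀ i ∈ w, Q i := by
  have key : ∀ S₁ : L.Substructure D, P S₁ → ∀ h : S₁ ≤ S₂, ∃ w,
      StepTower K S (A := Bundled.of S₁) (B := Bundled.of S₂) (Substructure.inclusion h) w ∧
        ∀ i ∈ w, Q i := by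
    intro S₁
    induction S₁ using hwf.induction with
    | _ S₁ ih =>
    intro hP h
    rcases h.eq_or_lt with rfl | hlt
    · exact ⟨0, .nil _ fun x => ⟨x, rfl⟩, by simp⟩
    · obtain ⟨T, hT, hlt', hTS, hPT, i, hi, hSi⟩ := hstep S₁ hP hlt
      obtain ⟨w, hw, hQ⟩ := ih T hlt' hPT hTS
      refine ⟨i ::ₘ w, .cons (A := Bundled.of S₁) (B := Bundled.of T) (C := Bundled.of S₂)
        (Substructure.inclusion hT) (Substructure.inclusion hTS) i w (hK T) hSi hw, ?_⟩
      intro j hj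
      rcases Multiset.mem_cons.1 hj with rfl | hj
      exacts [hi, hQ j hj]
  have hle : f.toHom.range ≤ S₂ := by
    rintro _ ⟨x, rfl⟩
    exact hf x
  obtain ⟨w, hw, hQ⟩ := key _ hP hle
  exact ⟨w, hw.precomp (A' := A) (A := Bundled.of f.toHom.range) hS f.equivRange.toEmbedding
    f.equivRange.surjective, hQ⟩

theorem stepTower_of_codRestrict
    (hS : ∀ (A' A B : Bundled.{w} L.Structure) (e : A' ↪[L] A) (f : A ↪[L] B) (i : ℕ),
      Function.Surjective e → S f i → S (f.comp e) i)
    {A D : Bundled.{w} L.Structure} {f : A ↪[L] D} {R : L.Substructure D} (hf : ∀ x, f x ∈ R)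
    {v w : Multiset ℕ} (h₁ : StepTower K S (B := Bundled.of R) (f.codRestrict R hf) v)
    (h₂ : StepTower K S (A := Bundled.of R) R.subtype w) : StepTower K S f (v + w) :=
  h₁.comp hS h₂

theorem isAmalgamationClass_of_steps (N : ℕ)
    (hS : ∀ (A' A B : Bundled.{w} L.Structure) (e : A' ↪[L] A) (f : A ↪[L] B) (i : ℕ),
      Function.Surjective e → S f i → S (f.comp e) i)
    (hN : ∀ (A B : Bundled.{w} L.Structure) (f : A ↪[L] B) (i : ℕ), S f i → 1 ≤ i ∧ i ≤ N)
    (base : ∀ (C A B : Bundled.{w} L.Structure) (f : C ↪[L] A) (g : C ↪[L] B) (i j : ℕ),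
      C ∈ K → A ∈ K → B ∈ K → S f i → S g j → HasSteppedAmalgam K S f g {i} {j})
    (tower : ∀ (A B : Bundled.{w} L.Structure) (f : A ↪[L] B), B ∈ K → ∃ w, StepTower K S f w)
    (fg : ∀ M ∈ K, Structure.FG L M)
    (iso_closed : ∀ M N : Bundled.{w} L.Structure, Nonempty (M ≃[L] N) → M ∈ K → N ∈ K)
    (hereditary : ∀ M ∈ K, ∀ S : L.Substructure M, Bundled.of (c := L.Structure) S ∈ K)
    (Z : Bundled.{w} L.Structure) (hZ : Z ∈ K) (initial : ∀ M ∈ K, Nonempty (Z ↪[L] M)) :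
    IsAmalgamationClass K := by
  have amalg : Amalgamation K := by
    intro C A B f g hC hA hB
    obtain ⟨v, hv⟩ := tower C A f hA
    obtain ⟨w, hw⟩ := tower C B g hB
    obtain ⟨D, f', g', -, -, hD, h, -⟩ :=
      hasSteppedAmalgam_of_steps N hS hN base f g hC hA hB hv hw
    exact ⟨D, f', g', hD, h⟩
  refine ⟨⟨Z, hZ⟩, fg, iso_closed, hereditary, ?_, amalg⟩
  intro A hA B hB
  obtain ⟨f⟩ := initial A hA
  obtain ⟨g⟩ := initial B hB
  obtain ⟨D, f', g', hD, -⟩ := amalg Z A B f g hZ hA hB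
  exact ⟨D, hD, ⟨f'⟩, ⟨g'⟩⟩

theorem countable_isoTypes {ι : Type*} [Countable ι] (Φ : ι → Bundled.{w} L.Structure)
    (h : ∀ M ∈ K, ∃ x, Nonempty (M ≃[L] Φ x)) : (Quotient.mk' '' K).Countable := by
  refine (Set.countable_range fun x => (Quotient.mk' (Φ x) : Quotient _)).mono ?_
  rintro _ ⟨M, hM, rfl⟩
  obtain ⟨x, hx⟩ := h M hM
  exact ⟨x, (Quotient.sound hx).symm⟩

theorem IsFraisseClass.isFraisse (h : IsFraisseClass K) : IsFraisse K where
  is_nonempty := h.nonempty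
  FG := h.fg
  is_essentially_countable := h.countable
  hereditary := by
    rintro M hM N ⟨-, ⟨f⟩⟩
    exact h.iso_closed (Bundled.of f.toHom.range) N ⟨f.equivRange.symm⟩ (h.hereditary M hM _)
  jointEmbedding := h.jointEmbedding
  amalgamation := h.amalgamation

theorem infinite_of_age_eq {M : Type w} [L.Structure M] (hM : L.age M = K)
    (h : ∀ n : ℕ, ∃ A ∈ K, n ≤ (Set.univ : Set A).encard) : Infinite M := by
  by_contra hfin
  rw [not_infinite_iff_finite] at hfin
  obtain ⟨A, hA, hn⟩ := h (Nat.card M + 1)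
  rw [← hM] at hA
  obtain ⟨-, ⟨f⟩⟩ := hA
  have h₁ : (Set.univ : Set A).encard ≤ (Set.univ : Set M).encard := by
    rw [← Function.Injective.encard_image f.injective]
    exact Set.encard_le_encard (Set.subset_univ _)
  rw [Set.encard_univ M, ENat.card_eq_coe_natCard] at h₁
  have := hn.trans h₁
  norm_cast at this
  omega

/-- A substructure generated by an n-tuple belongs to the class, so a bound for n-generated members
is a bound inside `M`. -/
theorem uniformlyLocallyFinite_of_age_eq {M : Type w} [L.Structure M] (hM : L.age M = K)
    (b : ℕ → ℕ) (h : ∀ A ∈ K, ∀ (n : ℕ) (a : Fin n → A),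
      Substructure.closure L (Set.range a) = ⊤ → (Set.univ : Set A).encard ≤ b n) :
    UniformlyLocallyFinite L M := by
  refine ⟨b, fun n a => ?_⟩
  let T := Substructure.closure L (Set.range a)
  have hT : Bundled.of (c := L.Structure) T ∈ K := by
    rw [← hM]
    exact age.fg_substructure (Substructure.fg_closure (Set.finite_range a))
  let a' : Fin n → T := fun i => ⟨a i, Substructure.subset_closure (Set.mem_range_self i)⟩
  have htop : Substructure.closure L (Set.range a') = ⊤ := by
    rw [eq_top_iff]
    rintro ⟨x, hx⟩ -
    have hle : T ≤ (Substructure.closure L (Set.range a')).map T.subtype.toHom := by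
      refine Substructure.closure_le.2 ?_
      rintro _ ⟨i, rfl⟩
      exact ⟨a' i, Substructure.subset_closure (Set.mem_range_self i), rfl⟩
    obtain ⟨y, hy, hyx⟩ := hle hx
    have : y = ⟨x, hx⟩ := Subtype.ext hyx
    exact this ▸ hy
  have := h _ hT n a' htop
  rw [Set.encard_univ] at this
  exact this

end SteppedClasses

/-! ### Decomposition of embeddings of Lazard Lie algebras into steps -/

section LieClass

variable {c : ℕ} {F : Type u} [Field F]

theorem iso_closed_lazardLieAlgebras (M N : Bundled.{u} (lieLang c F).Structure)
    (e : Nonempty (M ≃[lieLang c F] N)) (hM : M ∈ lazardLieAlgebras c F) :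
    N ∈ lazardLieAlgebras c F := by
  obtain ⟨e⟩ := e
  obtain ⟨hM, hfg⟩ := hM
  refine ⟨?_, e.fg_iff.1 hfg⟩
  obtain ⟨i, j, H, h⟩ := isLazardLieAlgebra_iff.1 hM
  let q : N ↪[lieLang c F] M := e.symm.toEmbedding
  let i' : LieRing N := e.symm.toEquiv.lieRing
  let j' : LieAlgebra F N := e.symm.toEquiv.lieAlgebra F
  let φ : N →ₗ⁅F⁆ M := (e.symm.toEquiv.lieEquiv F).toLieHom
  have hφ : ∀ x, φ x = q x := fun x => rfl
  have inj : Function.Injective φ := q.injective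
  refine isLazardLieAlgebra_iff.2 ⟨i', j', fun k => (H k).comap φ, fun x y => inj ?_,
    fun x => inj ?_, inj ?_, fun x y => inj ?_, fun r x => inj ?_, fun k x => ?_, ?_, ?_, ?_, ?_⟩
  · exact ((map_funMap_two (L := lieLang c F) q LieFunc.add x y).trans (h.add _ _)).trans
      (map_add φ x y).symm
  · exact ((map_funMap_one (L := lieLang c F) q LieFunc.neg x).trans (h.neg _)).trans
      (map_neg φ x).symm
  · exact ((map_funMap_zero (L := lieLang c F) q LieFunc.zero).trans h.zero).trans
      (map_zero φ).symm
  · exact ((map_funMap_two (L := lieLang c F) q LieFunc.bracket x y).trans (h.bracket _ _)).trans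
      (φ.map_lie x y).symm
  · exact ((map_funMap_one (L := lieLang c F) q (LieFunc.smul r) x).trans (h.smul _ _)).trans
      (map_smul φ r x).symm
  · exact (map_relMap_one (L := lieLang c F) q (LazardRel.pred k) x).symm.trans (h.pred _ _)
  · rw [eq_top_iff]
    intro x _
    exact h.series.mem_one (φ x)
  · exact fun k hk x hx => h.series.anti k hk hx
  · intro k hk
    rw [eq_bot_iff]
    intro x hx
    have hx' : φ x ∈ H k := hx
    rw [h.series.bot k hk] at hx'
    exact inj (((LieSubalgebra.mem_bot _).1 hx').trans (map_zero φ).symm)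
  · intro k l hk hl x hx y hy
    change φ ⁅x, y⁆ ∈ H (k + l)
    rw [φ.map_lie]
    exact h.series.lie_mem k l hk hl _ hx _ hy

/-- `B` is generated over the image of `f`, an ideal of codimension one, by an element of weight
`i`, and all elements of weight greater than `i` belong to this ideal. -/
def IsLieStepEmbedding {A B : Type*} [(lieLang c F).Structure A] [(lieLang c F).Structure B]
    (f : A ↪[lieLang c F] B) (i : ℕ) : Prop :=
  1 ≤ i ∧ i ≤ c ∧ ∃ (_ : LieRing B) (_ : LieAlgebra F B) (H : ℕ → LieSubalgebra F B),
    LieCompatible c F B H ∧ ∃ a ∈ H i, (∀ y, f y ≠ a) ∧ (∀ x, ∃ y, ∃ r : F, x = f y + r • a) ∧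
      (∀ y, ∃ z, ⁅a, f y⁆ = f z) ∧ ∀ x ∈ H (i + 1), ∃ y, f y = x

variable (c F) in
/-- The step relation on the embeddings of bundled structures. -/
def LieStep ⦃A B : Bundled.{u} (lieLang c F).Structure⦄ (f : A ↪[lieLang c F] B) (i : ℕ) : Prop :=
  IsLieStepEmbedding f i

theorem LieStep.comp (A' A B : Bundled.{u} (lieLang c F).Structure) (e : A' ↪[lieLang c F] A)
    (f : A ↪[lieLang c F] B) (i : ℕ) (he : Function.Surjective e) (h : LieStep c F f i) :
    LieStep c F (f.comp e) i := by
  obtain ⟨h₁, h₂, i', j', H, hH, a, ha, h₃, h₄, h₅, h₆⟩ := h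
  refine ⟨h₁, h₂, i', j', H, hH, a, ha, fun y => h₃ (e y), fun x => ?_, fun y => ?_,
    fun x hx => ?_⟩
  · obtain ⟨y, r, hy⟩ := h₄ x
    obtain ⟨y, rfl⟩ := he y
    exact ⟨y, r, hy⟩
  · obtain ⟨z, hz⟩ := h₅ (e y)
    obtain ⟨z, rfl⟩ := he z
    exact ⟨z, hz⟩
  · obtain ⟨y, hy⟩ := h₆ x hx
    obtain ⟨y, rfl⟩ := he y
    exact ⟨y, hy⟩

theorem LieCompatible.wellFoundedGT {M : Type*} [(lieLang c F).Structure M] [LieRing M]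
    [LieAlgebra F M] {H : ℕ → LieSubalgebra F M} (h : LieCompatible c F M H)
    [FiniteDimensional F M] : WellFoundedGT ((lieLang c F).Substructure M) := by
  refine StrictMono.wellFoundedGT (f := fun S => (h.toSubalgebra S).toSubmodule) ?_
  intro S T hST
  refine lt_of_le_not_ge (fun x hx => hST.le hx) fun hle => hST.not_ge fun x hx => hle hx

/-- Adjoin to `S₁` an element of `S₂` outside `S₁` of the greatest possible weight i. If `S₂` is
contained in `S₁` + H m, some missing element has weight m, so i ≥ m; this is the lower bound on the
extra weights of an amalgam. -/
theorem exists_lieStep_lt {M : Type u} [(lieLang c F).Structure M] [LieRing M]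
    [LieAlgebra F M] {H : ℕ → LieSubalgebra F M} (h : LieCompatible c F M H)
    {S₁ S₂ : (lieLang c F).Substructure M} (hlt : S₁ < S₂) {m : ℕ} (hm : 1 ≤ m)
    (hP : ∀ d ∈ S₂, ∃ s ∈ S₁, ∃ z ∈ H m, d = s + z) :
    ∃ (T : (lieLang c F).Substructure M) (hT : S₁ ≤ T), S₁ < T ∧ T ≤ S₂ ∧
      ∃ i, m ≤ i ∧ IsLieStepEmbedding (Substructure.inclusion hT) i := by
  classical
  let P : ℕ → Prop := fun k => ∃ a ∈ H k, a ∈ S₂ ∧ a ∉ S₁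
  have hPm : P m := by
    obtain ⟨d, hd, hd'⟩ := Set.exists_of_ssubset (SetLike.coe_ssubset_coe.2 hlt)
    obtain ⟨s, hs, z, hz, rfl⟩ := hP d hd
    have hz₂ : (s + z) - s ∈ h.toSubalgebra S₂ :=
      sub_mem (h.mem_toSubalgebra.2 hd) (h.mem_toSubalgebra.2 (hlt.le hs))
    rw [add_sub_cancel_left] at hz₂
    exact ⟨z, hz, hz₂, fun hzs => hd' (add_mem (S := LieSubalgebra F M)
      (h.mem_toSubalgebra.2 hs) (h.mem_toSubalgebra.2 hzs))⟩
  have hPc : ∀ k, P k → k ≤ c := by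
    rintro k ⟨a, ha, -, ha'⟩
    by_contra hk
    rw [h.series.bot k (by omega), LieSubalgebra.mem_bot] at ha
    rw [ha] at ha'
    exact ha' (zero_mem (h.toSubalgebra S₁))
  set i := Nat.findGreatest P c with hi
  have hPi : P i := Nat.findGreatest_spec (hPc m hPm) hPm
  have hmi : m ≤ i := Nat.le_findGreatest (hPc m hPm) hPm
  have hnext : ∀ x ∈ H (i + 1), x ∈ S₂ → x ∈ S₁ := by
    intro x hx hx₂
    by_contra hx₁
    have hP' : P (i + 1) := ⟨x, hx, hx₂, hx₁⟩
    have := Nat.le_findGreatest (hPc _ hP') hP'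
    omega
  have hic := hPc i hPi
  obtain ⟨a, ha, ha₂, ha₁⟩ := hPi
  let R := h.toSubalgebra S₁
  let R₂ := h.toSubalgebra S₂
  have hle : ∀ x ∈ R, x ∈ R₂ := fun x hx => hlt.le hx
  -- The bracket has weight at least i + 1 and lies in `S₂`, so it belongs to `S₁` by maximality of
  -- i.
  have hideal : ∀ s ∈ R, ⁅a, s⁆ ∈ R := by
    intro s hs
    refine hnext _ ?_ (R₂.lie_mem ha₂ (hle s hs))
    rw [← lie_skew]
    exact neg_mem (h.series.lie_mem_series (by omega) s ha)
  let T : LieSubalgebra F M :=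
    { R.toSubmodule ⊔ Submodule.span F {a} with
      lie_mem' := fun {x y} hx hy => by
        simp only [AddSubsemigroup.mem_carrier, AddSubmonoid.mem_toSubsemigroup,
          Submodule.mem_toAddSubmonoid, Submodule.mem_sup, Submodule.mem_span_singleton,
          LieSubalgebra.mem_toSubmodule] at hx hy ⊢
        obtain ⟨s, hs, _, ⟨r, rfl⟩, rfl⟩ := hx
        obtain ⟨s', hs', _, ⟨r', rfl⟩, rfl⟩ := hy
        refine ⟨⁅s, s'⁆ + r • ⁅a, s'⁆ - r' • ⁅a, s⁆, ?_, 0, ⟨0, zero_smul _ _⟩, ?_⟩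
        · exact sub_mem (add_mem (R.lie_mem hs hs') (R.smul_mem r (hideal _ hs')))
            (R.smul_mem r' (hideal _ hs))
        · rw [add_lie, lie_add, lie_add, smul_lie, smul_lie, lie_smul, lie_smul, lie_self,
            smul_zero, smul_zero, ← lie_skew a s, smul_neg]
          abel }
  have memT : ∀ x, x ∈ T ↔ ∃ s ∈ R, ∃ r : F, s + r • a = x := by
    intro x
    change x ∈ R.toSubmodule ⊔ Submodule.span F {a} ↔ _
    simp only [Submodule.mem_sup, Submodule.mem_span_singleton, LieSubalgebra.mem_toSubmodule]
    constructor
    · rintro ⟨s, hs, _, ⟨r, rfl⟩, rfl⟩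
      exact ⟨s, hs, r, rfl⟩
    · rintro ⟨s, hs, r, rfl⟩
      exact ⟨s, hs, _, ⟨r, rfl⟩, rfl⟩
  have haT : a ∈ T := (memT a).2 ⟨0, zero_mem _, 1, by rw [one_smul, zero_add]⟩
  have hle' : S₁ ≤ h.ofSubalgebra T := fun x hx =>
    (memT x).2 ⟨x, hx, 0, by rw [zero_smul, add_zero]⟩
  have hTS : h.ofSubalgebra T ≤ S₂ := by
    intro x hx
    obtain ⟨s, hs, r, rfl⟩ := (memT x).1 hx
    exact add_mem (S := LieSubalgebra F M) (hle s hs) (R₂.smul_mem r ha₂)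
  refine ⟨h.ofSubalgebra T, hle', lt_of_le_not_ge hle' fun hge => ha₁ (hge haT), hTS, i, hmi, ?_⟩
  obtain ⟨i₁, i₂, HT, hT⟩ := h.exists_substructure (h.ofSubalgebra T)
  let ι := hT.toLieHom h (h.ofSubalgebra T).subtype
  have hι : ∀ x, ι x = (x : M) := fun x => rfl
  have inj : Function.Injective ι := Subtype.coe_injective
  have hmem := fun (k : ℕ) (hk : 1 ≤ k) => hT.map_mem_iff h (h.ofSubalgebra T).subtype hk
  refine ⟨by omega, hic, i₁, i₂, HT, hT, ⟨a, haT⟩, ?_, ?_, ?_, ?_, ?_⟩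
  · exact (hmem _ (by omega) _).1 ha
  · intro y hy
    exact ha₁ (by rw [← show (y : M) = a from congrArg Subtype.val hy]; exact y.2)
  · rintro ⟨x, hx⟩
    obtain ⟨s, hs, r, rfl⟩ := (memT x).1 hx
    refine ⟨⟨s, hs⟩, r, inj ?_⟩
    rw [map_add, map_smul]
    rfl
  · rintro ⟨y, hy⟩
    refine ⟨⟨⁅a, y⁆, hideal y hy⟩, inj ?_⟩
    rw [ι.map_lie]
    rfl
  · intro x hx
    exact ⟨⟨x, hnext x ((hmem _ (by omega) x).2 hx) (hTS x.2)⟩, rfl⟩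

theorem exists_lieTower {A D : Type u} [(lieLang c F).Structure A] [(lieLang c F).Structure D]
    (hD : Bundled.of (c := (lieLang c F).Structure) D ∈ lazardLieAlgebras c F) [LieRing D] [LieAlgebra F D] {H : ℕ → LieSubalgebra F D}
    (h : LieCompatible c F D H) (f : A ↪[lieLang c F] D) (S : (lieLang c F).Substructure D)
    (hf : ∀ x, f x ∈ S) {m : ℕ} (hm : 1 ≤ m)
    (hP : ∀ d ∈ S, ∃ y, ∃ z ∈ H m, d = f y + z) :
    ∃ w, StepTower (lazardLieAlgebras c F) (LieStep c F) (A := Bundled.of A)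
      (B := Bundled.of S) (f.codRestrict S hf) w ∧ ∀ i ∈ w, m ≤ i := by
  have := h.fg_iff.1 hD.2
  let P : (lieLang c F).Substructure D → Prop := fun S₁ =>
    ∀ d ∈ S, ∃ s ∈ S₁, ∃ z ∈ H m, d = s + z
  refine exists_stepTower_codRestrict (A := Bundled.of A) (D := Bundled.of D)
    (hwf := h.wellFoundedGT) LieStep.comp (substructure_mem_lazardLieAlgebras hD) S P
    (fun i => m ≤ i) ?_ f hf ?_
  · intro S₁ hS₁ hlt
    obtain ⟨T, hT, hlt', hTS, i, hi, hs⟩ := exists_lieStep_lt h hlt hm hS₁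
    refine ⟨T, hT, hlt', hTS, fun d hd => ?_, i, hi, hs⟩
    obtain ⟨s, hs, hz⟩ := hS₁ d hd
    exact ⟨s, hT hs, hz⟩
  · intro d hd
    obtain ⟨y, hz⟩ := hP d hd
    exact ⟨f y, ⟨y, rfl⟩, hz⟩

/-- The case m = 1, where the congruence modulo `H m` is void. -/
theorem exists_lieTower_of_mem {A D : Bundled.{u} (lieLang c F).Structure}
    (f : A ↪[lieLang c F] D) (hD : D ∈ lazardLieAlgebras c F) :
    ∃ w, StepTower (lazardLieAlgebras c F) (LieStep c F) f w := by
  obtain ⟨i, j, H, h, -⟩ := mem_lazardLieAlgebras_iff.1 hD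
  obtain ⟨w, hw, -⟩ := exists_lieTower hD h f ⊤ (fun x => Substructure.mem_top _) le_rfl
    (fun d _ => ⟨Structure.funMap (L := lieLang c F) LieFunc.zero ![], d,
      h.series.mem_one d, by
        have : f (Structure.funMap (L := lieLang c F) LieFunc.zero ![]) = 0 :=
          (map_funMap_zero (L := lieLang c F) f LieFunc.zero).trans h.zero
        exact ((congrArg (· + d) this).trans (zero_add d)).symm⟩)
  exact ⟨w + 0, stepTower_of_codRestrict LieStep.comp _ hw (.nil _ fun x => ⟨⟨x, trivial⟩, rfl⟩)⟩

/-- The lower part, from A to R = f(A) + H m, consists of steps of weight at least m; the step of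
weight j from R to D is put on top. -/
theorem FactorsThroughStep.exists_stepTower {A D : Type u} [(lieLang c F).Structure A]
    [(lieLang c F).Structure D]
    (hD : Bundled.of (c := (lieLang c F).Structure) D ∈ lazardLieAlgebras c F) [LieRing A] [LieAlgebra F A] [LieRing D] [LieAlgebra F D]
    {H : ℕ → LieSubalgebra F D}
    (h : LieCompatible c F D H) (f : A ↪[lieLang c F] D) {f' : A →ₗ⁅F⁆ D} (hff' : ∀ x, f' x = f x)
    {t : D} {j m : ℕ} (hj : 1 ≤ j) (hjc : j ≤ c) (hm : 1 ≤ m)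
    (hft : FactorsThroughStep H f' t j m) :
    ∃ w, StepTower (lazardLieAlgebras c F) (LieStep c F) (A := Bundled.of A) (B := Bundled.of D) f
      ({j} + w) ∧ ∀ i ∈ w, m ≤ i := by
  obtain ⟨R, hR, hRm, ht, htR, hspan, hideal, hnext⟩ := hft
  have hfR : ∀ x, f x ∈ h.ofSubalgebra R := fun x => hff' x ▸ hR x
  obtain ⟨w, hw, hwm⟩ := exists_lieTower hD h f (h.ofSubalgebra R) hfR hm fun d hd => by
    obtain ⟨y, z, hz, rfl⟩ := hRm d hd
    exact ⟨y, z, hz, by rw [hff']⟩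
  refine ⟨w, ?_, hwm⟩
  rw [add_comm]
  suffices hs : IsLieStepEmbedding (h.ofSubalgebra R).subtype j from
    stepTower_of_codRestrict LieStep.comp hfR hw (StepTower.single hD hs)
  refine ⟨hj, hjc, _, _, H, h, t, ht, fun y hy => htR ?_, fun x => ?_, fun y => ?_, fun x hx => ?_⟩
  · rw [← hy]
    exact y.2
  · obtain ⟨r, hr, s, hs⟩ := hspan x
    exact ⟨⟨r, hr⟩, s, hs⟩
  · exact ⟨⟨⁅t, (y : D)⁆, hideal _ y.2⟩, rfl⟩
  · exact ⟨⟨x, hnext hx⟩, rfl⟩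

/-- Returns from algebra to structures. The amalgam is finite-dimensional because Der(C) is, `C`
being finite-dimensional. -/
theorem hasSteppedAmalgam_lieStep (C A B : Bundled.{u} (lieLang c F).Structure)
    (f : C ↪[lieLang c F] A) (g : C ↪[lieLang c F] B) (i j : ℕ)
    (hC : C ∈ lazardLieAlgebras c F) (hf : LieStep c F f i) (hg : LieStep c F g j) :
    HasSteppedAmalgam (lazardLieAlgebras c F) (LieStep c F) f g {i} {j} := by
  obtain ⟨_, _, HC, hHC, hfd⟩ := mem_lazardLieAlgebras_iff.1 hC
  obtain ⟨hi, hic, _, _, HA, hHA, a, ha, fa, sa, ia, na⟩ := hf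
  obtain ⟨hj, hjc, _, _, HB, hHB, b, hb, fb, sb, ib, nb⟩ := hg
  have stepf : IsLieStep HC HA (hHC.toLieHom hHA f) i a :=
    ⟨f.injective, fun k hk x => hHC.map_mem_iff hHA f hk x, hi, ha,
      fun ⟨y, hy⟩ => fa y hy, sa, ia, na⟩
  have stepg : IsLieStep HC HB (hHC.toLieHom hHB g) j b :=
    ⟨g.injective, fun k hk x => hHC.map_mem_iff hHB g hk x, hj, hb,
      fun ⟨y, hy⟩ => fb y hy, sb, ib, nb⟩
  obtain ⟨D, HD, f', g', hHD, hf', hg', hcomp, hA, hB⟩ :=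
    stepf.exists_amalgam hHC.series hHA.series hHB.series stepg hic hjc
  let str := lieStructure c F HD
  have hcD : LieCompatible c F D HD := lieCompatible_lieStructure hHD
  have hDK : Bundled.of (c := (lieLang c F).Structure) D ∈ lazardLieAlgebras c F :=
    mem_lazardLieAlgebras_iff.2
      ⟨_, _, HD, hcD, inferInstanceAs (FiniteDimensional F D.toSubmodule)⟩
  let f'' : A ↪[lieLang c F] D := hHA.toEmbedding hcD f' hf'
  let g'' : B ↪[lieLang c F] D := hHB.toEmbedding hcD g' hg'
  obtain ⟨v, hv, hvm⟩ := FactorsThroughStep.exists_stepTower hDK hcD f'' (fun x => rfl) hj hjc (by omega) hA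
  obtain ⟨w, hw, hwm⟩ := FactorsThroughStep.exists_stepTower hDK hcD g'' (fun x => rfl) hi hic (by omega) hB
  refine ⟨Bundled.of D, f'', g'', v, w, hDK, ?_, hv, hw, ?_, ?_⟩
  · ext y
    exact hcomp y
  · exact fun x hx => ⟨i, Multiset.mem_singleton_self i, j, Multiset.mem_singleton_self j, hvm x hx⟩
  · exact fun x hx => ⟨i, Multiset.mem_singleton_self i, j, Multiset.mem_singleton_self j, by
      have := hwm x hx
      omega⟩

end LieClass

/-! ### The Fraïssé class of Lazard Lie algebras -/

section LieClass

variable {c : ℕ} {F : Type u} [Field F]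

theorem exists_abelian_mem (hc : 1 ≤ c) (n : ℕ) :
    ∃ (i : (lieLang c F).Structure (Fin n → F)) (_ : LieRing (Fin n → F))
      (_ : LieAlgebra F (Fin n → F)) (H : ℕ → LieSubalgebra F (Fin n → F)),
      LieCompatible c F (Fin n → F) H ∧
      (⟨Fin n → F, i⟩ : Bundled (lieLang c F).Structure) ∈ lazardLieAlgebras c F := by
  classical
  let i₁ : LieRing (Fin n → F) := LieRing.ofAssociativeRing
  let i₂ : LieAlgebra F (Fin n → F) := LieAlgebra.ofAssociativeAlgebra
  have hab : ∀ x y : Fin n → F, ⁅x, y⁆ = 0 := fun x y => by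
    rw [LieRing.of_associative_ring_bracket, mul_comm, sub_self]
  let H : ℕ → LieSubalgebra F (Fin n → F) := fun k => if k ≤ 1 then ⊤ else ⊥
  have hH : IsLieLazardSeries c H := by
    refine ⟨if_pos le_rfl, fun i hi => ?_, fun k hk => if_neg (by omega), fun i j _ _ x _ y _ => ?_⟩
    · rw [show H (i + 1) = ⊥ from if_neg (by omega)]
      exact bot_le
    · rw [hab]
      exact zero_mem _
  let str := lieStructure c F H
  have h : LieCompatible c F (Fin n → F) H := lieCompatible_lieStructure hH
  exact ⟨str, i₁, i₂, H, h, mem_lazardLieAlgebras_iff.2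
    ⟨i₁, i₂, H, h, inferInstanceAs (FiniteDimensional F (Fin n → F))⟩⟩

theorem isAmalgamationClass_lazardLieAlgebras (hc : 1 ≤ c) :
    IsAmalgamationClass (lazardLieAlgebras c F) := by
  obtain ⟨i, _, _, H, h, hZ⟩ := exists_abelian_mem (c := c) (F := F) hc 0
  refine isAmalgamationClass_of_steps c LieStep.comp (fun A B f i h => ⟨h.1, h.2.1⟩)
    (fun C A B f g i j hC _ _ hf hg => hasSteppedAmalgam_lieStep C A B f g i j hC hf hg)
    (fun A B f hB => exists_lieTower_of_mem f hB) (fun M hM => hM.2)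
    iso_closed_lazardLieAlgebras (fun M hM S => substructure_mem_lazardLieAlgebras hM S) _ hZ ?_
  intro M hM
  obtain ⟨_, _, H', h', -⟩ := mem_lazardLieAlgebras_iff.1 hM
  refine ⟨h.toEmbedding h' (0 : (Fin 0 → F) →ₗ⁅F⁆ M) fun k hk x => ?_⟩
  refine iff_of_true (zero_mem (H' k)) ?_
  have h₀ := (H k).zero_mem
  rwa [Subsingleton.elim x _]

/-- The structure on `F ^ n` with structure constants `B` and predicates `P`. -/
@[reducible]
def coordinateStructure {n : ℕ} (B : Fin n → Fin n → Fin n → F)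
    (P : Fin (c + 1) → Submodule F (Fin n → F)) : (lieLang c F).Structure (Fin n → F) where
  funMap := fun {_} f => match f with
    | LieFunc.add => fun x => x 0 + x 1
    | LieFunc.neg => fun x => -x 0
    | LieFunc.zero => fun _ => 0
    | LieFunc.bracket => fun x => ∑ i, ∑ j, (x 0 i * x 1 j) • B i j
    | LieFunc.smul r => fun x => r • x 0
  RelMap := fun {_} r => match r with
    | LazardRel.pred i => fun x => x 0 ∈ P i

/-- A basis encodes the structure by its structure constants and c + 1 subspaces of F ^ n; over a
countable field there are countably many such data. -/
theorem LieCompatible.exists_equiv_coordinate {M : Type w} [(lieLang c F).Structure M] [LieRing M]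
    [LieAlgebra F M] {H : ℕ → LieSubalgebra F M} (h : LieCompatible c F M H)
    [FiniteDimensional F M] : ∃ (n : ℕ) (e : M ≃ₗ[F] (Fin n → F)),
      letI := coordinateStructure (c := c)
        (fun i j => e ⁅e.symm (Pi.single i 1), e.symm (Pi.single j 1)⁆)
        (fun k => (H (k + 1)).toSubmodule.map (e : M →ₗ[F] (Fin n → F)))
      Nonempty (M ≃[lieLang c F] (Fin n → F)) := by
  let b := Module.finBasis F M
  let e := b.equivFun
  refine ⟨Module.finrank F M, e, ?_⟩
  have hb : ∀ i, e.symm (Pi.single i 1) = b i := fun i => by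
    rw [LinearEquiv.symm_apply_eq]
    funext j
    rw [b.equivFun_self i j, Pi.single_apply]
    simp only [eq_comm]
  have hlie : ∀ x y, e ⁅x, y⁆ = ∑ i, ∑ j, (e x i * e y j) • e ⁅b i, b j⁆ := by
    intro x y
    conv_lhs => rw [← b.sum_equivFun x, ← b.sum_equivFun y]
    rw [sum_lie, map_sum]
    refine Finset.sum_congr rfl fun i _ => ?_
    rw [lie_sum, map_sum]
    refine Finset.sum_congr rfl fun j _ => ?_
    rw [smul_lie, lie_smul, map_smul, map_smul, smul_smul]
  let str := coordinateStructure (c := c)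
    (fun i j => e ⁅e.symm (Pi.single i 1), e.symm (Pi.single j 1)⁆)
    (fun k => (H (k + 1)).toSubmodule.map (e : M →ₗ[F] (Fin _ → F)))
  refine ⟨{ e.toEquiv with
    map_fun' := fun {n} g x => ?_
    map_rel' := fun {n} g x => ?_ }⟩
  · have e₂ : ∀ y : Fin 2 → M, y = ![y 0, y 1] := fun y => by
      funext i; fin_cases i <;> rfl
    have e₁ : ∀ y : Fin 1 → M, y = ![y 0] := fun y => by
      funext i; fin_cases i; rfl
    change e (Structure.funMap g x) = Structure.funMap g (e ∘ x)
    cases g with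
    | add =>
      refine (congrArg e ((congrArg _ (e₂ x)).trans (h.add _ _))).trans ?_
      exact map_add e _ _
    | neg =>
      refine (congrArg e ((congrArg _ (e₁ x)).trans (h.neg _))).trans ?_
      exact map_neg e _
    | zero =>
      refine (congrArg e ((congrArg _ (Subsingleton.elim x ![])).trans h.zero)).trans ?_
      exact map_zero e
    | bracket =>
      refine (congrArg e ((congrArg _ (e₂ x)).trans (h.bracket _ _))).trans ?_
      refine (hlie _ _).trans ?_
      simp_rw [← hb]
      rfl
    | smul r =>
      refine (congrArg e ((congrArg _ (e₁ x)).trans (h.smul _ _))).trans ?_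
      exact map_smul e _ _
  · have e₁ : ∀ y : Fin 1 → M, y = ![y 0] := fun y => by
      funext i; fin_cases i; rfl
    change Structure.RelMap g (e ∘ x) ↔ _
    cases g with
    | pred k =>
      have h₁ : Structure.RelMap (L := lieLang c F) (LazardRel.pred k) x ↔ x 0 ∈ H (k + 1) := by
        rw [e₁ x]
        exact h.pred _ _
      refine Iff.trans ?_ h₁.symm
      change e (x 0) ∈ (H (k + 1)).toSubmodule.map (e : M →ₗ[F] (Fin _ → F)) ↔ _
      rw [Submodule.mem_map_equiv, LinearEquiv.symm_apply_apply]
      rfl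

theorem countable_isoTypes_lazardLieAlgebras [Countable F] :
    (Quotient.mk' '' lazardLieAlgebras c F).Countable := by
  have : ∀ n, Countable (Submodule F (Fin n → F)) := fun n => by
    refine Function.Surjective.countable
      (f := fun X : Finset (Fin n → F) => Submodule.span F (X : Set (Fin n → F))) fun P => ?_
    exact IsNoetherian.noetherian P
  refine countable_isoTypes (ι := Σ n : ℕ, (Fin n → Fin n → Fin n → F) ×
    (Fin (c + 1) → Submodule F (Fin n → F)))
    (fun x => ⟨Fin x.1 → F, coordinateStructure x.2.1 x.2.2⟩) fun M hM => ?_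
  obtain ⟨_, _, H, h, _⟩ := mem_lazardLieAlgebras_iff.1 hM
  obtain ⟨n, e, he⟩ := h.exists_equiv_coordinate
  exact ⟨⟨n, _, _⟩, he⟩

/-- For c = 1 the bracket is zero and the series is trivial, so the dimension is a complete
invariant over any field. -/
theorem countable_isoTypes_lazardLieAlgebras_one :
    (Quotient.mk' '' lazardLieAlgebras 1 F).Countable := by
  refine countable_isoTypes (ι := ℕ) (fun n => ⟨Fin n → F, coordinateStructure (fun _ _ => 0)
    (fun k => if k = 0 then ⊤ else ⊥)⟩) fun M hM => ?_
  obtain ⟨_, _, H, h, _⟩ := mem_lazardLieAlgebras_iff.1 hM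
  obtain ⟨n, e, he⟩ := h.exists_equiv_coordinate
  refine ⟨n, ?_⟩
  have hB : (fun i j : Fin n => e ⁅e.symm (Pi.single i 1), e.symm (Pi.single j 1)⁆) =
      fun _ _ => 0 := by
    funext i j
    have := h.series.lie_mem 1 1 le_rfl le_rfl _ (h.series.mem_one (e.symm (Pi.single i 1)))
      _ (h.series.mem_one (e.symm (Pi.single j 1)))
    rw [h.series.bot _ (by omega), LieSubalgebra.mem_bot] at this
    rw [this, map_zero]
  have hP : (fun k : Fin (1 + 1) => (H (k + 1)).toSubmodule.map (e : M →ₗ[F] (Fin n → F))) =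
      fun k => if k = 0 then ⊤ else ⊥ := by
    funext k
    fin_cases k
    · simp [h.series.one]
    · simp [h.series.bot 2 (by omega)]
  rw [hB, hP] at he
  exact he

theorem isFraisseClass_lazardLieAlgebras (hc : 1 ≤ c) (h : Countable F ∨ c = 1) :
    IsFraisseClass (lazardLieAlgebras c F) := by
  refine ⟨isAmalgamationClass_lazardLieAlgebras hc, ?_⟩
  rcases h with h | rfl
  · exact countable_isoTypes_lazardLieAlgebras
  · exact countable_isoTypes_lazardLieAlgebras_one

section Finite

variable [Finite F]

instance finite_lieLang_functions : Finite (Σ l, (lieLang c F).Functions l) := by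
  let g : Fin 4 ⊕ F → (Σ l, (lieLang c F).Functions l) := Sum.elim
    ![⟨_, LieFunc.add⟩, ⟨_, LieFunc.neg⟩, ⟨_, LieFunc.zero⟩, ⟨_, LieFunc.bracket⟩]
    fun r => ⟨_, LieFunc.smul r⟩
  refine Finite.of_surjective g ?_
  rintro ⟨_, _ | _ | _ | _ | r⟩
  exacts [⟨Sum.inl 0, rfl⟩, ⟨Sum.inl 1, rfl⟩, ⟨Sum.inl 2, rfl⟩, ⟨Sum.inl 3, rfl⟩,
    ⟨Sum.inr r, rfl⟩]

instance finite_lazardRel : Finite (Σ l, LazardRel c l) := by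
  refine Finite.of_surjective (fun i : Fin (c + 1) => (⟨1, LazardRel.pred i⟩ : Σ l, LazardRel c l)) ?_
  rintro ⟨_, ⟨i⟩⟩
  exact ⟨i, rfl⟩

theorem uniformlyLocallyFinite_of_age_eq_lazardLieAlgebras {M : Type u}
    [(lieLang c F).Structure M] (hM : (lieLang c F).age M = lazardLieAlgebras c F) :
    UniformlyLocallyFinite (lieLang c F) M := by
  classical
  refine uniformlyLocallyFinite_of_age_eq hM
    (fun n => Nat.card F ^ ∑ k ∈ Finset.range c, n ^ (k + 1)) fun A hA n a ha => ?_
  obtain ⟨_, _, H, h, _⟩ := mem_lazardLieAlgebras_iff.1 hA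
  have ha' := (h.closure_eq_top_iff _).1 ha
  obtain ⟨T, hT, hcard⟩ := h.series.exists_spanning_finset (Finset.univ.image a)
    (by rw [Finset.coe_image, Finset.coe_univ, Set.image_univ]; exact ha')
  have hsurj : Function.Surjective (fun r : T → F => ∑ t, r t • (t : A)) := by
    intro x
    have hx : x ∈ Submodule.span F (Set.range ((↑) : T → A)) := by
      rw [Subtype.range_coe_subtype]
      exact hT ▸ Submodule.mem_top
    exact (Submodule.mem_span_range_iff_exists_fun F).1 hx
  have hfin : Finite A := Finite.of_surjective _ hsurj
  have h₁ : Nat.card A ≤ Nat.card F ^ T.card := by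
    refine (Nat.card_le_card_of_surjective _ hsurj).trans_eq ?_
    rw [Nat.card_fun, Nat.card_eq_finsetCard]
  have h₂ : T.card ≤ ∑ k ∈ Finset.range c, n ^ (k + 1) := by
    refine hcard.trans (Finset.sum_le_sum fun k _ => Nat.pow_le_pow_left ?_ _)
    exact Finset.card_image_le.trans (by simp)
  rw [Set.encard_univ, ENat.card_eq_coe_natCard]
  exact_mod_cast h₁.trans (Nat.pow_le_pow_right Nat.card_pos h₂)

/-- The abelian algebras F ^ n, with everything in weight 1, are members of unbounded size; this
needs c ≥ 1. -/
theorem infinite_of_age_eq_lazardLieAlgebras (hc : 1 ≤ c) {M : Type u}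
    [(lieLang c F).Structure M] (hM : (lieLang c F).age M = lazardLieAlgebras c F) :
    Infinite M := by
  refine infinite_of_age_eq hM fun n => ?_
  obtain ⟨i, -, -, -, -, hZ⟩ := exists_abelian_mem (c := c) (F := F) hc n
  refine ⟨_, hZ, ?_⟩
  rw [Set.encard_univ]
  change (n : ℕ∞) ≤ ENat.card (Fin n → F)
  rw [ENat.card_eq_coe_natCard, Nat.card_fun, Nat.card_fin]
  exact_mod_cast (Nat.lt_pow_self Finite.one_lt_card).le

end Finite

end LieClass

open scoped commutatorElement

/-! ### Polynomial sequences in filtered groups -/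

section PolynomialSequences

variable {G : Type*} [Group G]

/-- The multiplicative difference of a sequence. -/
def mulDiff (f : ℕ → G) : ℕ → G := fun n => (f n)⁻¹ * f (n + 1)

/-- The values of `f` lie in `K i`, and those of its `k`-th difference lie in `K (i + k)`
for all `k ≤ m`. -/
def IsPolynomialSeq (K : ℕ → Subgroup G) : ℕ → ℕ → (ℕ → G) → Prop
  | 0, i, f => ∀ n, f n ∈ K i
  | m + 1, i, f => (∀ n, f n ∈ K i) ∧ IsPolynomialSeq K m (i + 1) (mulDiff f)

namespace IsPolynomialSeq

variable {K : ℕ → Subgroup G} {m i j : ℕ} {f g : ℕ → G}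

theorem mem (h : IsPolynomialSeq K m i f) (n : ℕ) : f n ∈ K i := by
  cases m with
  | zero => exact h n
  | succ m => exact h.1 n

theorem of_succ (h : IsPolynomialSeq K (m + 1) i f) : IsPolynomialSeq K m i f := by
  induction m generalizing i f with
  | zero => exact h.1
  | succ m ih => exact ⟨h.1, ih h.2⟩

/-- If the first k values are trivial, then the value at k is the k-th difference at 0. -/
theorem mem_of_eq_one {k : ℕ} (h : IsPolynomialSeq K m i f) (hkm : k ≤ m)
    (hf : ∀ n < k, f n = 1) : f k ∈ K (i + k) := by
  induction k generalizing i f m with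
  | zero => exact h.mem 0
  | succ k ih =>
    obtain ⟨m, rfl⟩ := Nat.exists_eq_add_of_le' (Nat.one_le_of_lt hkm)
    have := ih h.2 (by omega) fun n hn => by
      rw [mulDiff, hf n (by omega), hf (n + 1) (by omega), inv_one, one_mul]
    rwa [mulDiff, hf k (by omega), inv_one, one_mul, add_assoc, add_comm 1 k] at this

section

variable (hK : Antitone K)
include hK

theorem mono (h : IsPolynomialSeq K m j f) (hij : i ≤ j) : IsPolynomialSeq K m i f := by
  induction m generalizing i j f with
  | zero => exact fun n => hK hij (h n)
  | succ m ih => exact ⟨fun n => hK hij (h.1 n), ih h.2 (by omega)⟩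

omit hK in
theorem one (m i : ℕ) : IsPolynomialSeq K m i (fun _ => 1) := by
  induction m generalizing i with
  | zero => exact fun n => one_mem _
  | succ m ih =>
    refine ⟨fun n => one_mem _, ?_⟩
    have : mulDiff (fun _ : ℕ => (1 : G)) = fun _ => 1 := by
      funext n
      simp [mulDiff]
    rw [this]
    exact ih _

/-- By Pascal's rule the difference of x ^ C(n, k + 1) is x ^ C(n, k). -/
theorem pow_choose (m i k : ℕ) {x : G} (hx : x ∈ K (i + k)) :
    IsPolynomialSeq K m i fun n => x ^ n.choose k := by
  induction m generalizing i k with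
  | zero => exact fun n => pow_mem (hK (by omega) hx) _
  | succ m ih =>
    refine ⟨fun n => pow_mem (hK (by omega) hx) _, ?_⟩
    cases k with
    | zero =>
      have : mulDiff (fun n => x ^ n.choose 0) = fun _ => 1 := by
        funext n
        simp [mulDiff]
      rw [this]
      exact one _ _
    | succ k =>
      have : mulDiff (fun n => x ^ n.choose (k + 1)) = fun n => x ^ n.choose k := by
        funext n
        rw [mulDiff, Nat.choose_succ_succ', add_comm (n.choose k), pow_add, inv_mul_cancel_left]
      rw [this]
      exact ih (i + 1) k (by rwa [add_assoc, add_comm 1 k])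

variable (hcomm : ∀ i j, ⁅K i, K j⁆ ≤ K (i + j))
include hcomm

/-- The differences of a product, an inverse and a commutator are expressed by products, conjugates
and commutators of sequences of one order less, so the three statements must be proved together.
Conjugation is covered by g f g⁻¹ = [g, f] f. -/
theorem closure_properties (m : ℕ) :
    (∀ i f g, IsPolynomialSeq K m i f → IsPolynomialSeq K m i g →
      IsPolynomialSeq K m i (f * g)) ∧
    (∀ i f, IsPolynomialSeq K m i f → IsPolynomialSeq K m i f⁻¹) ∧
    (∀ i j f g, IsPolynomialSeq K m i f → IsPolynomialSeq K m j g →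
      IsPolynomialSeq K m (i + j) ⁅f, g⁆) := by
  induction m with
  | zero =>
    exact ⟨fun i f g hf hg n => mul_mem (hf n) (hg n), fun i f hf n => inv_mem (hf n),
      fun i j f g hf hg n => hcomm i j (Subgroup.commutator_mem_commutator (hf n) (hg n))⟩
  | succ m ih =>
    obtain ⟨hmul, hinv, hbr⟩ := ih
    have conj : ∀ i j f g, IsPolynomialSeq K m j g → IsPolynomialSeq K m i f →
        IsPolynomialSeq K m i (g * f * g⁻¹) := by
      intro i j f g hg hf
      have := hmul _ _ _ ((hbr j i g f hg hf).mono hK (i := i) (by omega)) hf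
      rwa [commutatorElement_def, inv_mul_cancel_right] at this
    refine ⟨fun i f g hf hg => ⟨fun n => mul_mem (hf.1 n) (hg.1 n), ?_⟩,
      fun i f hf => ⟨fun n => inv_mem (hf.1 n), ?_⟩, fun i j f g hf hg =>
      ⟨fun n => hcomm i j (Subgroup.commutator_mem_commutator (hf.1 n) (hg.1 n)), ?_⟩⟩
    · have : mulDiff (f * g) = g⁻¹ * mulDiff f * g⁻¹⁻¹ * mulDiff g := by
        funext n
        simp only [mulDiff, Pi.mul_apply, Pi.inv_apply]
        group
      rw [this]
      exact hmul _ _ _ (conj _ i _ _ (hinv _ _ hg.of_succ) hf.2) hg.2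
    · have : mulDiff f⁻¹ = f * (mulDiff f)⁻¹ * f⁻¹ := by
        funext n
        simp only [mulDiff, Pi.mul_apply, Pi.inv_apply]
        group
      rw [this]
      exact conj _ i _ _ hf.of_succ (hinv _ _ hf.2)
    · have : mulDiff ⁅f, g⁆ = ⁅f, g⁆⁻¹ * (f * ⁅mulDiff f, g * mulDiff g⁆ * f⁻¹) * ⁅f, g⁆⁻¹⁻¹ *
          (g * ⁅f, mulDiff g⁆ * g⁻¹) := by
        funext n
        simp only [mulDiff, Pi.mul_apply, Pi.inv_apply, commutatorElement_def]
        group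
      rw [this]
      have h₁ := hbr _ _ _ _ hf.2 (hmul _ _ _ hg.of_succ (hg.2.mono hK (i := j) (by omega)))
      have h₂ := hbr _ _ _ _ hf.of_succ hg.2
      rw [add_right_comm] at h₁
      exact hmul _ _ _ (conj _ _ _ _ (hinv _ _ (hbr _ _ _ _ hf.of_succ hg.of_succ))
        (conj _ _ _ _ hf.of_succ h₁)) (conj _ _ _ _ hg.of_succ h₂)

/-- Divide f successively by factors g_k ^ C(n, k) with g_k ∈ K k, for 2 ≤ k < p, so that more and
more initial values become trivial. At n = p these factors are trivial, since p divides C(p, k) and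
K 2 has exponent p; hence f(p) is unchanged and ends up in K p = 1. -/
theorem apply_prime_eq_one {p : ℕ} (hp : p.Prime) (hf : ∀ m, IsPolynomialSeq K m 0 f)
    (h₀ : f 0 = 1) (h₁ : f 1 = 1) (hexp : ∀ x ∈ K 2, x ^ p = 1) (hbot : K p = ⊥) : f p = 1 := by
  have key : ∀ k, 2 ≤ k → k ≤ p → ∃ g : ℕ → G, (∀ m, IsPolynomialSeq K m 0 g) ∧
      (∀ n < k, g n = 1) ∧ g p = f p := by
    intro k hk
    induction k, hk using Nat.le_induction with
    | base =>
      refine fun _ => ⟨f, hf, fun n hn => ?_, rfl⟩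
      interval_cases n <;> assumption
    | succ k hk ih =>
      intro hkp
      obtain ⟨g, hg, hg₁, hgp⟩ := ih (by omega)
      have hgk : g k ∈ K k := by
        have := (hg k).mem_of_eq_one le_rfl hg₁
        rwa [zero_add] at this
      refine ⟨g * (fun n => g k ^ n.choose k)⁻¹, fun m => ?_, fun n hn => ?_, ?_⟩
      · obtain ⟨hmul, hinv, -⟩ := closure_properties hK hcomm m
        exact hmul _ _ _ (hg m) (hinv _ _ (pow_choose hK m 0 k (by rwa [zero_add])))
      · rcases Nat.lt_succ_iff_lt_or_eq.1 hn with hn | rfl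
        · simp [hg₁ n hn, Nat.choose_eq_zero_of_lt hn]
        · simp
      · obtain ⟨r, hr⟩ := hp.dvd_choose_self (by omega : k ≠ 0) (by omega : k < p)
        rw [Pi.mul_apply, Pi.inv_apply, hr, pow_mul, hexp _ (hK hk hgk), one_pow, inv_one, mul_one,
          hgp]
  obtain ⟨g, hg, hg₁, hgp⟩ := key p hp.two_le le_rfl
  have := (hg p).mem_of_eq_one le_rfl hg₁
  rwa [zero_add, hbot, Subgroup.mem_bot, hgp] at this

end

end IsPolynomialSeq

/-- Apply the preceding result to (xy)⁻ⁿ xⁿ yⁿ, which is trivial at n = 0 and n = 1. -/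
theorem mul_pow_prime_of_series {K : ℕ → Subgroup G} (hK : Antitone K)
    (hcomm : ∀ i j, ⁅K i, K j⁆ ≤ K (i + j)) {p : ℕ} (hp : p.Prime)
    (hexp : ∀ x ∈ K 2, x ^ p = 1) (hbot : K p = ⊥) {x y : G} (hx : x ∈ K 1) (hy : y ∈ K 1) :
    (x * y) ^ p = x ^ p * y ^ p := by
  have hpow : ∀ m, ∀ z ∈ K 1, IsPolynomialSeq K m 0 fun n => z ^ n := fun m z hz => by
    simpa using IsPolynomialSeq.pow_choose hK m 0 1 (by rwa [zero_add])
  have h := IsPolynomialSeq.apply_prime_eq_one hK hcomm hp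
    (f := (fun n => (x * y) ^ n)⁻¹ * ((fun n => x ^ n) * fun n => y ^ n)) (fun m => by
      obtain ⟨hmul, hinv, -⟩ := IsPolynomialSeq.closure_properties hK hcomm m
      exact hmul _ _ _ (hinv _ _ (hpow m _ (mul_mem hx hy)))
        (hmul _ _ _ (hpow m x hx) (hpow m y hy))) (by simp) (by simp) hexp hbot
  exact inv_mul_eq_one.1 h

end PolynomialSequences

/-! ### Elements of order dividing p in groups with a short Lazard series -/

section Exponent

theorem commutator_closure_le {G : Type*} [Group G] (N : Subgroup G) [N.Normal] {S : Set G}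
    (h : ∀ a ∈ S, ∀ b ∈ S, ⁅a, b⁆ ∈ N) : ⁅Subgroup.closure S, Subgroup.closure S⁆ ≤ N := by
  let q := QuotientGroup.mk' N
  have hq : ∀ a b, ⁅a, b⁆ ∈ N ↔ q a * q b = q b * q a := fun a b => by
    rw [← QuotientGroup.eq_one_iff, ← commutatorElement_eq_one_iff_mul_comm]
    rfl
  have comm : ∀ z : G, (∀ b ∈ S, ⁅z, b⁆ ∈ N) → ∀ b ∈ Subgroup.closure S, ⁅z, b⁆ ∈ N := by
    intro z hz b hb
    have hle : Subgroup.closure S ≤ (Subgroup.centralizer {q z}).comap q := by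
      rw [Subgroup.closure_le]
      intro b hb
      exact Subgroup.mem_centralizer_singleton_iff.2 ((hq z b).1 (hz b hb)).symm
    exact (hq z b).2 (Subgroup.mem_centralizer_singleton_iff.1 (hle hb)).symm
  have symm : ∀ a b, ⁅a, b⁆ ∈ N → ⁅b, a⁆ ∈ N := fun a b hab => by
    rw [← commutatorElement_inv]
    exact inv_mem hab
  rw [Subgroup.commutator_le]
  intro a ha b hb
  exact comm a (fun b hb => symm _ _ (comm b (h b hb) a ha)) b hb

theorem IsGroupLazardSeries.mono {c : ℕ} {G : Type*} [Group G] {H : ℕ → Subgroup G}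
    (h : IsGroupLazardSeries c H) {k l : ℕ} (hk : 1 ≤ k) (hkl : k ≤ l) : H l ≤ H k := by
  induction l, hkl using Nat.le_induction with
  | base => exact le_rfl
  | succ l hl ih => exact (h.anti l (by omega)).trans ih

theorem IsGroupLazardSeries.mem_one {c : ℕ} {G : Type*} [Group G] {H : ℕ → Subgroup G}
    (h : IsGroupLazardSeries c H) (x : G) : x ∈ H 1 := h.one ▸ Subgroup.mem_top x

theorem IsGroupLazardSeries.commutator_mem {c : ℕ} {G : Type*} [Group G] {H : ℕ → Subgroup G}
    (h : IsGroupLazardSeries c H) {k l : ℕ} (hk : 1 ≤ k) (hl : 1 ≤ l) {x y : G} (hx : x ∈ H k)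
    (hy : y ∈ H l) : ⁅x, y⁆ ∈ H (k + l) :=
  h.commutator_le k l hk hl (Subgroup.commutator_mem_commutator hx hy)

theorem IsGroupLazardSeries.normal {c : ℕ} {G : Type*} [Group G] {H : ℕ → Subgroup G}
    (h : IsGroupLazardSeries c H) {k : ℕ} (hk : 1 ≤ k) : (H k).Normal := by
  refine ⟨fun x hx g => ?_⟩
  have := mul_mem (h.mono hk (by omega) (h.commutator_mem le_rfl hk (h.mem_one g) hx)) hx
  rwa [commutatorElement_def, inv_mul_cancel_right] at this

theorem IsGroupLazardSeries.mul_pow_eq_one_of_eq_bot {c p : ℕ} {G : Type*} [Group G]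
    {H : ℕ → Subgroup G} (h : IsGroupLazardSeries c H) (h₂ : H 2 = ⊥) {x y : G}
    (hx : x ^ p = 1) (hy : y ^ p = 1) : (x * y) ^ p = 1 := by
  have hxy := h.commutator_mem le_rfl le_rfl (h.mem_one x) (h.mem_one y)
  rw [h₂, Subgroup.mem_bot, commutatorElement_eq_one_iff_mul_comm] at hxy
  rw [(show Commute x y from hxy).mul_pow, hx, hy, one_mul]

/-- Induction on the length. The group itself is not assumed to have exponent p, so a filtration of
⟨x, y⟩-type with second term of exponent p must be found first; the p-torsion of `H 2`, a subgroup
by induction, provides it. -/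
theorem IsGroupLazardSeries.mul_pow_eq_one {p : ℕ} (hp : p.Prime) {c : ℕ} (hcp : c < p)
    {G : Type u} [Group G] {H : ℕ → Subgroup G} (h : IsGroupLazardSeries c H) {x y : G}
    (hx : x ^ p = 1) (hy : y ^ p = 1) : (x * y) ^ p = 1 := by
  induction c generalizing G with
  | zero => exact h.mul_pow_eq_one_of_eq_bot (h.bot 2 (by omega)) hx hy
  | succ c ih =>
    rcases Nat.eq_zero_or_pos c with rfl | hc
    · exact h.mul_pow_eq_one_of_eq_bot (h.bot 2 (by omega)) hx hy
    have hn₂ : (H 2).Normal := h.normal (by omega)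
    have hn₃ : (H 3).Normal := h.normal (by omega)
    -- Since [B, B] ≤ H 3, shifting the indices gives B a Lazard series that is shorter by one, and
    -- the induction hypothesis applies to it.
    let B : Subgroup G := Subgroup.closure (insert x (H 2 : Set G))
    have hxB : x ∈ B := Subgroup.subset_closure (Set.mem_insert _ _)
    have hHB : H 2 ≤ B := fun z hz => Subgroup.subset_closure (Set.mem_insert_of_mem _ hz)
    have hBB : ⁅B, B⁆ ≤ H 3 := by
      refine commutator_closure_le _ ?_
      have h₁ : ∀ a ∈ H 2, ∀ b, ⁅b, a⁆ ∈ H 3 := fun a ha b =>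
        h.commutator_mem le_rfl (by omega) (h.mem_one b) ha
      have h₂ : ∀ a ∈ H 2, ∀ b, ⁅a, b⁆ ∈ H 3 := fun a ha b =>
        h.commutator_mem (by omega) le_rfl ha (h.mem_one b)
      rintro a (rfl | ha) b (rfl | hb)
      · rw [commutatorElement_self]
        exact one_mem _
      exacts [h₁ b hb a, h₂ a ha b, h₂ a ha b]
    let HB : ℕ → Subgroup B := fun k => if k ≤ 1 then ⊤ else (H (k + 1)).subgroupOf B
    have hB₁ : ∀ k, k ≤ 1 → HB k = ⊤ := fun k hk => if_pos hk
    have hB₂ : ∀ k, 2 ≤ k → HB k = (H (k + 1)).subgroupOf B := fun k hk => if_neg (by omega)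
    have hHBs : IsGroupLazardSeries c HB := by
      refine ⟨hB₁ 1 le_rfl, fun k hk => ?_, fun k hk => ?_, fun k l hk hl => ?_⟩
      · rcases hk.eq_or_lt with rfl | hk'
        · rw [hB₁ 1 le_rfl]
          exact le_top
        · rw [hB₂ k hk', hB₂ (k + 1) (by omega)]
          exact fun z hz => h.anti (k + 1) (by omega) hz
      · rw [hB₂ k (by omega), h.bot _ (by omega), Subgroup.bot_subgroupOf]
      · rw [Subgroup.commutator_le, hB₂ (k + l) (by omega)]
        rintro ⟨a, ha⟩ ha' ⟨b, hb⟩ hb'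
        change ⁅a, b⁆ ∈ H (k + l + 1)
        rcases hk.eq_or_lt with rfl | hk'
        · rcases hl.eq_or_lt with rfl | hl'
          · exact hBB (Subgroup.commutator_mem_commutator ha hb)
          · rw [hB₂ l hl'] at hb'
            have := h.commutator_mem le_rfl (by omega) (h.mem_one a) (y := b) (l := l + 1) hb'
            rwa [← add_assoc] at this
        · rw [hB₂ k hk'] at ha'
          rcases hl.eq_or_lt with rfl | hl'
          · exact h.commutator_mem (by omega) le_rfl (x := a) (k := k + 1) ha' (h.mem_one b)
          · rw [hB₂ l hl'] at hb'
            exact h.mono (by omega) (by omega)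
              (h.commutator_mem (k := k + 1) (l := l + 1) (by omega) (by omega) (x := a) (y := b)
                ha' hb')
    have hB : ∀ a ∈ B, ∀ b ∈ B, a ^ p = 1 → b ^ p = 1 → (a * b) ^ p = 1 := by
      intro a ha b hb hap hbp
      have hap' : (⟨a, ha⟩ : B) ^ p = 1 := Subtype.ext hap
      have hbp' : (⟨b, hb⟩ : B) ^ p = 1 := Subtype.ext hbp
      exact congrArg Subtype.val (ih (by omega) hHBs hap' hbp')
    have conj_pow_eq : ∀ a b : G, a ^ p = 1 → (b * a * b⁻¹) ^ p = 1 := fun a b hab => by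
      rw [conj_pow, hab, mul_one, mul_inv_cancel]
    let T : Subgroup G :=
      { carrier := {z | z ∈ H 2 ∧ z ^ p = 1}
        one_mem' := ⟨one_mem _, one_pow _⟩
        mul_mem' := fun {a b} ha hb => ⟨mul_mem ha.1 hb.1, hB a (hHB ha.1) b (hHB hb.1) ha.2 hb.2⟩
        inv_mem' := fun {a} ha => ⟨inv_mem ha.1, by rw [inv_pow, ha.2, inv_one]⟩ }
    have hT₂ : T ≤ H 2 := fun z hz => hz.1
    have hTn : T.Normal := ⟨fun z hz g => ⟨hn₂.conj_mem z hz.1 g, conj_pow_eq z g hz.2⟩⟩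
    -- The commutator is the product of x and y x⁻¹ y⁻¹. Both have order dividing p, and the second
    -- lies in B because it is congruent to x⁻¹ modulo H 2.
    have hxyT : ⁅x, y⁆ ∈ T := by
      refine ⟨h.commutator_mem le_rfl le_rfl (h.mem_one x) (h.mem_one y), ?_⟩
      have hxi : x⁻¹ ^ p = 1 := by rw [inv_pow, hx, inv_one]
      have hmem : y * x⁻¹ * y⁻¹ ∈ B := by
        have := mul_mem (hHB (h.commutator_mem le_rfl le_rfl (h.mem_one y) (h.mem_one x⁻¹)))
          (inv_mem hxB)
        rwa [commutatorElement_def, inv_mul_cancel_right] at this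
      have := hB x hxB _ hmem hx (conj_pow_eq x⁻¹ y hxi)
      rwa [← mul_assoc, ← mul_assoc] at this
    have hcomm_left : ∀ z ∈ T, ∀ g, ⁅z, g⁆ ∈ T := fun z hz g => by
      have := mul_mem hz (hTn.conj_mem _ (inv_mem hz) g)
      rwa [← mul_assoc, ← mul_assoc] at this
    have hcomm_right : ∀ z ∈ T, ∀ g, ⁅g, z⁆ ∈ T := fun z hz g => by
      rw [← commutatorElement_inv]
      exact inv_mem (hcomm_left z hz g)
    let S : Set G := insert x (insert y (T : Set G))
    -- The desired filtration: ⟨x, y, T⟩ in degrees 0 and 1, then the intersections of the series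
    -- with T. Its second term has exponent p, and K p = 1 because c < p.
    let K : ℕ → Subgroup G := fun k => if k ≤ 1 then Subgroup.closure S else H k ⊓ T
    have hK₁ : ∀ k, k ≤ 1 → K k = Subgroup.closure S := fun k hk => if_pos hk
    have hK₂ : ∀ k, 2 ≤ k → K k = H k ⊓ T := fun k hk => if_neg (by omega)
    have hTS : T ≤ Subgroup.closure S := fun z hz =>
      Subgroup.subset_closure (Set.mem_insert_of_mem _ (Set.mem_insert_of_mem _ hz))
    have hK : Antitone K := by
      refine antitone_nat_of_succ_le fun k => ?_
      rcases Nat.lt_or_ge 1 k with hk | hk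
      · rw [hK₂ k hk, hK₂ (k + 1) (by omega)]
        exact inf_le_inf_right T (h.anti k (by omega))
      · rw [hK₁ k hk]
        rcases Nat.lt_or_ge 1 (k + 1) with hk' | hk'
        · rw [hK₂ _ hk']
          exact inf_le_right.trans hTS
        · rw [hK₁ _ hk']
    have hSS : ⁅Subgroup.closure S, Subgroup.closure S⁆ ≤ T := by
      refine commutator_closure_le T ?_
      have hyxT : ⁅y, x⁆ ∈ T := by
        rw [← commutatorElement_inv]
        exact inv_mem hxyT
      rintro a (rfl | rfl | ha) b (rfl | rfl | hb)
      · rw [commutatorElement_self]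
        exact one_mem _
      · exact hxyT
      · exact hcomm_right b hb _
      · exact hyxT
      · rw [commutatorElement_self]
        exact one_mem _
      · exact hcomm_right b hb _
      all_goals exact hcomm_left a ha _
    have hKcomm : ∀ i j, ⁅K i, K j⁆ ≤ K (i + j) := by
      intro i j
      rw [Subgroup.commutator_le]
      intro a ha b hb
      rcases Nat.lt_or_ge 1 i with hi | hi
      · rw [hK₂ i hi] at ha
        rcases Nat.lt_or_ge 1 j with hj | hj
        · rw [hK₂ j hj] at hb
          rw [hK₂ _ (by omega)]
          exact ⟨h.commutator_mem (by omega) (by omega) ha.1 hb.1, hcomm_left a ha.2 b⟩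
        · refine hK (by omega : i + j ≤ i + 1) ?_
          rw [hK₂ _ (by omega)]
          exact ⟨h.commutator_mem (by omega) le_rfl ha.1 (h.mem_one b), hcomm_left a ha.2 b⟩
      · rcases Nat.lt_or_ge 1 j with hj | hj
        · rw [hK₂ j hj] at hb
          refine hK (by omega : i + j ≤ 1 + j) ?_
          rw [hK₂ _ (by omega)]
          exact ⟨h.commutator_mem le_rfl (by omega) (h.mem_one a) hb.1, hcomm_right b hb.2 a⟩
        · rw [hK₁ i hi] at ha
          rw [hK₁ j hj] at hb
          refine hK (by omega : i + j ≤ 2) ?_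
          have := hSS (Subgroup.commutator_mem_commutator ha hb)
          rw [hK₂ _ le_rfl]
          exact ⟨hT₂ this, this⟩
    have hxS : x ∈ K 1 := hK₁ 1 le_rfl ▸ Subgroup.subset_closure (Set.mem_insert _ _)
    have hyS : y ∈ K 1 := hK₁ 1 le_rfl ▸
      Subgroup.subset_closure (Set.mem_insert_of_mem _ (Set.mem_insert _ _))
    rw [mul_pow_prime_of_series hK hKcomm hp ?_ ?_ hxS hyS, hx, hy, one_mul]
    · intro z hz
      rw [hK₂ 2 le_rfl] at hz
      exact hz.2.2
    · rw [hK₂ p hp.two_le, h.bot p hcp, bot_inf_eq]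

end Exponent

/-! ### One-step extensions of groups -/

section GroupSteps

theorem dvd_of_zpow_mem {G : Type*} [Group G] {p : ℕ} (hp : p.Prime) {R : Subgroup G} {a : G}
    (ha : a ^ p = 1) (haR : a ∉ R) {n : ℤ} (h : a ^ n ∈ R) : (p : ℤ) ∣ n := by
  by_contra hpn
  obtain ⟨r, s, hrs⟩ := ((Nat.prime_iff_prime_int.1 hp).coprime_iff_not_dvd).2 hpn
  refine haR ?_
  have : a = (a ^ n) ^ s := by
    rw [← zpow_mul, ← zpow_one a, ← zpow_mul, one_mul, ← hrs, zpow_add, mul_comm r, zpow_mul,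
      zpow_natCast, ha, one_zpow, one_mul, mul_comm]
  rw [this]
  exact zpow_mem h s

theorem zpow_eq_one_of_dvd {G : Type*} [Group G] {p : ℕ} {a : G} (ha : a ^ p = 1) {n : ℤ}
    (h : (p : ℤ) ∣ n) : a ^ n = 1 := by
  obtain ⟨k, rfl⟩ := h
  rw [zpow_mul, zpow_natCast, ha, one_zpow]

/-- `A` is generated by `a`, an element of order `p` and weight `i`, over the image of `f`, a normal
subgroup which contains all elements of weight greater than `i`. -/
structure IsGroupStep {C A : Type*} [Group C] [Group A] (p : ℕ) (HC : ℕ → Subgroup C)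
    (HA : ℕ → Subgroup A) (f : C →* A) (i : ℕ) (a : A) : Prop where
  inj : Function.Injective f
  mem_iff : ∀ k, 1 ≤ k → ∀ x, f x ∈ HA k ↔ x ∈ HC k
  pos : 1 ≤ i
  mem : a ∈ HA i
  notMem : a ∉ f.range
  span : ∀ x, ∃ (y : C) (n : ℤ), x = f y * a ^ n
  normal : f.range.Normal
  next : ∀ x ∈ HA (i + 1), x ∈ f.range
  pow_eq_one : a ^ p = 1

namespace IsGroupStep

variable {C A : Type*} [Group C] [Group A] {p : ℕ} {HC : ℕ → Subgroup C} {HA : ℕ → Subgroup A}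
  {f : C →* A} {i : ℕ} {a : A}

theorem exists_conj (h : IsGroupStep p HC HA f i a) :
    ∃ γ : A →* MulAut C, ∀ x y, f (γ x y) = x * f y * x⁻¹ := by
  have := h.normal
  let e : C ≃* f.range := MonoidHom.ofInjective h.inj
  refine ⟨(MulAut.congr e.symm).toMonoidHom.comp MulAut.conjNormal, fun x y => ?_⟩
  have : ∀ z : f.range, f (e.symm z) = z := fun z =>
    congrArg Subtype.val (e.apply_symm_apply z)
  exact this _

/-- Because a ^ p = 1 and a lies outside the image of `C`, the group `A` is a split extension of `C`
by ⟨a⟩ of order p; w ^ p = 1 and compatibility of the actions are the only conditions. -/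
theorem exists_lift (hp : p.Prime) (h : IsGroupStep p HC HA f i a) {W : Type*} [Group W]
    (q : C →* W) {w : W} (hw : w ^ p = 1) {γ : A →* MulAut C}
    (hγ : ∀ x y, f (γ x y) = x * f y * x⁻¹) (hq : ∀ y, w * q y * w⁻¹ = q (γ a y)) :
    ∃ g : A →* W, (∀ y, g (f y) = q y) ∧ g a = w := by
  choose y n hyn using h.span
  have key : ∀ (y' : C) (n' : ℤ), q (y (f y' * a ^ n')) * w ^ (n (f y' * a ^ n')) = q y' * w ^ n' := by
    intro y' n'
    have h₁ := hyn (f y' * a ^ n')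
    set m := n (f y' * a ^ n')
    set z := y (f y' * a ^ n')
    have h₂ : a ^ (n' - m) = f (y'⁻¹ * z) := by
      rw [map_mul, map_inv, zpow_sub, eq_inv_mul_iff_mul_eq, ← mul_assoc, mul_inv_eq_iff_eq_mul]
      exact h₁
    have hdvd := dvd_of_zpow_mem hp h.pow_eq_one h.notMem (n := n' - m) ⟨_, h₂.symm⟩
    rw [zpow_eq_one_of_dvd h.pow_eq_one hdvd, eq_comm, ← map_one f] at h₂
    have h₃ : z = y' := (inv_mul_eq_one.1 (h.inj h₂)).symm
    have h₄ := zpow_eq_one_of_dvd hw hdvd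
    rw [zpow_sub, mul_inv_eq_one] at h₄
    rw [h₃, h₄]
  -- The compatible pairs form a subgroup of A × W, so compatibility of (a, w) passes to all integer
  -- powers.
  have hconj : ∀ n : ℤ, ∀ y, w ^ n * q y * (w ^ n)⁻¹ = q (γ (a ^ n) y) := by
    let P : Subgroup (A × W) :=
      { carrier := {t | ∀ y, t.2 * q y * t.2⁻¹ = q (γ t.1 y)}
        one_mem' := fun y => by simp
        mul_mem' := fun {s t} hs ht y => by
          have h₁ := hs (γ t.1 y)
          rw [← ht y] at h₁
          rw [Prod.fst_mul, map_mul, MulAut.mul_apply, ← h₁, Prod.snd_mul]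
          group
        inv_mem' := fun {t} ht y => by
          have h₁ := ht (γ t⁻¹.1 y)
          rw [Prod.fst_inv, map_inv, MulAut.apply_inv_self] at h₁
          rw [Prod.fst_inv, map_inv, Prod.snd_inv, ← h₁]
          group }
    intro n
    have : ((a, w) ^ n : A × W) ∈ P := zpow_mem (show (a, w) ∈ P from hq) n
    exact this
  refine ⟨MonoidHom.mk' (fun x => q (y x) * w ^ n x) fun x x' => ?_, fun y' => ?_, ?_⟩
  · have hx := hyn x
    have hx' := hyn x'
    set m := n x
    set m' := n x'
    set z := y x
    set z' := y x'
    have hxx : x * x' = f (z * γ (a ^ m) z') * a ^ (m + m') := by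
      rw [hx, hx', map_mul, hγ, zpow_add]
      group
    rw [hxx, key, map_mul, ← hconj, zpow_add]
    group
  · have := key y' 0
    simpa using this
  · have := key 1 1
    simpa using this

/-- For k ≤ i powers of `a` can be cancelled on both sides. For k > i the homomorphism `lam` kills
`K k` but not q(a), so the exponent of `a` is a multiple of p and the question is reduced to `C`. -/
theorem mem_series_iff {c : ℕ} (hp : p.Prime) (h : IsGroupStep p HC HA f i a)
    (hA : IsGroupLazardSeries c HA) {W M : Type*} [Group W] [Group M] {K : ℕ → Subgroup W}
    {q : A →* W} (hK : ∀ k, 1 ≤ k → k ≤ i → K i ≤ K k)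
    (hqf : ∀ k, 1 ≤ k → ∀ y, q (f y) ∈ K k ↔ y ∈ HC k) (hqa : q a ∈ K i) (lam : W →* M)
    (hlam : ∀ y, lam (q (f y)) = 1) (hlama : lam (q a) ≠ 1)
    (hlamK : ∀ k, i < k → ∀ t ∈ K k, lam t = 1) (k : ℕ) (hk : 1 ≤ k) (x : A) :
    q x ∈ K k ↔ x ∈ HA k := by
  have hrange : ∀ y, q (f y) ∈ K k ↔ f y ∈ HA k := fun y => by rw [hqf k hk, h.mem_iff k hk]
  rcases Nat.lt_or_ge i k with hik | hik
  · have : x ∈ f.range → (q x ∈ K k ↔ x ∈ HA k) := by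
      rintro ⟨y, rfl⟩
      exact hrange y
    constructor
    · intro hx
      refine (this ?_).1 hx
      have h₁ := hlamK k hik _ hx
      obtain ⟨y, n, rfl⟩ := h.span x
      rw [map_mul, map_mul, hlam, one_mul, map_zpow, map_zpow] at h₁
      have hdvd := dvd_of_zpow_mem hp (R := ⊥) (a := lam (q a))
        (by rw [← map_pow, ← map_pow, h.pow_eq_one, map_one, map_one]) hlama h₁
      rw [zpow_eq_one_of_dvd h.pow_eq_one hdvd, mul_one]
      exact ⟨y, rfl⟩
    · intro hx
      exact (this (h.next x (hA.mono (by omega) hik hx))).2 hx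
  · obtain ⟨y, n, rfl⟩ := h.span x
    rw [map_mul, Subgroup.mul_mem_cancel_right _ (by
        rw [map_zpow]
        exact zpow_mem (hK k hk hik hqa) n), Subgroup.mul_mem_cancel_right _
        (zpow_mem (hA.mono hk hik h.mem) n), hrange]

end IsGroupStep

/-- The image of `f` is contained in a normal subgroup `R` such that all elements of `R` are
congruent to elements of the image modulo weight `m`, and `t` generates `D` over `R`. -/
def FactorsThroughGroupStep {A D : Type*} [Group A] [Group D] (HD : ℕ → Subgroup D) (f : A →* D)
    (t : D) (j m : ℕ) : Prop :=
  ∃ R : Subgroup D, R.Normal ∧ (∀ x, f x ∈ R) ∧ (∀ x ∈ R, ∃ y, ∃ z ∈ HD m, x = f y * z) ∧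
    t ∈ HD j ∧ t ∉ R ∧ (∀ d, ∃ r ∈ R, ∃ n : ℤ, d = r * t ^ n) ∧ HD (j + 1) ≤ R

/-- Take R = q(A) · HD(i + j). Conjugation by `t` preserves it since [t, q(a)] has weight i + j, and
μ detects the exponent of `t` modulo R. -/
theorem factorsThroughGroupStep_of_hom {c p : ℕ} (hp : p.Prime) {C A D M : Type*} [Group C]
    [Group A] [Group D] [Group M] {HC : ℕ → Subgroup C} {HA : ℕ → Subgroup A}
    {HD : ℕ → Subgroup D} {f : C →* A} {i j : ℕ} {a : A} (h : IsGroupStep p HC HA f i a)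
    (hD : IsGroupLazardSeries c HD) {q : A →* D} (hq : q a ∈ HD i) (hj : 1 ≤ j) {t : D}
    (ht : t ∈ HD j) (htp : t ^ p = 1) (μ : D →* M) (hμq : ∀ x, μ (q x) = 1) (hμt : μ t ≠ 1)
    (hμ : ∀ x ∈ HD (j + 1), μ x = 1) (hnorm : ∀ y, ∃ z, t * q (f y) * t⁻¹ = q (f z))
    (hgen : q.range ⊔ Subgroup.zpowers t = ⊤) : FactorsThroughGroupStep HD q t j (i + j) := by
  have hi := h.pos
  have hN : (HD (i + j)).Normal := hD.normal (by omega)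
  let R := q.range ⊔ HD (i + j)
  have hconj : R ≤ R.comap (MulAut.conj t).toMonoidHom := by
    refine sup_le ?_ fun z hz => ?_
    · rintro _ ⟨x, rfl⟩
      obtain ⟨y, n, rfl⟩ := h.span x
      change MulAut.conj t (q (f y * a ^ n)) ∈ R
      rw [map_mul, map_mul, map_zpow, map_zpow]
      refine mul_mem ?_ (zpow_mem ?_ n)
      · obtain ⟨z, hz⟩ := hnorm y
        rw [MulAut.conj_apply, hz]
        exact Subgroup.mem_sup_left ⟨_, rfl⟩
      · have h₁ : ⁅t, q a⁆ ∈ R := Subgroup.mem_sup_right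
          (add_comm j i ▸ hD.commutator_mem hj hi ht hq)
        have := mul_mem h₁ (Subgroup.mem_sup_left ⟨a, rfl⟩ : q a ∈ R)
        rwa [commutatorElement_def, inv_mul_cancel_right] at this
    · exact Subgroup.mem_sup_right (hN.conj_mem z hz t)
  have hpow : ∀ n : ℕ, ∀ r ∈ R, t ^ n * r * (t ^ n)⁻¹ ∈ R := by
    intro n
    induction n with
    | zero => simp
    | succ n ih =>
      intro r hr
      have := hconj (ih r hr)
      change t * (t ^ n * r * (t ^ n)⁻¹) * t⁻¹ ∈ R at this
      rwa [show t ^ (n + 1) * r * (t ^ (n + 1))⁻¹ = t * (t ^ n * r * (t ^ n)⁻¹) * t⁻¹ by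
        rw [pow_succ']; group]
  -- Only t R t⁻¹ ⊆ R is known; the reverse inclusion follows because t⁻¹ is a nonnegative power of
  -- t.
  have htinv : t ^ (p - 1) = t⁻¹ := by
    refine eq_inv_of_mul_eq_one_left ?_
    rw [← pow_succ, Nat.sub_add_cancel hp.one_le, htp]
  have hR : R.Normal := by
    rw [← Subgroup.normalizer_eq_top_iff, eq_top_iff, ← hgen]
    refine sup_le (le_sup_left.trans Subgroup.le_normalizer) ?_
    rw [Subgroup.zpowers_le, Subgroup.mem_normalizer_iff]
    refine fun r => ⟨fun hr => hconj hr, fun hr => ?_⟩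
    have := hpow (p - 1) _ hr
    rw [htinv] at this
    convert this using 1
    group
  have hμR : ∀ r ∈ R, μ r = 1 := by
    have : R ≤ μ.ker := by
      refine sup_le ?_ fun z hz => hμ z (hD.mono (by omega) (by omega) hz)
      rintro _ ⟨x, rfl⟩
      exact hμq x
    exact this
  have hspan : ∀ d, ∃ r ∈ R, ∃ n : ℤ, d = r * t ^ n := by
    intro d
    have hd : d ∈ R ⊔ Subgroup.zpowers t := by
      have htop : R ⊔ Subgroup.zpowers t = ⊤ := by
        rw [eq_top_iff, ← hgen]
        exact sup_le_sup_right le_sup_left _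
      rw [htop]
      trivial
    obtain ⟨r, hr, _, ⟨n, rfl⟩, rfl⟩ := Subgroup.mem_sup_of_normal_left.1 hd
    exact ⟨r, hr, n, rfl⟩
  refine ⟨R, hR, fun x => Subgroup.mem_sup_left ⟨x, rfl⟩, fun x hx => ?_, ht,
    fun htR => hμt (hμR t htR), hspan, fun d hd => ?_⟩
  · obtain ⟨_, ⟨y, rfl⟩, z, hz, rfl⟩ := Subgroup.mem_sup_of_normal_right.1 hx
    exact ⟨y, z, hz, rfl⟩
  · obtain ⟨r, hr, n, rfl⟩ := hspan d
    have h₁ := hμ _ hd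
    rw [map_mul, hμR r hr, one_mul, map_zpow] at h₁
    have hdvd := dvd_of_zpow_mem hp (R := ⊥) (a := μ t) (by rw [← map_pow, htp, map_one]) hμt h₁
    rwa [zpow_eq_one_of_dvd htp hdvd, mul_one]

end GroupSteps

/-! ### The filtration of the automorphism group -/

section AutomorphismSeries

variable {c : ℕ} {C : Type*} [Group C] {H : ℕ → Subgroup C}

/-- The automorphisms which move the elements of weight `l` by elements of weight `k + l`. -/
def autSeries (hH : IsGroupLazardSeries c H) (k : ℕ) : Subgroup (MulAut C) where
  carrier := {α | ∀ l, 1 ≤ l → ∀ y ∈ H l, α y * y⁻¹ ∈ H (k + l) ∧ α⁻¹ y * y⁻¹ ∈ H (k + l)}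
  one_mem' := fun l _ y _ => by simp
  mul_mem' := fun {α β} hα hβ l hl y hy => by
    have key : ∀ α β : MulAut C, (∀ y ∈ H l, α y * y⁻¹ ∈ H (k + l)) →
        (∀ y ∈ H l, β y * y⁻¹ ∈ H (k + l)) → (α * β) y * y⁻¹ ∈ H (k + l) := by
      intro α β hα hβ
      have h₁ := mul_mem (hH.mono hl (Nat.le_add_left l k) (hβ y hy)) hy
      rw [inv_mul_cancel_right] at h₁
      have := mul_mem (hα _ h₁) (hβ y hy)
      rwa [mul_assoc, inv_mul_cancel_left] at this
    rw [mul_inv_rev]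
    exact ⟨key α β (fun y hy => (hα l hl y hy).1) fun y hy => (hβ l hl y hy).1,
      key β⁻¹ α⁻¹ (fun y hy => (hβ l hl y hy).2) fun y hy => (hα l hl y hy).2⟩
  inv_mem' := fun {α} hα l hl y hy => by
    rw [inv_inv]
    exact (hα l hl y hy).symm

theorem autSeries_mono (hH : IsGroupLazardSeries c H) {k l : ℕ} (hkl : k ≤ l) :
    autSeries hH l ≤ autSeries hH k := fun _ hα m hm y hy =>
  ⟨hH.mono (by omega) (by omega) (hα m hm y hy).1, hH.mono (by omega) (by omega) (hα m hm y hy).2⟩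

theorem apply_mem_of_mem_autSeries {hH : IsGroupLazardSeries c H} {k l : ℕ} {α : MulAut C}
    (hα : α ∈ autSeries hH k) (hl : 1 ≤ l) {y : C} (hy : y ∈ H l) : α y ∈ H l := by
  have := mul_mem (hH.mono hl (Nat.le_add_left l k) (hα l hl y hy).1) hy
  rwa [inv_mul_cancel_right] at this

theorem quotient_mk_apply_eq {hH : IsGroupLazardSeries c H} {k l m : ℕ} {α : MulAut C}
    (hα : α ∈ autSeries hH k) (hl : 1 ≤ l) (hm : 1 ≤ m) (hmkl : m ≤ k + l) {y : C} (hy : y ∈ H l)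
    [(H m).Normal] : QuotientGroup.mk' (H m) (α y) = QuotientGroup.mk' (H m) y := by
  rw [← mul_inv_eq_one, ← map_inv, ← map_mul]
  exact (QuotientGroup.eq_one_iff _).2 (hH.mono hm hmkl (hα l hl y hy).1)

/-- Write αx = ux and βx = vx with u, v of weights k + m and l + m. Modulo weight k + l + m, αβx is
vux and βαx is uvx, and u, v commute. The inverse commutator is covered by exchanging α and β. -/
theorem commutator_mem_autSeries {hH : IsGroupLazardSeries c H} {k l : ℕ} {α β : MulAut C}
    (hα : α ∈ autSeries hH k) (hβ : β ∈ autSeries hH l) : ⁅α, β⁆ ∈ autSeries hH (k + l) := by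
  have key : ∀ (k l : ℕ) (α β : MulAut C), α ∈ autSeries hH k → β ∈ autSeries hH l → ∀ m, 1 ≤ m →
      ∀ y ∈ H m, ⁅α, β⁆ y * y⁻¹ ∈ H (k + l + m) := by
    intro k l α β hα hβ m hm y hy
    have hN : (H (k + l + m)).Normal := hH.normal (by omega)
    -- In terms of x the commutator sends βαx to αβx, so no inverses remain.
    obtain ⟨x, hx, rfl⟩ : ∃ x ∈ H m, β (α x) = y := by
      refine ⟨α⁻¹ (β⁻¹ y), apply_mem_of_mem_autSeries (inv_mem hα) hm
        (apply_mem_of_mem_autSeries (inv_mem hβ) hm hy), ?_⟩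
      rw [MulAut.apply_inv_self, MulAut.apply_inv_self]
    have happ : ⁅α, β⁆ (β (α x)) = α (β x) := by
      simp [commutatorElement_def, MulAut.mul_apply]
    rw [happ]
    obtain ⟨u, hu, hux⟩ : ∃ u ∈ H (k + m), α x = u * x :=
      ⟨_, (hα m hm x hx).1, by rw [inv_mul_cancel_right]⟩
    obtain ⟨v, hv, hvx⟩ : ∃ v ∈ H (l + m), β x = v * x :=
      ⟨_, (hβ m hm x hx).1, by rw [inv_mul_cancel_right]⟩
    rw [hvx, hux, map_mul, map_mul, hux, hvx]
    refine (QuotientGroup.eq_one_iff _).1 ?_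
    change QuotientGroup.mk' (H (k + l + m)) _ = 1
    have huv : ⁅v, u⁆ ∈ H (k + l + m) :=
      hH.mono (by omega) (by omega) (hH.commutator_mem (by omega) (by omega) hv hu)
    have huv' : QuotientGroup.mk' (H (k + l + m)) v * QuotientGroup.mk' _ u =
        QuotientGroup.mk' (H (k + l + m)) u * QuotientGroup.mk' _ v := by
      rw [← map_mul, ← map_mul, ← mul_inv_eq_one, ← map_inv, ← map_mul, mul_inv_rev, ← mul_assoc]
      exact (QuotientGroup.eq_one_iff _).2 huv
    rw [map_mul, map_inv, mul_inv_eq_one, map_mul, map_mul, map_mul, map_mul,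
      quotient_mk_apply_eq hα (by omega) (by omega) (by omega) hv,
      quotient_mk_apply_eq hβ (by omega) (by omega) (by omega) hu, ← mul_assoc, ← mul_assoc,
      huv']
  intro m hm y hy
  refine ⟨key k l α β hα hβ m hm y hy, ?_⟩
  rw [commutatorElement_inv, add_comm k l]
  exact key l k β α hβ hα m hm y hy

theorem IsGroupStep.conj_mem_autSeries {A : Type*} [Group A] {p : ℕ} {HA : ℕ → Subgroup A}
    {f : C →* A} {i : ℕ} {a : A} (hH : IsGroupLazardSeries c H) (h : IsGroupStep p H HA f i a)
    (hA : IsGroupLazardSeries c HA) {γ : A →* MulAut C} (hγ : ∀ x y, f (γ x y) = x * f y * x⁻¹) :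
    γ a ∈ autSeries hH i := by
  have hi := h.pos
  have key : ∀ a ∈ HA i, ∀ l, 1 ≤ l → ∀ y ∈ H l, γ a y * y⁻¹ ∈ H (i + l) := by
    intro a ha l hl y hy
    rw [← h.mem_iff _ (by omega), map_mul, map_inv, hγ]
    exact hA.commutator_mem hi hl ha ((h.mem_iff l hl y).2 hy)
  refine fun l hl y hy => ⟨key a h.mem l hl y hy, ?_⟩
  rw [← map_inv]
  exact key a⁻¹ (inv_mem h.mem) l hl y hy

end AutomorphismSeries

/-! ### The ambient semidirect product and the amalgam of groups -/

section GroupAmalgam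

/-- The plane over `ℤ/p`, written multiplicatively. -/
abbrev MulPlane (p : ℕ) := Multiplicative (ZMod p) × Multiplicative (ZMod p)

/-- The ambient group of the amalgam of two steps over `C`. -/
abbrev GroupAmbient (p : ℕ) (C : Type*) [Group C] :=
  C ⋊[MonoidHom.fst (MulAut C) (MulPlane p)] (MulAut C × MulPlane p)

instance finite_groupAmbient (p : ℕ) [NeZero p] (C : Type*) [Group C] [Finite C] :
    Finite (GroupAmbient p C) :=
  have : Finite (MulAut C) := Finite.of_injective (fun α : MulAut C => (α : C → C))
    DFunLike.coe_injective
  have : Finite (Multiplicative (ZMod p)) := inferInstanceAs (Finite (ZMod p))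
  Finite.of_equiv _ SemidirectProduct.equivProd.symm

variable {p c : ℕ} {C : Type*} [Group C] {H : ℕ → Subgroup C} {i j k l : ℕ}
  {t s : GroupAmbient p C}

/-- The elements of weight `k`, where the two basis vectors of the plane have weights `i`
and `j`. -/
structure HasGroupWeight (hH : IsGroupLazardSeries c H) (i j k : ℕ) (t : GroupAmbient p C) :
    Prop where
  left : t.left ∈ H k
  aut : t.right.1 ∈ autSeries hH k
  fst : i < k → t.right.2.1 = 1
  snd : j < k → t.right.2.2 = 1

namespace HasGroupWeight

variable {hH : IsGroupLazardSeries c H}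

theorem one : HasGroupWeight hH i j k (1 : GroupAmbient p C) :=
  ⟨one_mem _, one_mem _, fun _ => rfl, fun _ => rfl⟩

theorem mul (hk : 1 ≤ k) (h : HasGroupWeight hH i j k t) (h' : HasGroupWeight hH i j k s) :
    HasGroupWeight hH i j k (t * s) :=
  ⟨mul_mem h.left (apply_mem_of_mem_autSeries h.aut hk h'.left), mul_mem h.aut h'.aut,
    fun hi => by
      rw [SemidirectProduct.mul_right, Prod.snd_mul, Prod.fst_mul, h.fst hi, h'.fst hi, one_mul],
    fun hj => by
      rw [SemidirectProduct.mul_right, Prod.snd_mul, Prod.snd_mul, h.snd hj, h'.snd hj, one_mul]⟩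

theorem inv (hk : 1 ≤ k) (h : HasGroupWeight hH i j k t) : HasGroupWeight hH i j k t⁻¹ :=
  ⟨apply_mem_of_mem_autSeries (inv_mem h.aut) hk (inv_mem h.left), inv_mem h.aut,
    fun hi => by
      rw [SemidirectProduct.inv_right, Prod.snd_inv, Prod.fst_inv, h.fst hi, inv_one],
    fun hj => by
      rw [SemidirectProduct.inv_right, Prod.snd_inv, Prod.snd_inv, h.snd hj, inv_one]⟩

theorem mono (h : HasGroupWeight hH i j l t) (hk : 1 ≤ k) (hkl : k ≤ l) :
    HasGroupWeight hH i j k t :=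
  ⟨hH.mono hk hkl h.left, autSeries_mono hH hkl h.aut, fun hi => h.fst (by omega),
    fun hj => h.snd (by omega)⟩

/-- Modulo `H (k + l)` the two automorphism parts act trivially on the elements concerned, so the
`C`-part is congruent to the commutator of the `C`-parts. The plane is abelian and contributes
nothing. -/
theorem commutator (hk : 1 ≤ k) (hl : 1 ≤ l) (h : HasGroupWeight hH i j k t)
    (h' : HasGroupWeight hH i j l s) : HasGroupWeight hH i j (k + l) ⁅t, s⁆ := by
  have hright : ⁅t, s⁆.right = ⁅t.right, s.right⁆ :=
    map_commutatorElement SemidirectProduct.rightHom t s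
  have hplane : ⁅t, s⁆.right.2 = 1 := by
    rw [hright]
    exact (map_commutatorElement (MonoidHom.snd (MulAut C) (MulPlane p)) _ _).trans
      (commutatorElement_eq_one_iff_mul_comm.2 (mul_comm _ _))
  have haut : ⁅t, s⁆.right.1 = ⁅t.right.1, s.right.1⁆ := by
    rw [hright]
    exact map_commutatorElement (MonoidHom.fst (MulAut C) (MulPlane p)) _ _
  have hautmem := commutator_mem_autSeries h.aut h'.aut
  refine ⟨?_, haut ▸ hautmem, fun _ => by rw [hplane]; rfl, fun _ => by rw [hplane]; rfl⟩
  have hN : (H (k + l)).Normal := hH.normal (by omega)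
  let q := QuotientGroup.mk' (H (k + l))
  have hts : ⁅t, s⁆ = t * s * (s * t)⁻¹ := by
    rw [commutatorElement_def]
    group
  have hleft : ⁅t, s⁆.left = t.left * t.right.1 s.left *
      ⁅t.right.1, s.right.1⁆ (s.left * s.right.1 t.left)⁻¹ := by
    rw [← haut, hts, SemidirectProduct.mul_left, SemidirectProduct.inv_left,
      SemidirectProduct.mul_left, SemidirectProduct.mul_left, SemidirectProduct.mul_right,
      SemidirectProduct.mul_right]
    rfl
  rw [hleft]
  refine (QuotientGroup.eq_one_iff _).1 ?_
  change q _ = 1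
  have h₁ : q (t.right.1 s.left) = q s.left :=
    quotient_mk_apply_eq h.aut hl (by omega) le_rfl h'.left
  have h₂ : q (s.right.1 t.left) = q t.left :=
    quotient_mk_apply_eq h'.aut hk (by omega) (by omega) h.left
  have h₃ : ∀ x, q (⁅t.right.1, s.right.1⁆ x) = q x := fun x =>
    quotient_mk_apply_eq hautmem le_rfl (by omega) (by omega) (hH.mem_one x)
  rw [map_mul, map_mul, h₁, h₃, map_inv, map_mul, h₂, ← map_mul, ← map_mul, ← map_inv, ← map_mul,
    mul_inv_rev, ← mul_assoc]
  exact (QuotientGroup.eq_one_iff _).2 (hH.commutator_mem hk hl h.left h'.left)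

theorem eq_one (hi : i ≤ c) (hj : j ≤ c) (hk : c < k) (h : HasGroupWeight hH i j k t) : t = 1 := by
  refine SemidirectProduct.ext ?_ (Prod.ext (MulEquiv.ext fun y => ?_)
    (Prod.ext (h.fst (by omega)) (h.snd (by omega))))
  · have := h.left
    rwa [hH.bot k hk, Subgroup.mem_bot] at this
  · have := (h.aut 1 le_rfl y (hH.mem_one y)).1
    rw [hH.bot _ (by omega), Subgroup.mem_bot, mul_inv_eq_one] at this
    exact this

end HasGroupWeight

/-- The subgroup of the elements of weight `k`, for positive `k`. -/
def weightSubgroup (p : ℕ) (hH : IsGroupLazardSeries c H) (i j k : ℕ) :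
    Subgroup (GroupAmbient p C) where
  -- With truncated subtraction, index 0 gives the same subgroup as index 1.
  carrier := {t | HasGroupWeight hH i j (k - 1 + 1) t}
  one_mem' := HasGroupWeight.one
  mul_mem' := fun h h' => h.mul (by omega) h'
  inv_mem' := fun h => h.inv (by omega)

theorem mem_weightSubgroup {hH : IsGroupLazardSeries c H} (hk : 1 ≤ k) :
    t ∈ weightSubgroup p hH i j k ↔ HasGroupWeight hH i j k t := by
  change HasGroupWeight hH i j (k - 1 + 1) t ↔ _
  rw [Nat.sub_add_cancel hk]

theorem weightSubgroup_isGroupLazardSeries (hH : IsGroupLazardSeries c H) (hi : i ≤ c)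
    (hj : j ≤ c) {D : Subgroup (GroupAmbient p C)} (hD : D ≤ weightSubgroup p hH i j 1) :
    IsGroupLazardSeries c fun k => (weightSubgroup p hH i j k).subgroupOf D where
  one := by rwa [Subgroup.subgroupOf_eq_top]
  anti := fun k hk x hx => by
    rw [Subgroup.mem_subgroupOf, mem_weightSubgroup (by omega)] at hx ⊢
    exact hx.mono hk (by omega)
  bot := fun k hk => by
    rw [eq_bot_iff]
    intro x hx
    rw [Subgroup.mem_subgroupOf, mem_weightSubgroup (by omega)] at hx
    exact Subtype.ext (hx.eq_one hi hj hk)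
  commutator_le := fun k l hk hl => by
    rw [Subgroup.commutator_le]
    intro x hx y hy
    rw [Subgroup.mem_subgroupOf, mem_weightSubgroup (by omega)] at hx hy ⊢
    exact hx.commutator hk hl hy

theorem hasGroupWeight_inl {hH : IsGroupLazardSeries c H} {y : C} :
    HasGroupWeight hH i j k (SemidirectProduct.inl y : GroupAmbient p C) ↔ y ∈ H k :=
  ⟨fun h => h.left, fun h => ⟨h, one_mem _, fun _ => rfl, fun _ => rfl⟩⟩

theorem IsGroupStep.exists_embedding {A : Type*} [Group A] (hp : p.Prime) {HA : ℕ → Subgroup A}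
    {f : C →* A} {a : A} (h : IsGroupStep p H HA f i a) {γ : A →* MulAut C}
    (hγ : ∀ x y, f (γ x y) = x * f y * x⁻¹) {v : MulPlane p} (hv : v ^ p = 1) :
    ∃ q : A →* GroupAmbient p C, (∀ y, q (f y) = SemidirectProduct.inl y) ∧
      q a = SemidirectProduct.inr (γ a, v) := by
  refine h.exists_lift hp SemidirectProduct.inl ?_ hγ fun y => ?_
  · rw [← map_pow, Prod.pow_mk, ← map_pow, h.pow_eq_one, hv, map_one]
    exact map_one _
  · rw [← map_inv, ← SemidirectProduct.inl_aut]
    rfl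

theorem exists_norm_eq {A B D : Type*} [Group A] [Group B] [Group D] {HB : ℕ → Subgroup B}
    {f : C →* A} {g : C →* B} {b : B} (h : IsGroupStep p H HB g j b) {f' : A →* D} {g' : B →* D}
    (hfg : ∀ y, f' (f y) = g' (g y)) (y : C) :
    ∃ z, g' b * f' (f y) * (g' b)⁻¹ = f' (f z) := by
  obtain ⟨z, hz⟩ := h.normal.conj_mem _ ⟨y, rfl⟩ b
  refine ⟨z, ?_⟩
  rw [hfg, hfg, hz, map_mul, map_mul, map_inv]

theorem range_sup_zpowers_eq_top {A B D : Type*} [Group A] [Group B] [Group D]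
    {HB : ℕ → Subgroup B} {f : C →* A} {g : C →* B} {b : B} (h : IsGroupStep p H HB g j b)
    {f' : A →* D} {g' : B →* D} (hfg : ∀ y, f' (f y) = g' (g y)) (hD : f'.range ⊔ g'.range = ⊤) :
    f'.range ⊔ Subgroup.zpowers (g' b) = ⊤ := by
  rw [eq_top_iff, ← hD]
  refine sup_le le_sup_left ?_
  rintro _ ⟨x, rfl⟩
  obtain ⟨y, n, rfl⟩ := h.span x
  rw [map_mul, map_zpow, ← hfg]
  exact mul_mem (Subgroup.mem_sup_left ⟨_, rfl⟩)
    (Subgroup.mem_sup_right (Subgroup.zpow_mem_zpowers _ n))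

theorem IsGroupStep.exists_amalgam {C A B : Type u} [Group C] [Group A] [Group B]
    (hp : p.Prime) (hcp : c < p)
    {HC : ℕ → Subgroup C} {HA : ℕ → Subgroup A} {HB : ℕ → Subgroup B}
    {f : C →* A} {g : C →* B} {i j : ℕ} {a : A} {b : B}
    (hC : IsGroupLazardSeries c HC) (hA : IsGroupLazardSeries c HA) (hB : IsGroupLazardSeries c HB)
    (hAp : ∀ x : A, x ^ p = 1) (hBp : ∀ x : B, x ^ p = 1)
    (hf : IsGroupStep p HC HA f i a) (hg : IsGroupStep p HC HB g j b) (hi : i ≤ c) (hj : j ≤ c) :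
    ∃ (D : Subgroup (GroupAmbient p C)) (HD : ℕ → Subgroup D) (f' : A →* D)
      (g' : B →* D), IsGroupLazardSeries c HD ∧ (∀ d : D, d ^ p = 1) ∧
      (∀ k, 1 ≤ k → ∀ x, f' x ∈ HD k ↔ x ∈ HA k) ∧ (∀ k, 1 ≤ k → ∀ x, g' x ∈ HD k ↔ x ∈ HB k) ∧
      (∀ y, f' (f y) = g' (g y)) ∧ FactorsThroughGroupStep HD f' (g' b) j (i + j) ∧
      FactorsThroughGroupStep HD g' (f' a) i (j + i) := by
  have hi₁ := hf.pos
  have hj₁ := hg.pos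
  obtain ⟨γ, hγ⟩ := hf.exists_conj
  obtain ⟨δ, hδ⟩ := hg.exists_conj
  let g₀ : Multiplicative (ZMod p) := Multiplicative.ofAdd 1
  have hg₀ : g₀ ^ p = 1 := by
    rw [← ofAdd_nsmul, nsmul_one, CharP.cast_eq_zero]
    rfl
  have hg₁ : g₀ ≠ 1 := by
    have : Fact p.Prime := ⟨hp⟩
    exact fun h => one_ne_zero (α := ZMod p) (Multiplicative.ofAdd.injective h)
  obtain ⟨qa, hqaf, hqa⟩ := hf.exists_embedding hp hγ (v := (g₀, 1))
    (by rw [Prod.pow_mk, hg₀, one_pow]; rfl)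
  obtain ⟨qb, hqbg, hqb⟩ := hg.exists_embedding hp hδ (v := (1, g₀))
    (by rw [Prod.pow_mk, hg₀, one_pow]; rfl)
  let K := weightSubgroup p hC i j
  have hKmono : ∀ k l, 1 ≤ k → k ≤ l → K l ≤ K k := fun k l hk hkl t ht => by
    rw [mem_weightSubgroup (by omega)] at ht ⊢
    exact ht.mono hk hkl
  have hinl : ∀ k, 1 ≤ k → ∀ y, (SemidirectProduct.inl y : GroupAmbient p C) ∈ K k ↔ y ∈ HC k :=
    fun k hk y => by rw [mem_weightSubgroup hk, hasGroupWeight_inl]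
  have hqaK : qa a ∈ K i := by
    rw [mem_weightSubgroup hi₁, hqa]
    exact ⟨one_mem _, hf.conj_mem_autSeries hC hA hγ, fun h => absurd h (lt_irrefl i),
      fun _ => rfl⟩
  have hqbK : qb b ∈ K j := by
    rw [mem_weightSubgroup hj₁, hqb]
    exact ⟨one_mem _, hg.conj_mem_autSeries hC hB hδ, fun _ => rfl,
      fun h => absurd h (lt_irrefl j)⟩
  let lam : GroupAmbient p C →* Multiplicative (ZMod p) :=
    ((MonoidHom.fst _ _).comp (MonoidHom.snd _ _)).comp SemidirectProduct.rightHom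
  let mu : GroupAmbient p C →* Multiplicative (ZMod p) :=
    ((MonoidHom.snd _ _).comp (MonoidHom.snd _ _)).comp SemidirectProduct.rightHom
  have hlamK : ∀ k, i < k → ∀ t ∈ K k, lam t = 1 := fun k hk t ht =>
    ((mem_weightSubgroup (by omega)).1 ht).fst hk
  have hmuK : ∀ k, j < k → ∀ t ∈ K k, mu t = 1 := fun k hk t ht =>
    ((mem_weightSubgroup (by omega)).1 ht).snd hk
  have hlama : lam (qa a) = g₀ := by rw [hqa]; rfl
  have hlamb : lam (qb b) = 1 := by rw [hqb]; rfl
  have hmua : mu (qa a) = 1 := by rw [hqa]; rfl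
  have hmub : mu (qb b) = g₀ := by rw [hqb]; rfl
  have hlamq : ∀ x, lam (qb x) = 1 := fun x => by
    obtain ⟨y, n, rfl⟩ := hg.span x
    rw [map_mul, map_mul, hqbg, map_zpow, map_zpow, hlamb, one_zpow, mul_one]
    rfl
  have hmuq : ∀ x, mu (qa x) = 1 := fun x => by
    obtain ⟨y, n, rfl⟩ := hf.span x
    rw [map_mul, map_mul, hqaf, map_zpow, map_zpow, hmua, one_zpow, mul_one]
    rfl
  have hmemA : ∀ k, 1 ≤ k → ∀ x, qa x ∈ K k ↔ x ∈ HA k :=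
    hf.mem_series_iff hp hA (fun k hk hki => hKmono k i hk hki)
      (fun k hk y => by rw [hqaf, hinl k hk]) hqaK lam (fun y => by rw [hqaf]; rfl)
      (by rwa [hlama]) hlamK
  have hmemB : ∀ k, 1 ≤ k → ∀ x, qb x ∈ K k ↔ x ∈ HB k :=
    hg.mem_series_iff hp hB (fun k hk hkj => hKmono k j hk hkj)
      (fun k hk y => by rw [hqbg, hinl k hk]) hqbK mu (fun y => by rw [hqbg]; rfl)
      (by rwa [hmub]) hmuK
  -- Unlike in the Lie case, only the subgroup generated by the two images is taken: its generators
  -- have order dividing p, which arbitrary automorphisms of high weight are not known to have.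
  let D : Subgroup (GroupAmbient p C) := qa.range ⊔ qb.range
  let f' : A →* D := qa.codRestrict D fun x => Subgroup.mem_sup_left ⟨x, rfl⟩
  let g' : B →* D := qb.codRestrict D fun x => Subgroup.mem_sup_right ⟨x, rfl⟩
  have hDK : D ≤ K 1 := by
    refine sup_le ?_ ?_
    · rintro _ ⟨x, rfl⟩
      exact (hmemA 1 le_rfl x).2 (hA.mem_one x)
    · rintro _ ⟨x, rfl⟩
      exact (hmemB 1 le_rfl x).2 (hB.mem_one x)
  have hfg : ∀ y, f' (f y) = g' (g y) := fun y => Subtype.ext ((hqaf y).trans (hqbg y).symm)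
  have hgen : f'.range ⊔ g'.range = ⊤ := by
    have hle : D ≤ (f'.range ⊔ g'.range).map D.subtype := by
      refine sup_le ?_ ?_
      · rintro _ ⟨x, rfl⟩
        exact ⟨f' x, Subgroup.mem_sup_left ⟨x, rfl⟩, rfl⟩
      · rintro _ ⟨x, rfl⟩
        exact ⟨g' x, Subgroup.mem_sup_right ⟨x, rfl⟩, rfl⟩
    rw [eq_top_iff]
    rintro ⟨d, hd⟩ -
    obtain ⟨e, he, rfl⟩ := hle hd
    exact he
  have hgen' : g'.range ⊔ f'.range = ⊤ := by rwa [sup_comm]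
  have hHD := weightSubgroup_isGroupLazardSeries hC hi hj hDK
  -- The elements of order dividing p form a subgroup because D has a Lazard series of length c < p;
  -- both images lie in it.
  have hexp : ∀ d : D, d ^ p = 1 := by
    let T : Subgroup D :=
      { carrier := {d | d ^ p = 1}
        one_mem' := one_pow _
        mul_mem' := fun hx hy => hHD.mul_pow_eq_one hp hcp hx hy
        inv_mem' := fun {x} hx => by
          change x⁻¹ ^ p = 1
          rw [inv_pow, show x ^ p = 1 from hx, inv_one] }
    have hT : f'.range ⊔ g'.range ≤ T := by
      refine sup_le ?_ ?_
      · rintro _ ⟨x, rfl⟩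
        change f' x ^ p = 1
        rw [← map_pow, hAp, map_one]
      · rintro _ ⟨x, rfl⟩
        change g' x ^ p = 1
        rw [← map_pow, hBp, map_one]
    rw [hgen] at hT
    exact fun d => hT (Subgroup.mem_top d)
  refine ⟨D, _, f', g', hHD, hexp, hmemA, hmemB, hfg, ?_, ?_⟩
  · exact factorsThroughGroupStep_of_hom hp hf hHD (q := f') (t := g' b) hqaK hj₁ hqbK (hexp _)
      (mu.comp D.subtype) hmuq (fun h => hg₁ (hmub.symm.trans h))
      (fun x hx => hmuK (j + 1) (by omega) x hx) (exists_norm_eq hg hfg)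
      (range_sup_zpowers_eq_top hg hfg hgen)
  · exact factorsThroughGroupStep_of_hom hp hg hHD (q := g') (t := f' a) hqbK hi₁ hqaK (hexp _)
      (lam.comp D.subtype) hlamq (fun h => hg₁ (hlama.symm.trans h))
      (fun x hx => hlamK (i + 1) (by omega) x hx) (exists_norm_eq hf fun y => (hfg y).symm)
      (range_sup_zpowers_eq_top hf (fun y => (hfg y).symm) hgen')

end GroupAmalgam

/-! ### Bounds on the size of finitely generated groups -/

section GroupGeneration

theorem IsGroupLazardSeries.lowerCentralSeries_eq_bot {c : ℕ} {G : Type*} [Group G]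
    {H : ℕ → Subgroup G} (h : IsGroupLazardSeries c H) :
    Subgroup.lowerCentralSeries (⊤ : Subgroup G) c = ⊥ := by
  have hle : ∀ k, Subgroup.lowerCentralSeries (⊤ : Subgroup G) k ≤ H (k + 1) := by
    intro k
    induction k with
    | zero => exact fun x _ => h.mem_one x
    | succ k ih =>
      rw [Subgroup.lowerCentralSeries_succ, Subgroup.commutator_le]
      exact fun x hx y _ => h.commutator_mem (by omega) le_rfl (ih hx) (h.mem_one y)
  rw [eq_bot_iff, ← h.bot _ (Nat.lt_succ_self c)]
  exact hle c

theorem card_le_of_comm {G : Type*} [Group G] [Finite G] (hG : ∀ x y : G, x * y = y * x) {p : ℕ}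
    (hp : 1 ≤ p) (hexp : ∀ x : G, x ^ p = 1) (S : Finset G)
    (hS : Subgroup.closure (S : Set G) = ⊤) : Nat.card G ≤ p ^ S.card := by
  let i : CommGroup G := { (inferInstance : Group G) with mul_comm := hG }
  refine (Nat.le_of_dvd (Nat.pow_pos hp) (card_dvd_exponent_pow_rank' G hexp)).trans ?_
  exact Nat.pow_le_pow_right hp (Group.rank_le hS)

/-- The abelian quotient by `H 2` has order at most p ^ n, so Schreier's bound makes `H 2` generated
by at most p ^ n * n elements; `H 2` has a Lazard series shorter by one. -/
theorem exists_card_le (p : ℕ) (hp : 1 ≤ p) (c n : ℕ) : ∃ N, ∀ (G : Type u) [Group G] [Finite G]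
    (H : ℕ → Subgroup G), IsGroupLazardSeries c H → (∀ x : G, x ^ p = 1) → ∀ S : Finset G,
      S.card ≤ n → Subgroup.closure (S : Set G) = ⊤ → Nat.card G ≤ N := by
  induction c generalizing n with
  | zero =>
    refine ⟨1, fun G _ _ H h _ _ _ _ => ?_⟩
    have : Subsingleton G := ⟨fun x y => by
      have hx := h.mem_one x
      have hy := h.mem_one y
      rw [h.bot 1 (by omega), Subgroup.mem_bot] at hx hy
      rw [hx, hy]⟩
    exact Finite.card_le_one_iff_subsingleton.2 this
  | succ c ih =>
    obtain ⟨N, hN⟩ := ih (p ^ n * n)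
    refine ⟨p ^ n * N, fun G _ _ H h hexp S hSn hS => ?_⟩
    classical
    have h₂ : (H 2).Normal := h.normal (by omega)
    have hindex : (H 2).index ≤ p ^ n := by
      have hq : Subgroup.closure ((S.image (QuotientGroup.mk' (H 2)) : Finset (G ⧸ H 2)) :
          Set (G ⧸ H 2)) = ⊤ := by
        rw [Finset.coe_image, ← MonoidHom.map_closure, hS, ← MonoidHom.range_eq_map,
          MonoidHom.range_eq_top]
        exact QuotientGroup.mk'_surjective _
      refine (card_le_of_comm (fun x y => ?_) hp (fun x => ?_) _ hq).trans
        (Nat.pow_le_pow_right hp (Finset.card_image_le.trans hSn))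
      · obtain ⟨x, rfl⟩ := QuotientGroup.mk'_surjective _ x
        obtain ⟨y, rfl⟩ := QuotientGroup.mk'_surjective _ y
        rw [← commutatorElement_eq_one_iff_mul_comm, ← map_commutatorElement]
        exact (QuotientGroup.eq_one_iff _).2
          (h.commutator_mem le_rfl le_rfl (h.mem_one x) (h.mem_one y))
      · obtain ⟨x, rfl⟩ := QuotientGroup.mk'_surjective _ x
        rw [← map_pow, hexp, map_one]
    obtain ⟨T, hTcard, hT⟩ := Subgroup.exists_finset_card_le_mul (H 2) hS
    have hseries : IsGroupLazardSeries c fun k => (H (k + 1)).subgroupOf (H 2) := by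
      refine ⟨Subgroup.subgroupOf_self _, fun k hk x hx => h.anti (k + 1) (by omega) hx,
        fun k hk => ?_, fun k l hk hl => ?_⟩
      · rw [h.bot (k + 1) (by omega), Subgroup.bot_subgroupOf]
      · rw [Subgroup.commutator_le]
        exact fun x hx y hy => h.mono (by omega) (by omega)
          (h.commutator_mem (k := k + 1) (l := l + 1) (by omega) (by omega) hx hy)
    have hcard := hN (H 2) _ hseries (fun x => Subtype.ext (hexp x)) T
      (hTcard.trans (Nat.mul_le_mul hindex hSn)) hT
    rw [← Subgroup.index_mul_card (H 2)]
    exact Nat.mul_le_mul hindex hcard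

end GroupGeneration

/-! ### Translation between structures and Lazard groups -/

section GroupLanguage

variable {c : ℕ}

/-- The structure `M` consists of the operations of a group and of the Lazard series `H`. -/
structure GroupCompatible (c : ℕ) (M : Type w) [(groupLang c).Structure M] [Group M]
    (H : ℕ → Subgroup M) : Prop where
  mul : ∀ x y : M, Structure.funMap (L := groupLang c) GroupFunc.mul ![x, y] = x * y
  inv : ∀ x : M, Structure.funMap (L := groupLang c) GroupFunc.inv ![x] = x⁻¹
  one : Structure.funMap (L := groupLang c) GroupFunc.one ![] = (1 : M)
  pred : ∀ (i : Fin (c + 1)) (x : M),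
    Structure.RelMap (L := groupLang c) (LazardRel.pred i) ![x] ↔ x ∈ H (i + 1)
  series : IsGroupLazardSeries c H

theorem isLazardGroup_iff {p : ℕ} {M : Type w} [(groupLang c).Structure M] :
    IsLazardGroup c p M ↔ ∃ (_ : Group M) (H : ℕ → Subgroup M),
      GroupCompatible c M H ∧ ∀ x : M, x ^ p = 1 :=
  ⟨fun ⟨i, H, h₁, h₂, h₃, h₄, h₅, _, h₇⟩ => ⟨i, H, ⟨h₁, h₂, h₃, h₄, h₅⟩, h₇⟩,
    fun ⟨i, H, h, hp⟩ => ⟨i, H, h.mul, h.inv, h.one, h.pred, h.series,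
      h.series.lowerCentralSeries_eq_bot, hp⟩⟩

/-- The structure given by a group and a series of subgroups. -/
@[reducible]
def groupStructure (c : ℕ) {M : Type w} [Group M] (H : ℕ → Subgroup M) :
    (groupLang c).Structure M where
  funMap := fun {_} f => match f with
    | GroupFunc.mul => fun x => x 0 * x 1
    | GroupFunc.inv => fun x => (x 0)⁻¹
    | GroupFunc.one => fun _ => 1
  RelMap := fun {_} r => match r with
    | LazardRel.pred i => fun x => x 0 ∈ H (i + 1)

theorem groupCompatible_groupStructure {M : Type w} [Group M] {H : ℕ → Subgroup M}
    (h : IsGroupLazardSeries c H) :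
    letI := groupStructure c H
    GroupCompatible c M H :=
  letI := groupStructure c H
  ⟨fun _ _ => rfl, fun _ => rfl, rfl, fun _ _ => Iff.rfl, h⟩

namespace GroupCompatible

variable {M N : Type*} [(groupLang c).Structure M] [(groupLang c).Structure N]
  [Group M] [Group N] {H : ℕ → Subgroup M} {H' : ℕ → Subgroup N}

theorem mem_of_pred (h : GroupCompatible c M H) {k : ℕ} (hk : k < c + 1) (x : M) :
    Structure.RelMap (L := groupLang c) (LazardRel.pred ⟨k, hk⟩) ![x] ↔ x ∈ H (k + 1) :=
  h.pred ⟨k, hk⟩ x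

/-- The subgroup with the same elements as a substructure. -/
def toSubgroup (h : GroupCompatible c M H) (S : (groupLang c).Substructure M) : Subgroup M where
  carrier := S
  one_mem' := by
    rw [← h.one]
    exact S.fun_mem _ _ fun i => i.elim0
  mul_mem' := fun {x y} hx hy => by
    rw [← h.mul]
    exact S.fun_mem _ _ (by intro i; fin_cases i; exacts [hx, hy])
  inv_mem' := fun {x} hx => by
    change x⁻¹ ∈ S
    rw [← h.inv]
    exact S.fun_mem _ _ (by intro i; fin_cases i; exact hx)

/-- The substructure with the same elements as a subgroup. -/
def ofSubgroup (h : GroupCompatible c M H) (R : Subgroup M) : (groupLang c).Substructure M where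
  carrier := R
  fun_mem := fun {n} f x hx => by
    have e₂ : ∀ y : Fin 2 → M, y = ![y 0, y 1] := fun y => by
      funext i; fin_cases i <;> rfl
    have e₁ : ∀ y : Fin 1 → M, y = ![y 0] := fun y => by
      funext i; fin_cases i; rfl
    cases f with
    | mul => rw [e₂ x, h.mul]; exact mul_mem (hx 0) (hx 1)
    | inv => rw [e₁ x, h.inv]; exact inv_mem (hx 0)
    | one => rw [Subsingleton.elim x ![], h.one]; exact one_mem R

theorem exists_substructure (h : GroupCompatible c M H) {p : ℕ} (hp : ∀ x : M, x ^ p = 1)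
    (S : (groupLang c).Substructure M) : ∃ (_ : Group S) (HS : ℕ → Subgroup S),
      GroupCompatible c S HS ∧ ∀ x : S, x ^ p = 1 := by
  let i₁ : Group S := inferInstanceAs (Group (h.toSubgroup S))
  let inc : S →* M := (h.toSubgroup S).subtype
  refine ⟨i₁, fun k => (H k).comap inc, ⟨fun x y => Subtype.ext ?_, fun x => Subtype.ext ?_,
    Subtype.ext ?_, fun k x => ?_, ?_, ?_, ?_, ?_⟩, fun x => ?_⟩
  · exact (map_funMap_two (L := groupLang c) S.subtype GroupFunc.mul x y).trans (h.mul _ _)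
  · exact (map_funMap_one (L := groupLang c) S.subtype GroupFunc.inv x).trans (h.inv _)
  · exact (map_funMap_zero (L := groupLang c) S.subtype GroupFunc.one).trans h.one
  · exact (map_relMap_one (L := groupLang c) S.subtype (LazardRel.pred k) x).symm.trans
      (h.pred _ _)
  · rw [h.series.one]; rfl
  · exact fun k hk x hx => h.series.anti k hk hx
  · intro k hk
    rw [eq_bot_iff]
    intro x hx
    have hx' : (x : M) ∈ H k := hx
    rw [h.series.bot k hk] at hx'
    exact Subtype.ext hx'
  · intro k l hk hl
    rw [Subgroup.commutator_le]
    exact fun x hx y hy => h.series.commutator_mem hk hl hx hy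
  · have hinj : Function.Injective inc := Subtype.coe_injective
    refine hinj ?_
    rw [map_pow, hp, map_one]

/-- Embeddings of structures are homomorphisms of groups. -/
def toMonoidHom (h : GroupCompatible c M H) (h' : GroupCompatible c N H')
    (f : M ↪[groupLang c] N) : M →* N :=
  MonoidHom.mk' f fun x y => ((congrArg f (h.mul x y)).symm.trans
    (map_funMap_two (L := groupLang c) f GroupFunc.mul x y)).trans (h'.mul _ _)

theorem map_mem_iff (h : GroupCompatible c M H) (h' : GroupCompatible c N H')
    (f : M ↪[groupLang c] N) {k : ℕ} (hk : 1 ≤ k) (x : M) : f x ∈ H' k ↔ x ∈ H k := by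
  by_cases hkc : k ≤ c
  · obtain ⟨k, rfl⟩ := Nat.exists_eq_add_of_le' hk
    exact (h'.mem_of_pred (by omega) _).symm.trans ((map_relMap_one (L := groupLang c) f
      (LazardRel.pred ⟨k, by omega⟩) x).trans (h.mem_of_pred (by omega) x))
  · rw [h.series.bot k (by omega), h'.series.bot k (by omega), Subgroup.mem_bot, Subgroup.mem_bot]
    have h₀ : f 1 = 1 := (toMonoidHom h h' f).map_one
    exact ⟨fun hx => f.injective (hx.trans h₀.symm), fun hx => by rw [hx, h₀]⟩

/-- Homomorphisms of groups which respect the series are embeddings of structures. -/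
def toEmbedding (h : GroupCompatible c M H) (h' : GroupCompatible c N H') (f : M →* N)
    (hf : ∀ k, 1 ≤ k → ∀ x, f x ∈ H' k ↔ x ∈ H k) : M ↪[groupLang c] N where
  toFun := f
  inj' := by
    refine (injective_iff_map_eq_one f).2 fun x hx => ?_
    have := (hf (c + 1) (by omega) x).1 (by rw [hx]; exact one_mem _)
    rwa [h.series.bot _ (by omega), Subgroup.mem_bot] at this
  map_fun' := fun {n} g x => by
    have e₂ : ∀ y : Fin 2 → M, y = ![y 0, y 1] := fun y => by
      funext i; fin_cases i <;> rfl
    have e₁ : ∀ y : Fin 1 → M, y = ![y 0] := fun y => by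
      funext i; fin_cases i; rfl
    have v₂ : ∀ y z : M, f ∘ ![y, z] = ![f y, f z] := fun y z => by
      funext i; fin_cases i <;> rfl
    have v₁ : ∀ y : M, f ∘ ![y] = ![f y] := fun y => by
      funext i; fin_cases i; rfl
    change f _ = Structure.funMap g (f ∘ x)
    cases g with
    | mul => rw [e₂ x, v₂, h.mul, h'.mul, map_mul]
    | inv => rw [e₁ x, v₁, h.inv, h'.inv, map_inv]
    | one => rw [Subsingleton.elim x ![], Subsingleton.elim (f ∘ ![]) ![], h.one, h'.one, map_one]
  map_rel' := fun {n} g x => by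
    have e₁ : ∀ y : Fin 1 → M, y = ![y 0] := fun y => by
      funext i; fin_cases i; rfl
    have v₁ : ∀ y : M, f ∘ ![y] = ![f y] := fun y => by
      funext i; fin_cases i; rfl
    change Structure.RelMap g (f ∘ x) ↔ _
    cases g with
    | pred k => rw [e₁ x, v₁, h.pred, h'.pred, hf _ (by omega)]

theorem subgroup_closure_eq_top (h : GroupCompatible c M H) {X : Set M}
    (hX : Substructure.closure (groupLang c) X = ⊤) : Subgroup.closure X = ⊤ := by
  have : Substructure.closure (groupLang c) X ≤ h.ofSubgroup (Subgroup.closure X) :=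
    (Substructure.closure_le).2 Subgroup.subset_closure
  rw [eq_top_iff]
  intro x _
  exact this (hX ▸ Substructure.mem_top x)

end GroupCompatible

theorem mem_lazardGroups_iff {p : ℕ} {M : Bundled.{w} (groupLang c).Structure} :
    M ∈ lazardGroups c p ↔ Finite M ∧ ∃ (_ : Group M) (H : ℕ → Subgroup M),
      GroupCompatible c M H ∧ ∀ x : M, x ^ p = 1 :=
  ⟨fun h => ⟨h.2, isLazardGroup_iff.1 h.1⟩, fun h => ⟨isLazardGroup_iff.2 h.2, h.1⟩⟩

theorem substructure_mem_lazardGroups {p : ℕ} {M : Bundled.{w} (groupLang c).Structure}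
    (hM : M ∈ lazardGroups c p) (S : (groupLang c).Substructure M) :
    Bundled.of (c := (groupLang c).Structure) S ∈ lazardGroups c p := by
  obtain ⟨hfin, i, H, h, hp⟩ := mem_lazardGroups_iff.1 hM
  exact mem_lazardGroups_iff.2 ⟨inferInstanceAs (Finite (S : Set M)), h.exists_substructure hp S⟩

end GroupLanguage

/-! ### The Fraïssé class of Lazard groups -/

section GroupClass

variable {c p : ℕ}

theorem iso_closed_lazardGroups (M N : Bundled.{w} (groupLang c).Structure)
    (e : Nonempty (M ≃[groupLang c] N)) (hM : M ∈ lazardGroups c p) : N ∈ lazardGroups c p := by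
  obtain ⟨e⟩ := e
  obtain ⟨hfin, i, H, h, hp⟩ := mem_lazardGroups_iff.1 hM
  let q : N ↪[groupLang c] M := e.symm.toEmbedding
  let i' : Group N := e.symm.toEquiv.group
  let φ : N →* M := e.symm.toEquiv.mulEquiv.toMonoidHom
  have inj : Function.Injective φ := q.injective
  refine mem_lazardGroups_iff.2 ⟨Finite.of_injective _ inj, i', fun k => (H k).comap φ,
    ⟨fun x y => inj ?_, fun x => inj ?_, inj ?_, fun k x => ?_, ?_, ?_, ?_, ?_⟩, fun x => inj ?_⟩
  · exact ((map_funMap_two (L := groupLang c) q GroupFunc.mul x y).trans (h.mul _ _)).trans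
      (map_mul φ x y).symm
  · exact ((map_funMap_one (L := groupLang c) q GroupFunc.inv x).trans (h.inv _)).trans
      (map_inv φ x).symm
  · exact ((map_funMap_zero (L := groupLang c) q GroupFunc.one).trans h.one).trans (map_one φ).symm
  · exact (map_relMap_one (L := groupLang c) q (LazardRel.pred k) x).symm.trans (h.pred _ _)
  · rw [h.series.one]; rfl
  · exact fun k hk x hx => h.series.anti k hk hx
  · intro k hk
    rw [eq_bot_iff]
    intro x hx
    have hx' : φ x ∈ H k := hx
    rw [h.series.bot k hk] at hx'
    exact inj ((Subgroup.mem_bot.1 hx').trans (map_one φ).symm)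
  · intro k l hk hl
    rw [Subgroup.commutator_le]
    intro x hx y hy
    rw [Subgroup.mem_comap, map_commutatorElement]
    exact h.series.commutator_mem hk hl hx hy
  · rw [map_pow, hp, map_one]

/-- `B` is generated over the image of `f`, a normal subgroup, by an element of weight `i`, and all
elements of weight greater than `i` belong to this subgroup. -/
def IsGroupStepEmbedding (p : ℕ) {A B : Type*} [(groupLang c).Structure A]
    [(groupLang c).Structure B] (f : A ↪[groupLang c] B) (i : ℕ) : Prop :=
  1 ≤ i ∧ i ≤ c ∧ ∃ (_ : Group B) (H : ℕ → Subgroup B),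
    GroupCompatible c B H ∧ (∀ x : B, x ^ p = 1) ∧ ∃ a ∈ H i, (∀ y, f y ≠ a) ∧
      (∀ x, ∃ y, ∃ n : ℤ, x = f y * a ^ n) ∧ (∀ y x, ∃ z, x * f y * x⁻¹ = f z) ∧
      ∀ x ∈ H (i + 1), ∃ y, f y = x

variable (c p) in
/-- The step relation on the embeddings of bundled structures. -/
def GroupStep ⦃A B : Bundled.{w} (groupLang c).Structure⦄ (f : A ↪[groupLang c] B) (i : ℕ) : Prop :=
  IsGroupStepEmbedding p f i

theorem GroupStep.comp (A' A B : Bundled.{w} (groupLang c).Structure) (e : A' ↪[groupLang c] A)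
    (f : A ↪[groupLang c] B) (i : ℕ) (he : Function.Surjective e) (h : GroupStep c p f i) :
    GroupStep c p (f.comp e) i := by
  obtain ⟨h₁, h₂, i', H, hH, hp, a, ha, h₃, h₄, h₅, h₆⟩ := h
  refine ⟨h₁, h₂, i', H, hH, hp, a, ha, fun y => h₃ (e y), fun x => ?_, fun y x => ?_,
    fun x hx => ?_⟩
  · obtain ⟨y, r, hy⟩ := h₄ x
    obtain ⟨y, rfl⟩ := he y
    exact ⟨y, r, hy⟩
  · obtain ⟨z, hz⟩ := h₅ (e y) x
    obtain ⟨z, rfl⟩ := he z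
    exact ⟨z, hz⟩
  · obtain ⟨y, hy⟩ := h₆ x hx
    obtain ⟨y, rfl⟩ := he y
    exact ⟨y, hy⟩

/-- As for Lie algebras: for a missing element `a` of greatest weight i, commutators of `a` with
`S₁` have weight i + 1 and so fall back into `S₁`, which is therefore normalised by `a`. -/
theorem exists_groupStep_lt {M : Type w} [(groupLang c).Structure M] [Group M]
    {H : ℕ → Subgroup M} (h : GroupCompatible c M H) (hp : ∀ x : M, x ^ p = 1)
    {S₁ S₂ : (groupLang c).Substructure M} (hlt : S₁ < S₂) {m : ℕ} (hm : 1 ≤ m)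
    (hP : ∀ d ∈ S₂, ∃ s ∈ S₁, ∃ z ∈ H m, d = s * z) :
    ∃ (T : (groupLang c).Substructure M) (hT : S₁ ≤ T), S₁ < T ∧ T ≤ S₂ ∧
      ∃ i, m ≤ i ∧ IsGroupStepEmbedding p (Substructure.inclusion hT) i := by
  classical
  let P : ℕ → Prop := fun k => ∃ a ∈ H k, a ∈ S₂ ∧ a ∉ S₁
  let R := h.toSubgroup S₁
  let R₂ := h.toSubgroup S₂
  have hle : R ≤ R₂ := fun x hx => hlt.le hx
  have hPm : P m := by
    obtain ⟨d, hd, hd'⟩ := Set.exists_of_ssubset (SetLike.coe_ssubset_coe.2 hlt)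
    obtain ⟨s, hs, z, hz, rfl⟩ := hP d hd
    have hz₂ : s⁻¹ * (s * z) ∈ R₂ := mul_mem (inv_mem (hle hs)) hd
    rw [inv_mul_cancel_left] at hz₂
    exact ⟨z, hz, hz₂, fun hzs => hd' (R.mul_mem hs hzs)⟩
  have hPc : ∀ k, P k → k ≤ c := by
    rintro k ⟨a, ha, -, ha'⟩
    by_contra hk
    rw [h.series.bot k (by omega), Subgroup.mem_bot] at ha
    rw [ha] at ha'
    exact ha' R.one_mem
  set i := Nat.findGreatest P c with hi
  have hPi : P i := Nat.findGreatest_spec (hPc m hPm) hPm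
  have hmi : m ≤ i := Nat.le_findGreatest (hPc m hPm) hPm
  have hnext : ∀ x ∈ H (i + 1), x ∈ S₂ → x ∈ S₁ := by
    intro x hx hx₂
    by_contra hx₁
    have hP' : P (i + 1) := ⟨x, hx, hx₂, hx₁⟩
    have := Nat.le_findGreatest (hPc _ hP') hP'
    omega
  have hic := hPc i hPi
  obtain ⟨a, ha, ha₂, ha₁⟩ := hPi
  have hconj : ∀ b ∈ H i, b ∈ R₂ → ∀ s ∈ R, b * s * b⁻¹ ∈ R := by
    intro b hb hb₂ s hs
    have h₁ : ⁅b, s⁆ ∈ R := by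
      refine hnext _ (h.series.commutator_mem (by omega) le_rfl hb (h.series.mem_one s)) ?_
      exact R₂.mul_mem (R₂.mul_mem (R₂.mul_mem hb₂ (hle hs)) (R₂.inv_mem hb₂))
        (R₂.inv_mem (hle hs))
    have := R.mul_mem h₁ hs
    rwa [commutatorElement_def, inv_mul_cancel_right] at this
  have hnorm : Subgroup.zpowers a ≤ Subgroup.normalizer (R : Set M) := by
    rw [Subgroup.zpowers_le, Subgroup.mem_normalizer_iff]
    refine fun s => ⟨hconj a ha ha₂ s, fun hs => ?_⟩
    have := hconj a⁻¹ (inv_mem ha) (R₂.inv_mem ha₂) _ hs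
    convert this using 1
    group
  let T := R ⊔ Subgroup.zpowers a
  have memT : ∀ x, x ∈ T ↔ ∃ s ∈ R, ∃ n : ℤ, s * a ^ n = x := by
    intro x
    rw [← SetLike.mem_coe, Subgroup.coe_mul_of_right_le_normalizer_left R _ hnorm, Set.mem_mul]
    constructor
    · rintro ⟨s, hs, _, ⟨n, rfl⟩, rfl⟩
      exact ⟨s, hs, n, rfl⟩
    · rintro ⟨s, hs, n, rfl⟩
      exact ⟨s, hs, _, ⟨n, rfl⟩, rfl⟩
  have hTnorm : T ≤ Subgroup.normalizer (R : Set M) := sup_le Subgroup.le_normalizer hnorm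
  have haT : a ∈ T := Subgroup.mem_sup_right (Subgroup.mem_zpowers a)
  have hle' : S₁ ≤ h.ofSubgroup T := (le_sup_left : R ≤ T)
  have hTS : h.ofSubgroup T ≤ S₂ := by
    have : T ≤ R₂ := sup_le hle (Subgroup.zpowers_le.2 ha₂)
    exact this
  refine ⟨h.ofSubgroup T, hle', lt_of_le_not_ge hle' fun hge => ha₁ (hge haT), hTS, i, hmi, ?_⟩
  obtain ⟨i₁, HT, hT, hTp⟩ := h.exists_substructure hp (h.ofSubgroup T)
  let ι := hT.toMonoidHom h (h.ofSubgroup T).subtype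
  have inj : Function.Injective ι := Subtype.coe_injective
  have hmem := fun (k : ℕ) (hk : 1 ≤ k) => hT.map_mem_iff h (h.ofSubgroup T).subtype hk
  refine ⟨by omega, hic, i₁, HT, hT, hTp, ⟨a, haT⟩, ?_, ?_, ?_, ?_, ?_⟩
  · exact (hmem _ (by omega) _).1 ha
  · intro y hy
    exact ha₁ (by rw [← show (y : M) = a from congrArg Subtype.val hy]; exact y.2)
  · rintro ⟨x, hx⟩
    obtain ⟨s, hs, n, rfl⟩ := (memT x).1 hx
    refine ⟨⟨s, hs⟩, n, inj ?_⟩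
    rw [map_mul, map_zpow]
    rfl
  · rintro ⟨y, hy⟩ ⟨x, hx⟩
    refine ⟨⟨x * y * x⁻¹, (Subgroup.mem_normalizer_iff.1 (hTnorm hx) y).1 hy⟩, inj ?_⟩
    rw [map_mul, map_mul, map_inv]
    rfl
  · intro x hx
    exact ⟨⟨x, hnext x ((hmem _ (by omega) x).2 hx) (hTS x.2)⟩, rfl⟩

theorem exists_groupTower {A D : Type w} [(groupLang c).Structure A] [(groupLang c).Structure D]
    (hD : Bundled.of (c := (groupLang c).Structure) D ∈ lazardGroups c p) [Group D]
    {H : ℕ → Subgroup D} (h : GroupCompatible c D H) (hp : ∀ x : D, x ^ p = 1)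
    (f : A ↪[groupLang c] D) (S : (groupLang c).Substructure D)
    (hf : ∀ x, f x ∈ S) {m : ℕ} (hm : 1 ≤ m)
    (hP : ∀ d ∈ S, ∃ y, ∃ z ∈ H m, d = f y * z) :
    ∃ w, StepTower (lazardGroups c p) (GroupStep c p) (A := Bundled.of A)
      (B := Bundled.of S) (f.codRestrict S hf) w ∧ ∀ i ∈ w, m ≤ i := by
  let P : (groupLang c).Substructure D → Prop := fun S₁ =>
    ∀ d ∈ S, ∃ s ∈ S₁, ∃ z ∈ H m, d = s * z
  have hfin : Finite D := hD.2
  have hfin' : Finite ((groupLang c).Substructure D) := Finite.of_injective _ SetLike.coe_injective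
  refine exists_stepTower_codRestrict (A := Bundled.of A) (D := Bundled.of D)
    (hwf := inferInstanceAs (WellFoundedGT ((groupLang c).Substructure D))) GroupStep.comp
    (substructure_mem_lazardGroups hD) S P (fun i => m ≤ i) ?_ f hf ?_
  · intro S₁ hS₁ hlt
    obtain ⟨T, hT, hlt', hTS, i, hi, hs⟩ := exists_groupStep_lt h hp hlt hm hS₁
    refine ⟨T, hT, hlt', hTS, fun d hd => ?_, i, hi, hs⟩
    obtain ⟨s, hs, hz⟩ := hS₁ d hd
    exact ⟨s, hT hs, hz⟩
  · intro d hd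
    obtain ⟨y, hz⟩ := hP d hd
    exact ⟨f y, ⟨y, rfl⟩, hz⟩

theorem exists_groupTower_of_mem {A D : Bundled.{w} (groupLang c).Structure}
    (f : A ↪[groupLang c] D) (hD : D ∈ lazardGroups c p) :
    ∃ w, StepTower (lazardGroups c p) (GroupStep c p) f w := by
  obtain ⟨-, i, H, h, hp⟩ := mem_lazardGroups_iff.1 hD
  obtain ⟨w, hw, -⟩ := exists_groupTower hD h hp f ⊤ (fun x => Substructure.mem_top _) le_rfl
    (fun d _ => ⟨Structure.funMap (L := groupLang c) GroupFunc.one ![], d,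
      h.series.mem_one d, by
        have : f (Structure.funMap (L := groupLang c) GroupFunc.one ![]) = 1 :=
          (map_funMap_zero (L := groupLang c) f GroupFunc.one).trans h.one
        exact ((congrArg (· * d) this).trans (one_mul d)).symm⟩)
  exact ⟨w + 0, stepTower_of_codRestrict GroupStep.comp _ hw (.nil _ fun x => ⟨⟨x, trivial⟩, rfl⟩)⟩

theorem FactorsThroughGroupStep.exists_stepTower {A D : Type w} [(groupLang c).Structure A]
    [(groupLang c).Structure D]
    (hD : Bundled.of (c := (groupLang c).Structure) D ∈ lazardGroups c p) [Group A] [Group D]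
    {H : ℕ → Subgroup D} (h : GroupCompatible c D H) (hp : ∀ x : D, x ^ p = 1)
    (f : A ↪[groupLang c] D) {f' : A →* D} (hff' : ∀ x, f' x = f x)
    {t : D} {j m : ℕ} (hj : 1 ≤ j) (hjc : j ≤ c) (hm : 1 ≤ m)
    (hft : FactorsThroughGroupStep H f' t j m) :
    ∃ w, StepTower (lazardGroups c p) (GroupStep c p) (A := Bundled.of A) (B := Bundled.of D) f
      ({j} + w) ∧ ∀ i ∈ w, m ≤ i := by
  obtain ⟨R, hRn, hR, hRm, ht, htR, hspan, hnext⟩ := hft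
  have hfR : ∀ x, f x ∈ h.ofSubgroup R := fun x => hff' x ▸ hR x
  obtain ⟨w, hw, hwm⟩ := exists_groupTower hD h hp f (h.ofSubgroup R) hfR hm fun d hd => by
    obtain ⟨y, z, hz, rfl⟩ := hRm d hd
    exact ⟨y, z, hz, by rw [hff']⟩
  refine ⟨w, ?_, hwm⟩
  rw [add_comm]
  suffices hs : IsGroupStepEmbedding p (h.ofSubgroup R).subtype j from
    stepTower_of_codRestrict GroupStep.comp hfR hw (StepTower.single hD hs)
  refine ⟨hj, hjc, _, H, h, hp, t, ht, fun y hy => htR ?_, fun x => ?_, fun y x => ?_,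
    fun x hx => ?_⟩
  · rw [← hy]
    exact y.2
  · obtain ⟨r, hr, s, hs⟩ := hspan x
    exact ⟨⟨r, hr⟩, s, hs⟩
  · exact ⟨⟨x * y * x⁻¹, hRn.conj_mem _ y.2 x⟩, rfl⟩
  · exact ⟨⟨x, hnext hx⟩, rfl⟩

theorem hasSteppedAmalgam_groupStep (hp : p.Prime) (hcp : c < p)
    (C A B : Bundled.{w} (groupLang c).Structure)
    (f : C ↪[groupLang c] A) (g : C ↪[groupLang c] B) (i j : ℕ)
    (hC : C ∈ lazardGroups c p) (hf : GroupStep c p f i) (hg : GroupStep c p g j) :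
    HasSteppedAmalgam (lazardGroups c p) (GroupStep c p) f g {i} {j} := by
  have : NeZero p := ⟨hp.ne_zero⟩
  obtain ⟨hfin, _, HC, hHC, -⟩ := mem_lazardGroups_iff.1 hC
  obtain ⟨hi, hic, _, HA, hHA, hAp, a, ha, fa, sa, na, xa⟩ := hf
  obtain ⟨hj, hjc, _, HB, hHB, hBp, b, hb, fb, sb, nb, xb⟩ := hg
  have stepf : IsGroupStep p HC HA (hHC.toMonoidHom hHA f) i a :=
    { inj := f.injective
      mem_iff := fun k hk x => hHC.map_mem_iff hHA f hk x
      pos := hi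
      mem := ha
      notMem := fun ⟨y, hy⟩ => fa y hy
      span := sa
      normal := ⟨by
        rintro _ ⟨y, rfl⟩ x
        obtain ⟨z, hz⟩ := na y x
        exact ⟨z, hz.symm⟩⟩
      next := xa
      pow_eq_one := hAp a }
  have stepg : IsGroupStep p HC HB (hHC.toMonoidHom hHB g) j b :=
    { inj := g.injective
      mem_iff := fun k hk x => hHC.map_mem_iff hHB g hk x
      pos := hj
      mem := hb
      notMem := fun ⟨y, hy⟩ => fb y hy
      span := sb
      normal := ⟨by
        rintro _ ⟨y, rfl⟩ x
        obtain ⟨z, hz⟩ := nb y x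
        exact ⟨z, hz.symm⟩⟩
      next := xb
      pow_eq_one := hBp b }
  obtain ⟨D, HD, f', g', hHD, hDp, hf', hg', hcomp, hA, hB⟩ :=
    stepf.exists_amalgam hp hcp hHC.series hHA.series hHB.series hAp hBp stepg hic hjc
  let str := groupStructure c HD
  have hcD : GroupCompatible c D HD := groupCompatible_groupStructure hHD
  have hDK : Bundled.of (c := (groupLang c).Structure) D ∈ lazardGroups c p :=
    mem_lazardGroups_iff.2 ⟨inferInstanceAs (Finite D), _, HD, hcD, hDp⟩
  let f'' : A ↪[groupLang c] D := hHA.toEmbedding hcD f' hf'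
  let g'' : B ↪[groupLang c] D := hHB.toEmbedding hcD g' hg'
  obtain ⟨v, hv, hvm⟩ := FactorsThroughGroupStep.exists_stepTower hDK hcD hDp f'' (fun x => rfl)
    hj hjc (by omega) hA
  obtain ⟨w, hw, hwm⟩ := FactorsThroughGroupStep.exists_stepTower hDK hcD hDp g'' (fun x => rfl)
    hi hic (by omega) hB
  refine ⟨Bundled.of D, f'', g'', v, w, hDK, ?_, hv, hw, ?_, ?_⟩
  · ext y
    exact hcomp y
  · exact fun x hx => ⟨i, Multiset.mem_singleton_self i, j, Multiset.mem_singleton_self j, hvm x hx⟩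
  · exact fun x hx => ⟨i, Multiset.mem_singleton_self i, j, Multiset.mem_singleton_self j, by
      have := hwm x hx
      omega⟩

theorem exists_abelian_mem_lazardGroups (hc : 1 ≤ c) (hp : 1 ≤ p) (n : ℕ) :
    ∃ (M : Type w) (_ : (groupLang c).Structure M) (_ : Group M) (H : ℕ → Subgroup M),
      GroupCompatible c M H ∧ Nat.card M = p ^ n ∧
      Bundled.of (c := (groupLang c).Structure) M ∈ lazardGroups c p := by
  classical
  have : NeZero p := ⟨by omega⟩
  let M := ULift.{w} (Fin n → Multiplicative (ZMod p))
  let H : ℕ → Subgroup M := fun k => if k ≤ 1 then ⊤ else ⊥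
  have hfin : Finite (Multiplicative (ZMod p)) := inferInstanceAs (Finite (ZMod p))
  have hH : IsGroupLazardSeries c H := by
    refine ⟨if_pos le_rfl, fun i hi => ?_, fun k hk => if_neg (by omega), fun i j _ _ => ?_⟩
    · rw [show H (i + 1) = ⊥ from if_neg (by omega)]
      exact bot_le
    · rw [Subgroup.commutator_le]
      intro x _ y _
      rw [commutatorElement_eq_one_iff_mul_comm.2 (mul_comm x y)]
      exact one_mem _
  let str := groupStructure c H
  have h : GroupCompatible c M H := groupCompatible_groupStructure hH
  have hexp : ∀ x : M, x ^ p = 1 := by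
    intro x
    refine ULift.ext _ _ (funext fun i => ?_)
    change Multiplicative.toAdd (x.down i ^ p) = 0
    rw [toAdd_pow, nsmul_eq_mul, CharP.cast_eq_zero, zero_mul]
  have hM : Finite M := inferInstance
  let grp : Group M := inferInstance
  refine ⟨M, str, grp, H, h, ?_, mem_lazardGroups_iff.2 ⟨hM, grp, H, h, hexp⟩⟩
  rw [Nat.card_congr Equiv.ulift, Nat.card_fun, Nat.card_fin]
  congr 1
  exact Nat.card_zmod p

theorem isAmalgamationClass_lazardGroups (hc : 1 ≤ c) (hp : p.Prime) (hcp : c < p) :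
    IsAmalgamationClass (lazardGroups.{w} c p) := by
  obtain ⟨Z, str, _, H, h, hcard, hZ⟩ := exists_abelian_mem_lazardGroups.{w} hc hp.one_le 0
  have hsub : Subsingleton Z := (Nat.card_eq_one_iff_unique.1 (by rw [hcard, pow_zero])).1
  refine isAmalgamationClass_of_steps c GroupStep.comp (fun A B f i h => ⟨h.1, h.2.1⟩)
    (fun C A B f g i j hC _ _ hf hg => hasSteppedAmalgam_groupStep hp hcp C A B f g i j hC hf hg)
    (fun A B f hB => exists_groupTower_of_mem f hB) (fun M hM => ?_)
    iso_closed_lazardGroups (fun M hM S => substructure_mem_lazardGroups hM S) _ hZ ?_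
  · have : Finite M := hM.2
    exact Structure.FG.of_finite
  · intro M hM
    obtain ⟨-, _, H', h', -⟩ := mem_lazardGroups_iff.1 hM
    refine ⟨h.toEmbedding h' (1 : Z →* M) fun k hk x => ?_⟩
    rw [Subsingleton.elim x 1]
    exact iff_of_true (one_mem (H' k)) (one_mem (H k))

instance finite_groupLang_functions : Finite (Σ l, (groupLang c).Functions l) := by
  let g : Fin 3 → (Σ l, (groupLang c).Functions l) :=
    ![⟨_, GroupFunc.mul⟩, ⟨_, GroupFunc.inv⟩, ⟨_, GroupFunc.one⟩]
  refine Finite.of_surjective g ?_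
  rintro ⟨_, _ | _ | _⟩
  exacts [⟨0, rfl⟩, ⟨1, rfl⟩, ⟨2, rfl⟩]

/-- Members are finite and the language is finite, so each cardinality contributes finitely many
structures on a fixed set. -/
theorem countable_isoTypes_lazardGroups :
    (Quotient.mk' '' lazardGroups.{w} c p).Countable := by
  have : ∀ n, Finite ((groupLang c).Structure (ULift.{w} (Fin n))) := fun n =>
    have : Finite (Σ l, (groupLang c).Relations l) := finite_lazardRel
    finite_structure _
  refine countable_isoTypes (ι := Σ n : ℕ, (groupLang c).Structure (ULift.{w} (Fin n)))
    (fun x => ⟨ULift.{w} (Fin x.1), x.2⟩) fun M hM => ?_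
  have hfin : Finite M := hM.2
  let e : M ≃ ULift.{w} (Fin (Nat.card M)) := (Finite.equivFin M).trans Equiv.ulift.symm
  exact ⟨⟨_, e.inducedStructure⟩, ⟨e.inducedStructureEquiv⟩⟩

theorem isFraisseClass_lazardGroups (hc : 1 ≤ c) (hp : p.Prime) (hcp : c < p) :
    IsFraisseClass (lazardGroups.{w} c p) :=
  ⟨isAmalgamationClass_lazardGroups hc hp hcp, countable_isoTypes_lazardGroups⟩

theorem uniformlyLocallyFinite_of_age_eq_lazardGroups (hp : p.Prime) {M : Type w}
    [(groupLang c).Structure M] (hM : (groupLang c).age M = lazardGroups c p) :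
    UniformlyLocallyFinite (groupLang c) M := by
  classical
  choose N hN using exists_card_le.{w} p hp.one_le c
  refine uniformlyLocallyFinite_of_age_eq hM N fun A hA n a ha => ?_
  obtain ⟨hfin, _, H, h, hAp⟩ := mem_lazardGroups_iff.1 hA
  have ha' := h.subgroup_closure_eq_top ha
  have := hN n A H h.series hAp (Finset.univ.image a) (Finset.card_image_le.trans (by simp))
    (by rw [Finset.coe_image, Finset.coe_univ, Set.image_univ]; exact ha')
  rw [Set.encard_univ, ENat.card_eq_coe_natCard]
  exact_mod_cast this

theorem infinite_of_age_eq_lazardGroups (hc : 1 ≤ c) (hp : p.Prime) {M : Type w}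
    [(groupLang c).Structure M] (hM : (groupLang c).age M = lazardGroups c p) : Infinite M := by
  refine infinite_of_age_eq hM fun n => ?_
  obtain ⟨Z, str, _, H, h, hcard, hZ⟩ := exists_abelian_mem_lazardGroups.{w} hc hp.one_le n
  have hfin : Finite Z := hZ.2
  refine ⟨_, hZ, ?_⟩
  rw [Set.encard_univ]
  change (n : ℕ∞) ≤ ENat.card Z
  rw [ENat.card_eq_coe_natCard, hcard]
  exact_mod_cast (Nat.lt_pow_self hp.one_lt).le

end GroupClass

end LazardFraisse

/-! ### The theorem -/

theorem theorem4p37 (c : ℕ) (hc : 1 ≤ c) :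
    -- arbitrary fields
    (∀ (F : Type u) [Field F],
      LazardFraisse.IsAmalgamationClass (LazardFraisse.lazardLieAlgebras c F) ∧
      ((Countable F ∨ c = 1) →
        LazardFraisse.IsFraisseClass (LazardFraisse.lazardLieAlgebras c F))) ∧
    -- countable fields: the limit exists
    (∀ (F : Type u) [Field F] [Countable F],
      ∃ (M : Type u) (_ : (LazardFraisse.lieLang c F).Structure M) (_ : Countable M),
        IsFraisseLimit (LazardFraisse.lazardLieAlgebras c F) M) ∧
    -- finite fields
    (∀ (F : Type u) [Field F] [Finite F] (M : Type u) [(LazardFraisse.lieLang c F).Structure M]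
        [Countable M], IsFraisseLimit (LazardFraisse.lazardLieAlgebras c F) M →
      LazardFraisse.UniformlyLocallyFinite (LazardFraisse.lieLang c F) M ∧
      LazardFraisse.OmegaCategorical.{u, 0, u} ((LazardFraisse.lieLang c F).completeTheory M) ∧
      LazardFraisse.HasQuantifierElimination ((LazardFraisse.lieLang c F).completeTheory M)) ∧
    -- groups
    (∀ p : ℕ, p.Prime → c < p →
      LazardFraisse.IsFraisseClass (LazardFraisse.lazardGroups.{w} c p) ∧
      (∃ (M : Type w) (_ : (LazardFraisse.groupLang c).Structure M) (_ : Countable M),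
        IsFraisseLimit (LazardFraisse.lazardGroups.{w} c p) M) ∧
      ∀ (M : Type w) [(LazardFraisse.groupLang c).Structure M] [Countable M],
        IsFraisseLimit (LazardFraisse.lazardGroups.{w} c p) M →
        LazardFraisse.OmegaCategorical.{0, 0, w} ((LazardFraisse.groupLang c).completeTheory M) ∧
        LazardFraisse.HasQuantifierElimination
          ((LazardFraisse.groupLang c).completeTheory M)) := by
  open LazardFraisse in
  refine ⟨fun F _ => ⟨isAmalgamationClass_lazardLieAlgebras hc,
    isFraisseClass_lazardLieAlgebras hc⟩, fun F _ _ => ?_, fun F _ _ M _ _ hM => ?_,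
    fun p hp hcp => ?_⟩
  · exact exists_fraisseLimit (isFraisseClass_lazardLieAlgebras hc (Or.inl inferInstance)).isFraisse
  · have hrel : Finite (Σ l, (lieLang c F).Relations l) := finite_lazardRel
    have hulf := uniformlyLocallyFinite_of_age_eq_lazardLieAlgebras hM.age
    have hinf := infinite_of_age_eq_lazardLieAlgebras hc hM.age
    exact ⟨hulf, omegaCategorical_completeTheory hM.ultrahomogeneous hulf.hasIsolatedQFTypes,
      hasQuantifierElimination_completeTheory hM.ultrahomogeneous hulf.hasIsolatedQFTypes⟩
  · have hrel : Finite (Σ l, (groupLang c).Relations l) := finite_lazardRel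
    have hK := isFraisseClass_lazardGroups.{w} hc hp hcp
    refine ⟨hK, exists_fraisseLimit hK.isFraisse, fun M _ _ hM => ?_⟩
    have hulf := uniformlyLocallyFinite_of_age_eq_lazardGroups hp hM.age
    have hinf := infinite_of_age_eq_lazardGroups hc hp hM.age
    exact ⟨omegaCategorical_completeTheory hM.ultrahomogeneous hulf.hasIsolatedQFTypes,
      hasQuantifierElimination_completeTheory hM.ultrahomogeneous hulf.hasIsolatedQFTypes⟩
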